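/- Let $\{f_\theta:\theta\in\Theta\subseteq\mathbb R^p\}$ be an identifiable family of densities with common support with respect to a $\sigma$-finite measure $\mu$. Let $\Theta_0=\{\theta\in\Theta:h(\theta)=0\}$ with $h:\mathbb R^p\to\mathbb R^r$, let $H(\theta)=\partial h(\theta)/\partial\theta$ ($p\times r$), and put $u_\theta=\nabla_\theta\log f_\theta$, $i_\theta=-\nabla^2_\theta\log f_\theta$. For $\gamma\in[0,1]$, $\lambda\in\mathbb R$, $A=1+\lambda(1-\gamma)$, $B=\gamma-\lambda(1-\gamma)$, the $S$-divergence is $$S_{(\gamma,\lambda)}(g,f)=\frac1A\int f^{1+\gamma}-\frac{1+\gamma}{AB}\int f^Bg^A+\frac1B\int g^{1+\gamma}$$ (continuous limits if $A=0$ or $B=0$). Fix $\beta\ge0$. The observations $X_1,X_2,\dots$ are i.i.d. with density $f_{\theta^*}$, where $\theta^*\in\Theta\setminus\Theta_0$. Let $\psi_n(\theta)=\frac1n\sum_{i\le n}u_\theta(X_i)f_\theta(X_i)^\beta-\int u_\theta f_\theta^{1+\beta}$ and $\psi(\theta)=E_{\theta^*}[u_\theta f_\theta^\beta]-\int u_\theta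 f_\theta^{1+\beta}$. The estimating equation of the minimum density power divergence estimator is $\psi_n(\theta)=0$; under the restriction it is $\psi_n(\theta)+H(\theta)\ell=0$, $h(\theta)=0$, with a Lagrange multiplier $\ell$. The risk is $R(\theta)=\frac1{1+\beta}\int f_\theta^{1+\beta}-E_{\theta^*}[f_\theta^\beta/\beta]$ (with $\log f_\theta$ in place of $f_\theta^\beta/\beta$ if $\beta=0$). Let $\theta_0\in\Theta_0$ be a (local) minimizer of $R$ over $\Theta_0$ (restricted best fitting parameter). Assume, near $\theta=\theta^*$ and near $\theta=\theta_0$ (both interior to $\Theta$), with true density $f_{\theta^*}$: $f_\theta(x)$ is $C^3$ in $\theta$ for almost all $x$; $\int f_\theta^{1+\beta}$ and $E_{\theta^*}[f_\theta^\beta]$ ($E_{\theta^*}[\log f_\theta]$ if $\beta=0$) exist and can be differentiated three times under the integral sign; the third derivatives in $\theta$ of $\frac1{1+\beta}\int f_\theta^{1+\beta}-f_\theta(x)^\beta/\beta$ (resp. with $\log f_\theta(x)$) are dominated by an $f_{\theta^*}$-integrable function of $x$; and $u_\theta f_\theta^\beta$ has finite second moments at $\theta=\theta^*,\theta_0$.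 Let $$J(\theta)=\int\left[u_\theta u_\theta^Tf_\theta^{1+\beta}+(i_\theta-\beta u_\theta u_\theta^T)(f_{\theta^*}-f_\theta)f_\theta^\beta\right],$$ and assume that $J(\theta^*)$ is positive definite. Assume that $h$ is $C^2$ near $\theta_0$, that $H(\theta_0)$ has rank $r$, and that $\tilde J=J(\theta_0)-\sum_k\ell_k\nabla^2h_k(\theta_0)$, with $\ell$ determined by $\psi(\theta_0)+H(\theta_0)\ell=0$, satisfies $v^T\tilde Jv>0$ for all $v\ne0$ with $H(\theta_0)^Tv=0$. Assume that $S_{(\gamma,\lambda)}(f_{\theta_1},f_{\theta_2})$ is finite (all its integrals converge) for $(\theta_1,\theta_2)$ near $(\theta^*,\theta_0)$ and differentiable at $(\theta^*,\theta_0)$. Let $P$ be the upper left $p\times p$ block of $\begin{pmatrix}\tilde J&H(\theta_0)\\H(\theta_0)^T&0\end{pmatrix}^{-1}$, let $C(\theta,\theta')=\operatorname{Cov}_{\theta^*}(u_\theta f_\theta^\beta,u_{\theta'}f_{\theta'}^\beta)$, and put $\Sigma=J(\theta^*)^{-1}C(\theta^*,\theta^*)J(\theta^*)^{-1}$, $V=C(\theta_0,\theta_0)$,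 $A_{12}=J(\theta^*)^{-1}C(\theta^*,\theta_0)P$, $M_1=\nabla_\theta S_{(\gamma,\lambda)}(f_\theta,f_{\theta_0})|_{\theta=\theta^*}$, $M_2=\nabla_\theta S_{(\gamma,\lambda)}(f_{\theta^*},f_\theta)|_{\theta=\theta_0}$, and $$\tilde\sigma^2=M_1^T\Sigma M_1+M_1^TA_{12}M_2+M_2^TA_{12}^TM_1+M_2^TPVPM_2 .$$ For $\alpha\in(0,1)$ let $\tilde t_\alpha$ be the $(1-\alpha)$-quantile of the asymptotic null distribution of the test statistic at $\theta_0$, that is, of $\sum_i\zeta_iZ_i^2$ with independent standard normal $Z_i$, where the $\zeta_i$ are the nonzero eigenvalues of $A_\gamma[J_0^{-1}-P_0]V_0[J_0^{-1}-P_0]$; here $A_\gamma=(1+\gamma)\int u_{\theta_0}u_{\theta_0}^Tf_{\theta_0}^{1+\gamma}$, and $J_0,P_0,V_0$ are $J(\theta_0),P,V$ computed with true density $f_{\theta_0}$ instead of $f_{\theta^*}$. Then there are measurable estimators $\hat\theta_n\to\theta^*$ and $\tilde\theta_n\to\theta_0$ (in probability) that solve the unrestricted and the restricted estimating equations, respectively,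 with probability tending to one. For any such estimators, with $T_n=2nS_{(\gamma,\lambda)}(f_{\hat\theta_n},f_{\tilde\theta_n})$: 1. $\sqrt n\,(\hat\theta_n-\theta^*,\tilde\theta_n-\theta_0)$ converges in distribution to the normal law with mean $0$ and covariance matrix $\begin{pmatrix}\Sigma&A_{12}\\A_{12}^T&PVP\end{pmatrix}$. 2. If $\tilde\sigma>0$, then $$P_{\theta^*}(T_n>c)-\left[1-\Phi\left(\frac{\sqrt n}{\tilde\sigma}\left(\frac c{2n}-S_{(\gamma,\lambda)}(f_{\theta^*},f_{\theta_0})\right)\right)\right]\to0\quad(n\to\infty)$$ uniformly in $c\in\mathbb R$; in particular this holds at $c=\tilde t_\alpha$, for every $\alpha\in(0,1)$. 3. The test is consistent: $P_{\theta^*}(T_n>\tilde t_\alpha)\to1$ for every $\alpha\in(0,1)$. -/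

import Mathlib

open MeasureTheory ProbabilityTheory Filter Topology Matrix

namespace SDivTest

noncomputable section

/-! ### Parametric model and sample -/

/-- The space `ℝᵖ` with the Euclidean norm, in which parameters live. -/
abbrev Param (p : ℕ) := EuclideanSpace ℝ (Fin p)

/-- The distribution with density `g` with respect to the dominating measure `μ`. -/
def law {𝒳 : Type*} [MeasurableSpace 𝒳] (μ : Measure 𝒳) (g : 𝒳 → ℝ) : Measure 𝒳 :=
  μ.withDensity fun x => ENNReal.ofReal (g x)

/-- `{f θ : θ ∈ Θ}` is an identifiable family of probability densities with respect to `μ` with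
common support. -/
structure IsModel {p : ℕ} {𝒳 : Type*} [MeasurableSpace 𝒳] (μ : Measure 𝒳) (Θ : Set (Param p))
    (f : Param p → 𝒳 → ℝ) : Prop where
  measurable : ∀ θ ∈ Θ, Measurable (f θ)
  nonneg : ∀ θ ∈ Θ, ∀ x, 0 ≤ f θ x
  lintegral_eq_one : ∀ θ ∈ Θ, ∫⁻ x, ENNReal.ofReal (f θ x) ∂μ = 1
  common_support : ∀ θ ∈ Θ, ∀ θ' ∈ Θ, ∀ x, 0 < f θ x ↔ 0 < f θ' x
  identifiable : ∀ θ ∈ Θ, ∀ θ' ∈ Θ, law μ (f θ) = law μ (f θ') → θ = θ'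

/-- The null parameter space `Θ₀ = {θ ∈ Θ : h θ = 0}`. -/
def nullSpace {p r : ℕ} (Θ : Set (Param p)) (h : Param p → Fin r → ℝ) : Set (Param p) :=
  {θ | θ ∈ Θ ∧ h θ = 0}

/-- The first `n` observations. -/
def sample {𝒳 Ω : Type*} (X : ℕ → Ω → 𝒳) (n : ℕ) (ω : Ω) : Fin n → 𝒳 := fun i => X i ω

/-! ### Derivatives in coordinates -/

/-- The gradient, as a vector of partial derivatives. -/
def grad {p : ℕ} (F : Param p → ℝ) (θ : Param p) : Fin p → ℝ :=
  fun j => fderiv ℝ F θ (EuclideanSpace.single j 1)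

/-- The Hessian, as a matrix of second partial derivatives. -/
def hess {p : ℕ} (F : Param p → ℝ) (θ : Param p) : Matrix (Fin p) (Fin p) ℝ :=
  Matrix.of fun j k =>
    iteratedFDeriv ℝ 2 F θ ![EuclideanSpace.single j 1, EuclideanSpace.single k 1]

/-- The `p × r` matrix `H(θ) = ∂h(θ)/∂θ`. -/
def restrMatrix {p r : ℕ} (h : Param p → Fin r → ℝ) (θ : Param p) : Matrix (Fin p) (Fin r) ℝ :=
  Matrix.of fun j k => grad (fun t => h t k) θ j

/-- The score `u_θ(x) = ∇_θ log f_θ(x)`. -/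
def score {p : ℕ} {𝒳 : Type*} (f : Param p → 𝒳 → ℝ) (θ : Param p) (x : 𝒳) : Fin p → ℝ :=
  grad (fun t => Real.log (f t x)) θ

/-- The information function `i_θ(x) = -∇²_θ log f_θ(x)`. -/
def info {p : ℕ} {𝒳 : Type*} (f : Param p → 𝒳 → ℝ) (θ : Param p) (x : 𝒳) :
    Matrix (Fin p) (Fin p) ℝ :=
  -hess (fun t => Real.log (f t x)) θ

/-! ### The `S`-divergence -/

/-- The tuning constant `A = 1 + λ (1 - γ)`. -/
def cA (γ lam : ℝ) : ℝ := 1 + lam * (1 - γ)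

/-- The tuning constant `B = γ - λ (1 - γ)`. -/
def cB (γ lam : ℝ) : ℝ := γ - lam * (1 - γ)

/-- The `S`-divergence `S_{(γ,λ)}(g, f)`; for `A = 0` and for `B = 0` it is given by the continuous
limits of the general formula. -/
def sDiv {𝒳 : Type*} [MeasurableSpace 𝒳] (μ : Measure 𝒳) (γ lam : ℝ) (g f : 𝒳 → ℝ) : ℝ :=
  if cA γ lam = 0 then
    (∫ x, f x ^ (1 + γ) * Real.log (f x / g x) ∂μ)
      - (1 / (1 + γ)) * ((∫ x, f x ^ (1 + γ) ∂μ) - ∫ x, g x ^ (1 + γ) ∂μ)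
  else if cB γ lam = 0 then
    (∫ x, g x ^ (1 + γ) * Real.log (g x / f x) ∂μ)
      - (1 / (1 + γ)) * ((∫ x, g x ^ (1 + γ) ∂μ) - ∫ x, f x ^ (1 + γ) ∂μ)
  else
    (1 / cA γ lam) * (∫ x, f x ^ (1 + γ) ∂μ)
      - ((1 + γ) / (cA γ lam * cB γ lam)) * (∫ x, f x ^ cB γ lam * g x ^ cA γ lam ∂μ)
      + (1 / cB γ lam) * ∫ x, g x ^ (1 + γ) ∂μ

/-- All integrals in the definition of `S_{(γ,λ)}(g, f)` are finite. -/
def SDivFinite {𝒳 : Type*} [MeasurableSpace 𝒳] (μ : Measure 𝒳) (γ lam : ℝ) (g f : 𝒳 → ℝ) : Prop :=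
  Integrable (fun x => g x ^ (1 + γ)) μ ∧ Integrable (fun x => f x ^ (1 + γ)) μ ∧
    if cA γ lam = 0 then Integrable (fun x => f x ^ (1 + γ) * Real.log (f x / g x)) μ
    else if cB γ lam = 0 then Integrable (fun x => g x ^ (1 + γ) * Real.log (g x / f x)) μ
    else Integrable (fun x => f x ^ cB γ lam * g x ^ cA γ lam) μ

/-! ### Minimum density power divergence estimation -/

/-- `t ^ β / β`, replaced by its continuous analogue `log t` for `β = 0`. -/
def boxCox (β t : ℝ) : ℝ := if β = 0 then Real.log t else t ^ β / β

/-- The loss of one observation `x`. Up to the positive factor `1 + β` and terms free of `θ`, its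
mean under the density `g` is the density power divergence between `g` and `f θ`
(the Kullback-Leibler divergence for `β = 0`). -/
def dpdLoss {p : ℕ} {𝒳 : Type*} [MeasurableSpace 𝒳] (μ : Measure 𝒳) (f : Param p → 𝒳 → ℝ) (β : ℝ)
    (θ : Param p) (x : 𝒳) : ℝ :=
  (1 / (1 + β)) * (∫ y, f θ y ^ (1 + β) ∂μ) - boxCox β (f θ x)

/-- The mean loss at `θ` when `g` is the true density. -/
def dpdRisk {p : ℕ} {𝒳 : Type*} [MeasurableSpace 𝒳] (μ : Measure 𝒳) (f : Param p → 𝒳 → ℝ) (β : ℝ)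
    (g : 𝒳 → ℝ) (θ : Param p) : ℝ :=
  ∫ x, dpdLoss μ f β θ x ∂(law μ g)

/-- The contribution `u_θ(x) f_θ(x) ^ β` of one observation to the estimating equation. -/
def wscore {p : ℕ} {𝒳 : Type*} (f : Param p → 𝒳 → ℝ) (β : ℝ) (θ : Param p) (x : 𝒳) : Fin p → ℝ :=
  fun j => score f θ x j * f θ x ^ β

/-- The estimating function
`n⁻¹ ∑ᵢ u_θ(xᵢ) f_θ(xᵢ) ^ β - ∫ u_θ f_θ ^ (1 + β)` of the minimum density power divergence
estimator. -/
def estFun {p : ℕ} {𝒳 : Type*} [MeasurableSpace 𝒳] (μ : Measure 𝒳) (f : Param p → 𝒳 → ℝ) (β : ℝ)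
    {n : ℕ} (x : Fin n → 𝒳) (θ : Param p) : Fin p → ℝ :=
  fun j => (1 / (n : ℝ)) * (∑ i, wscore f β θ (x i) j) - ∫ y, score f θ y j * f θ y ^ (1 + β) ∂μ

/-- The population version of `estFun` when `g` is the true density. -/
def popEstFun {p : ℕ} {𝒳 : Type*} [MeasurableSpace 𝒳] (μ : Measure 𝒳) (f : Param p → 𝒳 → ℝ) (β : ℝ)
    (g : 𝒳 → ℝ) (θ : Param p) : Fin p → ℝ :=
  fun j => (∫ y, wscore f β θ y j ∂(law μ g)) - ∫ y, score f θ y j * f θ y ^ (1 + β) ∂μ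

/-- `est` is a consistent (for `θs`) sequence of roots of the unrestricted estimating equations:
measurable functions of the data, converging in probability to `θs`, which solve the equations
with probability tending to one. -/
structure IsConsistentRoot {p : ℕ} {𝒳 Ω : Type*} [MeasurableSpace 𝒳] [MeasurableSpace Ω]
    (μ : Measure 𝒳) (Θ : Set (Param p)) (f : Param p → 𝒳 → ℝ) (β : ℝ)
    (P : Measure Ω) (X : ℕ → Ω → 𝒳) (θs : Param p)
    (est : (n : ℕ) → (Fin n → 𝒳) → Param p) : Prop where
  measurable : ∀ n, Measurable (est n)
  consistent : TendstoInMeasure P (fun n ω => est n (sample X n ω)) atTop fun _ => θs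
  root : Tendsto (fun n => P {ω | ¬ (est n (sample X n ω) ∈ Θ ∧
    estFun μ f β (sample X n ω) (est n (sample X n ω)) = 0)}) atTop (𝓝 0)

/-- `est` is a consistent (for `θ₀`) sequence of roots of the restricted estimating equations,
with a vector `ℓ` of Lagrange multipliers. -/
structure IsConsistentRestrictedRoot {p r : ℕ} {𝒳 Ω : Type*} [MeasurableSpace 𝒳]
    [MeasurableSpace Ω] (μ : Measure 𝒳) (Θ : Set (Param p)) (h : Param p → Fin r → ℝ)
    (f : Param p → 𝒳 → ℝ) (β : ℝ) (P : Measure Ω) (X : ℕ → Ω → 𝒳) (θ₀ : Param p)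
    (est : (n : ℕ) → (Fin n → 𝒳) → Param p) : Prop where
  measurable : ∀ n, Measurable (est n)
  consistent : TendstoInMeasure P (fun n ω => est n (sample X n ω)) atTop fun _ => θ₀
  root : Tendsto (fun n => P {ω | ¬ (est n (sample X n ω) ∈ nullSpace Θ h ∧
    ∃ ℓ : Fin r → ℝ, estFun μ f β (sample X n ω) (est n (sample X n ω))
      + restrMatrix h (est n (sample X n ω)) *ᵥ ℓ = 0)}) atTop (𝓝 0)

/-! ### Regularity conditions -/

/-- On `ω`, the integral `∫ F θ x dν(x)` exists, is three times differentiable in `θ`, and the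
derivatives can be taken under the integral sign. -/
def DiffUnderIntegral {p : ℕ} {𝒳 : Type*} [MeasurableSpace 𝒳] (ν : Measure 𝒳)
    (F : Param p → 𝒳 → ℝ) (ω : Set (Param p)) : Prop :=
  (ContDiffOn ℝ 2 (fun t => ∫ x, F t x ∂ν) ω ∧
    DifferentiableOn ℝ (iteratedFDeriv ℝ 2 (fun t => ∫ x, F t x ∂ν)) ω) ∧
  ∀ θ ∈ ω, ∀ k ≤ 3,
    Integrable (fun x => iteratedFDeriv ℝ k (fun t => F t x) θ) ν ∧
    iteratedFDeriv ℝ k (fun t => ∫ x, F t x ∂ν) θ =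
      ∫ x, iteratedFDeriv ℝ k (fun t => F t x) θ ∂ν

/-- Smoothness and domination conditions for minimum density power divergence estimation near
the interior point `θ` of `Θ` when `g` is the true density. -/
structure IsRegularAt {p : ℕ} {𝒳 : Type*} [MeasurableSpace 𝒳] (μ : Measure 𝒳) (Θ : Set (Param p))
    (f : Param p → 𝒳 → ℝ) (β : ℝ) (g : 𝒳 → ℝ) (θ : Param p) : Prop where
  exists_nhd : ∃ ω : Set (Param p), IsOpen ω ∧ ω ⊆ Θ ∧ θ ∈ ω ∧
    (∀ᵐ x ∂μ, ContDiffOn ℝ 3 (fun t => f t x) ω) ∧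
    DiffUnderIntegral μ (fun t x => f t x ^ (1 + β)) ω ∧
    DiffUnderIntegral (law μ g) (fun t x => boxCox β (f t x)) ω ∧
    ∃ M : 𝒳 → ℝ, Integrable M (law μ g) ∧
      ∀ᵐ x ∂(law μ g), ∀ t ∈ ω, ‖iteratedFDeriv ℝ 3 (fun s => dpdLoss μ f β s x) t‖ ≤ M x
  memLp_wscore : ∀ j, MemLp (fun x => wscore f β θ x j) 2 (law μ g)

/-! ### The matrices of the asymptotic theory -/

/-- The matrix
`J = ∫ u uᵀ f_θ ^ (1 + β) + ∫ (i_θ - β u uᵀ) (g - f_θ) f_θ ^ β`; for `g = f_θ` it is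
`∫ u uᵀ f_θ ^ (1 + β)`. -/
def matJ {p : ℕ} {𝒳 : Type*} [MeasurableSpace 𝒳] (μ : Measure 𝒳) (f : Param p → 𝒳 → ℝ) (β : ℝ)
    (g : 𝒳 → ℝ) (θ : Param p) : Matrix (Fin p) (Fin p) ℝ :=
  Matrix.of fun j k => ∫ x, (score f θ x j * score f θ x k * f θ x ^ (1 + β)
    + (info f θ x j k - β * (score f θ x j * score f θ x k)) * (g x - f θ x) * f θ x ^ β) ∂μ

/-- The covariance matrix of `u_θ f_θ ^ β` and `u_θ' f_θ' ^ β` under the density `g`. -/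
def matC {p : ℕ} {𝒳 : Type*} [MeasurableSpace 𝒳] (μ : Measure 𝒳) (f : Param p → 𝒳 → ℝ) (β : ℝ)
    (g : 𝒳 → ℝ) (θ θ' : Param p) : Matrix (Fin p) (Fin p) ℝ :=
  Matrix.of fun j k => covariance (fun x => wscore f β θ x j) (fun x => wscore f β θ' x k) (law μ g)

/-- The matrix `V = ∫ u uᵀ f_θ ^ (2 β) g - ξ ξᵀ` with `ξ = ∫ u f_θ ^ β g`. -/
def matV {p : ℕ} {𝒳 : Type*} [MeasurableSpace 𝒳] (μ : Measure 𝒳) (f : Param p → 𝒳 → ℝ) (β : ℝ)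
    (g : 𝒳 → ℝ) (θ : Param p) : Matrix (Fin p) (Fin p) ℝ :=
  matC μ f β g θ θ

/-- The Lagrange multiplier at a restricted best fitting parameter: the solution `ℓ` of
`popEstFun + H ℓ = 0`, computed by least squares. -/
def multiplier {p r : ℕ} {𝒳 : Type*} [MeasurableSpace 𝒳] (μ : Measure 𝒳) (f : Param p → 𝒳 → ℝ)
    (h : Param p → Fin r → ℝ) (β : ℝ) (g : 𝒳 → ℝ) (θ : Param p) : Fin r → ℝ :=
  -((((restrMatrix h θ)ᵀ * restrMatrix h θ)⁻¹ * (restrMatrix h θ)ᵀ) *ᵥ popEstFun μ f β g θ)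

/-- The matrix `J` of the restricted problem: the Hessian of its Lagrangian. It is `matJ` if `h` is
affine, and also if `g = f_θ` (the multiplier then vanishes). -/
def matJres {p r : ℕ} {𝒳 : Type*} [MeasurableSpace 𝒳] (μ : Measure 𝒳) (f : Param p → 𝒳 → ℝ)
    (h : Param p → Fin r → ℝ) (β : ℝ) (g : 𝒳 → ℝ) (θ : Param p) : Matrix (Fin p) (Fin p) ℝ :=
  matJ μ f β g θ - ∑ k, multiplier μ f h β g θ k • hess (fun t => h t k) θ

/-- The upper left block of the inverse of `[[J, H], [Hᵀ, 0]]`. For invertible `J` it is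
`J⁻¹ - J⁻¹ H (Hᵀ J⁻¹ H)⁻¹ Hᵀ J⁻¹`. -/
def blockP {p r : ℕ} (J : Matrix (Fin p) (Fin p) ℝ) (H : Matrix (Fin p) (Fin r) ℝ) :
    Matrix (Fin p) (Fin p) ℝ :=
  (Matrix.fromBlocks J H Hᵀ 0)⁻¹.toBlocks₁₁

/-- The matrix `P` of the restricted estimator at `θ` when `g` is the true density. -/
def matP {p r : ℕ} {𝒳 : Type*} [MeasurableSpace 𝒳] (μ : Measure 𝒳) (f : Param p → 𝒳 → ℝ)
    (h : Param p → Fin r → ℝ) (β : ℝ) (g : 𝒳 → ℝ) (θ : Param p) : Matrix (Fin p) (Fin p) ℝ :=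
  blockP (matJres μ f h β g θ) (restrMatrix h θ)

/-- `Σ = J⁻¹ V J⁻¹` at the true parameter `θs`. -/
def covUnres {p : ℕ} {𝒳 : Type*} [MeasurableSpace 𝒳] (μ : Measure 𝒳) (f : Param p → 𝒳 → ℝ) (β : ℝ)
    (θs : Param p) : Matrix (Fin p) (Fin p) ℝ :=
  (matJ μ f β (f θs) θs)⁻¹ * matV μ f β (f θs) θs * (matJ μ f β (f θs) θs)⁻¹

/-- `P V P` at the restricted best fitting parameter `θ₀`, the true density being `f θs`. -/
def covRes {p r : ℕ} {𝒳 : Type*} [MeasurableSpace 𝒳] (μ : Measure 𝒳) (f : Param p → 𝒳 → ℝ)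
    (h : Param p → Fin r → ℝ) (β : ℝ) (θs θ₀ : Param p) : Matrix (Fin p) (Fin p) ℝ :=
  matP μ f h β (f θs) θ₀ * matV μ f β (f θs) θ₀ * matP μ f h β (f θs) θ₀

/-- The asymptotic cross-covariance `A₁₂` of the unrestricted and the restricted estimator. -/
def covCross {p r : ℕ} {𝒳 : Type*} [MeasurableSpace 𝒳] (μ : Measure 𝒳) (f : Param p → 𝒳 → ℝ)
    (h : Param p → Fin r → ℝ) (β : ℝ) (θs θ₀ : Param p) : Matrix (Fin p) (Fin p) ℝ :=
  (matJ μ f β (f θs) θs)⁻¹ * matC μ f β (f θs) θs θ₀ * matP μ f h β (f θs) θ₀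

/-- The joint asymptotic covariance matrix of the two estimators. -/
def covJoint {p r : ℕ} {𝒳 : Type*} [MeasurableSpace 𝒳] (μ : Measure 𝒳) (f : Param p → 𝒳 → ℝ)
    (h : Param p → Fin r → ℝ) (β : ℝ) (θs θ₀ : Param p) :
    Matrix (Fin p ⊕ Fin p) (Fin p ⊕ Fin p) ℝ :=
  Matrix.fromBlocks (covUnres μ f β θs) (covCross μ f h β θs θ₀)
    (covCross μ f h β θs θ₀)ᵀ (covRes μ f h β θs θ₀)

/-- `M₁ = ∇_θ S(f_θ, f_θ₀)` at `θ = θs`. -/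
def gradM1 {p : ℕ} {𝒳 : Type*} [MeasurableSpace 𝒳] (μ : Measure 𝒳) (f : Param p → 𝒳 → ℝ)
    (γ lam : ℝ) (θs θ₀ : Param p) : Fin p → ℝ :=
  grad (fun t => sDiv μ γ lam (f t) (f θ₀)) θs

/-- `M₂ = ∇_θ S(f_θs, f_θ)` at `θ = θ₀`. -/
def gradM2 {p : ℕ} {𝒳 : Type*} [MeasurableSpace 𝒳] (μ : Measure 𝒳) (f : Param p → 𝒳 → ℝ)
    (γ lam : ℝ) (θs θ₀ : Param p) : Fin p → ℝ :=
  grad (fun t => sDiv μ γ lam (f θs) (f t)) θ₀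

/-- The asymptotic variance
`σ² = M₁ᵀ Σ M₁ + M₁ᵀ A₁₂ M₂ + M₂ᵀ A₁₂ᵀ M₁ + M₂ᵀ P V P M₂`. -/
def sigmaSq {p r : ℕ} {𝒳 : Type*} [MeasurableSpace 𝒳] (μ : Measure 𝒳) (f : Param p → 𝒳 → ℝ)
    (h : Param p → Fin r → ℝ) (β γ lam : ℝ) (θs θ₀ : Param p) : ℝ :=
  gradM1 μ f γ lam θs θ₀ ⬝ᵥ covUnres μ f β θs *ᵥ gradM1 μ f γ lam θs θ₀
    + gradM1 μ f γ lam θs θ₀ ⬝ᵥ covCross μ f h β θs θ₀ *ᵥ gradM2 μ f γ lam θs θ₀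
    + gradM2 μ f γ lam θs θ₀ ⬝ᵥ (covCross μ f h β θs θ₀)ᵀ *ᵥ gradM1 μ f γ lam θs θ₀
    + gradM2 μ f γ lam θs θ₀ ⬝ᵥ covRes μ f h β θs θ₀ *ᵥ gradM2 μ f γ lam θs θ₀

/-! ### The test -/

/-- The test statistic `2 n S_{(γ,λ)}(f_θ̂, f_θ̃)`. -/
def testStat {p : ℕ} {𝒳 : Type*} [MeasurableSpace 𝒳] (μ : Measure 𝒳) (f : Param p → 𝒳 → ℝ)
    (γ lam : ℝ) (est rest : (n : ℕ) → (Fin n → 𝒳) → Param p) (n : ℕ) (x : Fin n → 𝒳) : ℝ :=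
  2 * n * sDiv μ γ lam (f (est n x)) (f (rest n x))

/-- The power of the test with critical value `c` based on `n` observations. -/
def power {p : ℕ} {𝒳 Ω : Type*} [MeasurableSpace 𝒳] [MeasurableSpace Ω] (μ : Measure 𝒳)
    (f : Param p → 𝒳 → ℝ) (γ lam : ℝ) (est rest : (n : ℕ) → (Fin n → 𝒳) → Param p)
    (P : Measure Ω) (X : ℕ → Ω → 𝒳) (n : ℕ) (c : ℝ) : ℝ :=
  P.real {ω | c < testStat μ f γ lam est rest n (sample X n ω)}

/-- The approximation `1 - Φ((√n / σ) (c / (2 n) - S(f_θs, f_θ₀)))` to the power. -/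
def powerApprox {p r : ℕ} {𝒳 : Type*} [MeasurableSpace 𝒳] (μ : Measure 𝒳) (f : Param p → 𝒳 → ℝ)
    (h : Param p → Fin r → ℝ) (β γ lam : ℝ) (θs θ₀ : Param p) (n : ℕ) (c : ℝ) : ℝ :=
  1 - cdf (gaussianReal 0 1) (√n / √(sigmaSq μ f h β γ lam θs θ₀) *
    (c / (2 * n) - sDiv μ γ lam (f θs) (f θ₀)))

/-- `A_γ(θ) = (1 + γ) ∫ u uᵀ f_θ ^ (1 + γ)`, the Hessian of `t ↦ S_{(γ,λ)}(f_t, f_θ)` at `t = θ`. -/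
def matA {p : ℕ} {𝒳 : Type*} [MeasurableSpace 𝒳] (μ : Measure 𝒳) (f : Param p → 𝒳 → ℝ) (γ : ℝ)
    (θ : Param p) : Matrix (Fin p) (Fin p) ℝ :=
  Matrix.of fun j k => (1 + γ) * ∫ x, score f θ x j * score f θ x k * f θ x ^ (1 + γ) ∂μ

/-- `[J⁻¹ - P] V [J⁻¹ - P]` at the null parameter `θ₀`, the true density being `f θ₀`. -/
def nullCov {p r : ℕ} {𝒳 : Type*} [MeasurableSpace 𝒳] (μ : Measure 𝒳) (f : Param p → 𝒳 → ℝ)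
    (h : Param p → Fin r → ℝ) (β : ℝ) (θ₀ : Param p) : Matrix (Fin p) (Fin p) ℝ :=
  ((matJ μ f β (f θ₀) θ₀)⁻¹ - matP μ f h β (f θ₀) θ₀) * matV μ f β (f θ₀) θ₀ *
    ((matJ μ f β (f θ₀) θ₀)⁻¹ - matP μ f h β (f θ₀) θ₀)

/-- The distribution of `∑ᵢ ζᵢ Zᵢ²` with independent standard normal `Zᵢ`. -/
def chiSqMixture (ζ : List ℝ) : Measure ℝ :=
  (Measure.pi fun _ : Fin ζ.length => gaussianReal 0 1).map fun z => ∑ i, ζ.get i * z i ^ 2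

/-- The asymptotic null distribution of the test statistic at `θ₀`: the distribution of
`∑ᵢ ζᵢ Zᵢ²`, where the `ζᵢ` are the nonzero eigenvalues, with multiplicity, of
`A_γ(θ₀) [J⁻¹ - P] V [J⁻¹ - P]`. -/
def nullLaw {p r : ℕ} {𝒳 : Type*} [MeasurableSpace 𝒳] (μ : Measure 𝒳) (f : Param p → 𝒳 → ℝ)
    (h : Param p → Fin r → ℝ) (β γ : ℝ) (θ₀ : Param p) : Measure ℝ :=
  chiSqMixture (((matA μ f γ θ₀ * nullCov μ f h β θ₀).charpoly.roots.filter (· ≠ 0)).toList)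

/-- The lower `q`-quantile of a probability measure on the line. -/
def quantile (ν : Measure ℝ) (q : ℝ) : ℝ := sInf {t | q ≤ cdf ν t}

/-- The critical value `t_α`: the `(1 - α)`-quantile of the asymptotic null distribution. -/
def critValue {p r : ℕ} {𝒳 : Type*} [MeasurableSpace 𝒳] (μ : Measure 𝒳) (f : Param p → 𝒳 → ℝ)
    (h : Param p → Fin r → ℝ) (β γ : ℝ) (θ₀ : Param p) (α : ℝ) : ℝ :=
  quantile (nullLaw μ f h β γ θ₀) (1 - α)

end

end SDivTest

open SDivTest

/-! The estimating equations are the Lagrange equations for the sample mean of `dpdLoss`: its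
gradient is minus the estimating function and its mean Hessian is `matJ`. The unrestricted estimator
is a restricted one with an empty system of constraints (`Fin 0`), so a single theory of constrained
M-estimation serves both.

Existence. The Hessian of the Lagrangian is positive on the kernel of `h'(θ₀)`, and along the
constraint set `h'(θ₀) (θ - θ₀)` is of second order. Hence the criterion grows quadratically there,
even after small perturbations of its gradient and Hessian (`exists_norm_sub_le_of_le_constrained`).
By the law of large numbers this applies to the empirical criterion: its minimizer over a small
compact piece of the constraint set lies within a constant times the gradient error of `θ₀`. It is
therefore consistent, eventually interior, and a root by Lagrange's theorem. The minimizer can be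
chosen measurably (`exists_measurable_isMinOn`).

Normality. Inverting the bordered matrix gives `P H = 0` and `P J̃ + B Hᵀ = 1`: multiplying the
estimating equation by `P` removes the unknown multiplier and solves for the displacement. So every
consistent root is, up to `o(1/√n)` in probability, `θ₀` plus the centred mean of `P u f ^ β`
(`exists_norm_linearization_le`, `RestrictedProblem.holdsWHP_linearization`). Both estimators use
the same sample, so the central limit theorem for the pair of influence functions yields the joint
law, with `A₁₂` as cross-covariance.

Power. At the pair of limits the divergence is differentiable with partial gradients `M₁` and `M₂`.
The delta method and the scalar central limit theorem give the limit variance of the statistic, and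
since the limiting tail is continuous, Pólya's argument makes the convergence uniform in the
critical value.

Consistency. The integrand of the divergence can be written as `f ^ B g ^ A ∫₀ᵈ (exp (A z) - exp (-B
z)) dz` with `d = log (f / g)`. It is positive unless `d = 0`, because `A + B = 1 + γ > 0`. By
identifiability the limiting divergence is positive, so with high probability the statistic exceeds
a positive multiple of `n`, while the critical value stays fixed. -/

namespace SDivTest

set_option maxSynthPendingDepth 3

/-! ### Events of probability tending to one -/

/-- The statement `A n` holds with (outer) probability tending to one. -/
def HoldsWHP {Ω : Type*} [MeasurableSpace Ω] (P : Measure Ω) (A : ℕ → Ω → Prop) : Prop :=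
  Tendsto (fun n => P {ω | ¬ A n ω}) atTop (𝓝 0)

section WHP

variable {Ω : Type*} [MeasurableSpace Ω] {P : Measure Ω} {A B : ℕ → Ω → Prop}

theorem HoldsWHP.mono_eventually (hA : HoldsWHP P A) (h : ∀ᶠ n in atTop, ∀ ω, A n ω → B n ω) :
    HoldsWHP P B := by
  refine tendsto_of_tendsto_of_tendsto_of_le_of_le' tendsto_const_nhds hA
    (Eventually.of_forall fun n => zero_le) ?_
  filter_upwards [h] with n hn
  exact measure_mono fun ω hω hA => hω (hn ω hA)

theorem HoldsWHP.mono (hA : HoldsWHP P A) (h : ∀ n ω, A n ω → B n ω) : HoldsWHP P B :=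
  hA.mono_eventually (Eventually.of_forall h)

theorem HoldsWHP.and (hA : HoldsWHP P A) (hB : HoldsWHP P B) :
    HoldsWHP P fun n ω => A n ω ∧ B n ω := by
  have hsum : Tendsto (fun n => P {ω | ¬ A n ω} + P {ω | ¬ B n ω}) atTop (𝓝 0) := by
    simpa using hA.add hB
  refine tendsto_of_tendsto_of_tendsto_of_le_of_le tendsto_const_nhds hsum
    (fun n => zero_le) fun n => ?_
  refine le_trans (measure_mono fun ω hω => ?_) (measure_union_le _ _)
  by_cases h : A n ω
  · exact Or.inr fun hB => hω ⟨h, hB⟩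
  · exact Or.inl h

theorem holdsWHP_of_ae (h : ∀ n, ∀ᵐ ω ∂P, A n ω) : HoldsWHP P A := by
  have h0 : ∀ n, P {ω | ¬ A n ω} = 0 := fun n => h n
  simp [HoldsWHP, h0]

theorem tendstoInMeasure_iff_holdsWHP {G : Type*} [NormedAddCommGroup G] {Y : ℕ → Ω → G}
    {Z : Ω → G} :
    TendstoInMeasure P Y atTop Z ↔ ∀ ε > 0, HoldsWHP P fun n ω => ‖Y n ω - Z ω‖ < ε := by
  rw [tendstoInMeasure_iff_norm]
  simp only [HoldsWHP, not_lt, gt_iff_lt]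

/-- A sequence of random elements is bounded in probability. -/
def BoundedInProb {G : Type*} [SeminormedAddCommGroup G] (P : Measure Ω) (Y : ℕ → Ω → G) : Prop :=
  ∀ ε > 0, ∃ K : ℝ, 0 < K ∧ ∀ n, P {ω | K ≤ ‖Y n ω‖} ≤ ε

theorem BoundedInProb.of_norm_le_sum {G ι : Type*} [SeminormedAddCommGroup G] [Fintype ι]
    {Y : ℕ → Ω → G} {Z : ι → ℕ → Ω → ℝ} (hZ : ∀ i, BoundedInProb P (Z i))
    (hle : ∀ n ω, ‖Y n ω‖ ≤ ∑ i, ‖Z i n ω‖) : BoundedInProb P Y := by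
  intro ε hε
  have hε' : 0 < ε / (Fintype.card ι + 1 : ENNReal) := ENNReal.div_pos hε.ne' (by finiteness)
  choose K hK0 hK using fun i => hZ i _ hε'
  refine ⟨∑ i, K i + 1, add_pos_of_nonneg_of_pos (Finset.sum_nonneg fun i _ => (hK0 i).le) one_pos,
    fun n => ?_⟩
  calc P {ω | ∑ i, K i + 1 ≤ ‖Y n ω‖}
      ≤ P (⋃ i, {ω | K i ≤ ‖Z i n ω‖}) := by
        refine measure_mono fun ω hω => ?_
        by_contra hcon
        simp only [Set.mem_iUnion, Set.mem_ofPred_eq, not_exists, not_le] at hcon hω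
        have := Finset.sum_le_sum fun i (_ : i ∈ Finset.univ) => (hcon i).le
        linarith [hle n ω]
    _ ≤ ∑ i, P {ω | K i ≤ ‖Z i n ω‖} := measure_iUnion_fintype_le _ _
    _ ≤ ∑ _i : ι, ε / (Fintype.card ι + 1 : ENNReal) := Finset.sum_le_sum fun i _ => hK i n
    _ = Fintype.card ι * (ε / (Fintype.card ι + 1 : ENNReal)) := by simp
    _ ≤ (Fintype.card ι + 1) * (ε / (Fintype.card ι + 1 : ENNReal)) := by gcongr; simp
    _ ≤ ε := ENNReal.mul_div_le

theorem HoldsWHP.tendsto_measure_one [IsProbabilityMeasure P] (hA : HoldsWHP P A) :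
    Tendsto (fun n => P.real {ω | A n ω}) atTop (𝓝 1) := by
  have h1 : Tendsto (fun n => 1 - P.real {ω | ¬ A n ω}) atTop (𝓝 1) := by
    have := (ENNReal.tendsto_toReal ENNReal.zero_ne_top).comp hA
    simpa [Measure.real] using tendsto_const_nhds.sub this
  refine tendsto_of_tendsto_of_tendsto_of_le_of_le h1 tendsto_const_nhds (fun n => ?_)
    fun n => measureReal_le_one
  -- The event need not be measurable, so subadditivity replaces the complement formula.
  have hu : P.real Set.univ ≤ P.real {ω | A n ω} + P.real {ω | ¬ A n ω} := by
    refine le_trans (measureReal_mono fun ω _ => ?_) (measureReal_union_le _ _)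
    exact em (A n ω)
  simp only [probReal_univ] at hu
  simp only
  linarith

end WHP

/-! ### Sample means -/

/-- The mean of `φ` over a sample. -/
noncomputable def sampleMean {𝒳 G : Type*} [NormedAddCommGroup G] [NormedSpace ℝ G] (φ : 𝒳 → G)
    {n : ℕ} (x : Fin n → 𝒳) : G :=
  (n : ℝ)⁻¹ • ∑ i, φ (x i)

theorem norm_sampleMean_le {𝒳 G : Type*} [NormedAddCommGroup G] [NormedSpace ℝ G] (φ : 𝒳 → G)
    {n : ℕ} (x : Fin n → 𝒳) {M : 𝒳 → ℝ} (h : ∀ i, ‖φ (x i)‖ ≤ M (x i)) :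
    ‖sampleMean φ x‖ ≤ sampleMean M x := by
  rw [sampleMean, norm_smul, sampleMean, norm_inv, Real.norm_natCast, smul_eq_mul]
  gcongr
  exact (norm_sum_le _ _).trans (Finset.sum_le_sum fun i _ => h i)

theorem sampleMean_sample {𝒳 Ω G : Type*} [NormedAddCommGroup G] [NormedSpace ℝ G] (φ : 𝒳 → G)
    (X : ℕ → Ω → 𝒳) (n : ℕ) (ω : Ω) :
      sampleMean φ (sample X n ω) = (n : ℝ)⁻¹ • ∑ i ∈ Finset.range n, φ (X i ω) := by
  simp only [sampleMean, sample]
  rw [Fin.sum_univ_eq_sum_range (fun i => φ (X i ω)) n]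

section IID

variable {𝒳 Ω G : Type*} [MeasurableSpace 𝒳] [MeasurableSpace Ω] {P : Measure Ω}
  {ν : Measure 𝒳} {X : ℕ → Ω → 𝒳}

/-- The `X i` are independent with distribution `ν`. -/
structure IsIID (P : Measure Ω) (ν : Measure 𝒳) (X : ℕ → Ω → 𝒳) : Prop where
  measurable : ∀ i, Measurable (X i)
  indep : iIndepFun X P
  map_eq : ∀ i, P.map (X i) = ν

theorem IsIID.quasiMeasurePreserving (hX : IsIID P ν X) (i : ℕ) :
    Measure.QuasiMeasurePreserving (X i) P ν :=
  ⟨hX.measurable i, (hX.map_eq i).le.absolutelyContinuous⟩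

theorem IsIID.ae_forall (hX : IsIID P ν X) {p : 𝒳 → Prop} (hp : ∀ᵐ x ∂ν, p x) :
    ∀ᵐ ω ∂P, ∀ i, p (X i ω) :=
  ae_all_iff.2 fun i => (hX.quasiMeasurePreserving i).ae hp

theorem IsIID.iIndepFun_comp (hX : IsIID P ν X) [MeasurableSpace G] {φ : 𝒳 → G}
    (hφ : AEMeasurable φ ν) : iIndepFun (fun i ω => φ (X i ω)) P :=
  hX.indep.comp₀ (fun _ => φ) (fun i => (hX.measurable i).aemeasurable)
    fun i => by rw [hX.map_eq i]; exact hφ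

theorem IsIID.identDistrib_comp (hX : IsIID P ν X) [MeasurableSpace G] {φ : 𝒳 → G}
    (hφ : AEMeasurable φ ν) (i : ℕ) :
    IdentDistrib (fun ω => φ (X i ω)) (fun ω => φ (X 0 ω)) P P := by
  have h : ∀ i, AEMeasurable φ (P.map (X i)) := fun i => by rw [hX.map_eq i]; exact hφ
  refine ⟨(h i).comp_measurable (hX.measurable i), (h 0).comp_measurable (hX.measurable 0), ?_⟩
  have hm : ∀ i, P.map (fun ω => φ (X i ω)) = ν.map φ := fun i => by
    rw [← hX.map_eq i, AEMeasurable.map_map_of_aemeasurable (h i) (hX.measurable i).aemeasurable]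
    rfl
  rw [hm, hm]

theorem IsIID.integral_comp (hX : IsIID P ν X) [NormedAddCommGroup G] [NormedSpace ℝ G]
    {φ : 𝒳 → G} (hφ : AEStronglyMeasurable φ ν) (i : ℕ) :
    ∫ ω, φ (X i ω) ∂P = ∫ x, φ x ∂ν := by
  rw [← hX.map_eq i, integral_map (hX.measurable i).aemeasurable]
  rw [hX.map_eq i]; exact hφ

theorem IsIID.integrable_comp (hX : IsIID P ν X) [NormedAddCommGroup G]
    {φ : 𝒳 → G} (hφ : Integrable φ ν) (i : ℕ) : Integrable (fun ω => φ (X i ω)) P := by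
  rw [← hX.map_eq i] at hφ
  exact hφ.comp_measurable (hX.measurable i)

theorem IsIID.memLp_comp (hX : IsIID P ν X) {φ : 𝒳 → ℝ} (hφ : MemLp φ 2 ν) (i : ℕ) :
    MemLp (fun ω => φ (X i ω)) 2 P := by
  rw [← hX.map_eq i] at hφ
  exact hφ.comp_of_map (hX.measurable i).aemeasurable

theorem IsIID.variance_comp (hX : IsIID P ν X) {φ : 𝒳 → ℝ} (hφ : AEMeasurable φ ν) (i : ℕ) :
    Var[fun ω => φ (X i ω); P] = Var[φ; ν] := by
  rw [← hX.map_eq i, variance_map]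
  · rfl
  · rw [hX.map_eq i]; exact hφ
  · exact (hX.measurable i).aemeasurable

theorem IsIID.tendstoInMeasure_sampleMean [IsProbabilityMeasure P] (hX : IsIID P ν X)
    [NormedAddCommGroup G] [NormedSpace ℝ G] [CompleteSpace G] {φ : 𝒳 → G} (hφ : Integrable φ ν) :
    TendstoInMeasure P (fun n ω => sampleMean φ (sample X n ω)) atTop fun _ => ∫ x, φ x ∂ν := by
  -- Gradients and Hessians are averaged in spaces of continuous (multi)linear maps, which come
  -- without a σ-algebra; the strong law is used with the Borel one.
  let _ : MeasurableSpace G := borel G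
  have : BorelSpace G := ⟨rfl⟩
  have hint := hX.integrable_comp hφ
  simp only [sampleMean_sample]
  refine tendstoInMeasure_of_tendsto_ae (fun n => ?_) ?_
  · exact (Finset.aestronglyMeasurable_fun_sum _
      fun i _ => (hint i).aestronglyMeasurable).const_smul (n : ℝ)⁻¹
  · have := strong_law_ae (fun i ω => φ (X i ω)) (hint 0)
      (fun i j hij => (hX.iIndepFun_comp hφ.aemeasurable).indepFun hij)
      (hX.identDistrib_comp hφ.aemeasurable)
    rwa [hX.integral_comp hφ.aestronglyMeasurable] at this

theorem IsIID.holdsWHP_norm_sampleMean_sub_lt [IsProbabilityMeasure P] (hX : IsIID P ν X)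
    [NormedAddCommGroup G] [NormedSpace ℝ G] [CompleteSpace G] {φ : 𝒳 → G} (hφ : Integrable φ ν)
    {δ : ℝ} (hδ : 0 < δ) :
    HoldsWHP P fun n ω => ‖sampleMean φ (sample X n ω) - ∫ x, φ x ∂ν‖ < δ :=
  tendstoInMeasure_iff_holdsWHP.1 (hX.tendstoInMeasure_sampleMean hφ) δ hδ

/-- Chebyshev's inequality: for `n > 0` the rescaled error has variance `Var[φ; ν]`, independent of
`n`, so a single `K` serves all sample sizes. -/
theorem IsIID.boundedInProb_sampleMean [IsProbabilityMeasure P] (hX : IsIID P ν X) {φ : 𝒳 → ℝ}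
    (hφ : MemLp φ 2 ν) :
    BoundedInProb P fun n ω => √n * (sampleMean φ (sample X n ω) - ∫ x, φ x ∂ν) := by
  intro ε hε
  have hm := hX.memLp_comp hφ
  obtain ⟨K, hK, hKε⟩ : ∃ K : ℝ, 0 < K ∧ ENNReal.ofReal (Var[φ; ν] / K ^ 2) ≤ ε := by
    have ht : Tendsto (fun K : ℝ => ENNReal.ofReal (Var[φ; ν] / K ^ 2)) atTop (𝓝 0) := by
      rw [← ENNReal.ofReal_zero]
      exact (ENNReal.continuous_ofReal.tendsto 0).comp
        (tendsto_const_nhds.div_atTop (tendsto_pow_atTop two_ne_zero))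
    obtain ⟨K, hK1, hK2⟩ := ((ht.eventually_le_const hε).and (eventually_gt_atTop 0)).exists
    exact ⟨K, hK2, hK1⟩
  refine ⟨K, hK, fun n => ?_⟩
  rcases Nat.eq_zero_or_pos n with rfl | hn
  · simp [not_le.2 hK]
  have hn' : (0 : ℝ) < n := by exact_mod_cast hn
  have hsq : 0 < √(n : ℝ) := Real.sqrt_pos.2 hn'
  set S : Ω → ℝ := ∑ i ∈ Finset.range n, fun ω => φ (X i ω) with hS
  have hSL : MemLp S 2 P := memLp_finsetSum' _ fun i _ => hm i
  have hVar : Var[S; P] = n * Var[φ; ν] := by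
    rw [hS, IndepFun.variance_sum (fun i _ => hm i)
      fun i _ j _ hij => (hX.iIndepFun_comp hφ.aemeasurable).indepFun hij]
    simp [hX.variance_comp hφ.aemeasurable]
  have hES : ∫ ω, S ω ∂P = n * ∫ x, φ x ∂ν := by
    have : ∀ ω, S ω = ∑ i ∈ Finset.range n, φ (X i ω) := fun ω => by simp [hS]
    simp only [this]
    rw [integral_finsetSum _ fun i _ => (hm i).integrable one_le_two]
    simp [hX.integral_comp hφ.aestronglyMeasurable]
  refine le_trans (le_of_eq ?_) ((meas_ge_le_variance_div_sq hSL
    (mul_pos hK hsq)).trans (le_trans (le_of_eq ?_) hKε))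
  · congr 1
    ext ω
    simp only [Set.mem_ofPred_eq, sampleMean_sample, hES]
    have h1 : √(n : ℝ) * ((n : ℝ)⁻¹ • ∑ i ∈ Finset.range n, φ (X i ω) - ∫ x, φ x ∂ν)
        = (S ω - n * ∫ x, φ x ∂ν) / √n := by
      simp only [hS, Finset.sum_apply, smul_eq_mul]
      rw [eq_div_iff hsq.ne']
      have := Real.mul_self_sqrt hn'.le
      field_simp
      rw [Real.sq_sqrt hn'.le]
    rw [h1, norm_div, Real.norm_eq_abs, Real.norm_of_nonneg hsq.le, le_div_iff₀ hsq]
  · congr 1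
    rw [hVar, mul_pow, Real.sq_sqrt hn'.le, mul_comm (n : ℝ), mul_div_mul_right _ _ hn'.ne']

end IID

/-! ### Second-order expansions at a constrained point -/

section Taylor

variable {E F : Type*} [NormedAddCommGroup E] [NormedSpace ℝ E] [NormedAddCommGroup F]
  [NormedSpace ℝ F]

/-- Mean value inequality for `k` minus its quadratic Taylor polynomial. Symmetry of `B` makes `A +
B (t - a)` the derivative of that polynomial. -/
theorem norm_sub_taylor_two_le {k : E → F} {k' : E → E →L[ℝ] F} {A : E →L[ℝ] F}
    {B : E →L[ℝ] E →L[ℝ] F} (hB : ∀ v w, B v w = B w v) {s : Set E} (hs : Convex ℝ s) {a b : E}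
    (ha : a ∈ s) (hb : b ∈ s) {c : ℝ} (hk : ∀ t ∈ s, HasFDerivAt k (k' t) t)
    (hc : ∀ t ∈ s, ‖k' t - A - B (t - a)‖ ≤ c) :
    ‖k b - k a - A (b - a) - (1 / 2 : ℝ) • B (b - a) (b - a)‖ ≤ c * ‖b - a‖ := by
  have hd : ∀ t ∈ s, HasFDerivWithinAt
      (fun t => k t - A (t - a) - (1 / 2 : ℝ) • B (t - a) (t - a)) (k' t - A - B (t - a)) s t := by
    intro t ht
    have hsub : HasFDerivAt (fun t : E => t - a) (ContinuousLinearMap.id ℝ E) t :=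
      (hasFDerivAt_id t).sub_const a
    have h1 : HasFDerivAt (fun t : E => A (t - a)) A t := by
      exact (A.hasFDerivAt.comp t hsub).congr_fderiv A.comp_id
    have h2 : HasFDerivAt (fun t : E => B (t - a)) B t := by
      exact (B.hasFDerivAt.comp t hsub).congr_fderiv B.comp_id
    have h3 := (h2.clm_apply hsub).const_smul (1 / 2 : ℝ)
    refine (((hk t ht).sub h1).sub h3).hasFDerivWithinAt.congr_fderiv ?_
    ext v
    simp only [_root_.sub_apply, _root_.smul_apply,
      _root_.add_apply, ContinuousLinearMap.comp_apply,
      ContinuousLinearMap.flip_apply, ContinuousLinearMap.id_apply]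
    rw [hB v (t - a), ← two_smul ℝ (B (t - a) v), smul_smul]
    norm_num
  have := hs.norm_image_sub_le_of_norm_hasFDerivWithin_le hd hc ha hb
  simpa [sub_sub, sub_eq_add_neg, add_comm, add_left_comm, add_assoc] using this

variable {h : E → F} {θ₀ : E}

theorem _root_.ContDiffAt.exists_norm_fderiv_sub_le (hh : ContDiffAt ℝ 2 h θ₀) {ε : ℝ}
    (hε : 0 < ε) :
    ∃ δ > 0, ∀ θ, ‖θ - θ₀‖ < δ → DifferentiableAt ℝ h θ ∧
      ‖fderiv ℝ h θ - fderiv ℝ h θ₀ - fderiv ℝ (fderiv ℝ h) θ₀ (θ - θ₀)‖ ≤ ε * ‖θ - θ₀‖ := by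
  have h1 : ContDiffAt ℝ 1 (fderiv ℝ h) θ₀ := hh.fderiv_right (by norm_num)
  have h2 := (h1.differentiableAt one_ne_zero).hasFDerivAt.isLittleO.def hε
  have h3 : ∀ᶠ θ in 𝓝 θ₀, DifferentiableAt ℝ h θ :=
    (hh.eventually (by simp)).mono fun θ hθ => hθ.differentiableAt two_ne_zero
  obtain ⟨δ, hδ, hball⟩ := Metric.eventually_nhds_iff.1 (h3.and h2)
  exact ⟨δ, hδ, fun θ hθ => hball (by rwa [dist_eq_norm])⟩

theorem _root_.ContDiffAt.fderiv_fderiv_comm (hh : ContDiffAt ℝ 2 h θ₀) (v w : E) :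
    fderiv ℝ (fderiv ℝ h) θ₀ v w = fderiv ℝ (fderiv ℝ h) θ₀ w v :=
  (hh.isSymmSndFDerivAt (by simp)) v w

theorem _root_.ContDiffAt.exists_norm_sub_taylor_two_le (hh : ContDiffAt ℝ 2 h θ₀) {ε : ℝ}
    (hε : 0 < ε) :
    ∃ δ > 0, ∀ θ, ‖θ - θ₀‖ < δ →
      ‖h θ - h θ₀ - fderiv ℝ h θ₀ (θ - θ₀)
        - (1 / 2 : ℝ) • fderiv ℝ (fderiv ℝ h) θ₀ (θ - θ₀) (θ - θ₀)‖ ≤ ε * ‖θ - θ₀‖ ^ 2 := by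
  obtain ⟨δ, hδ, H⟩ := hh.exists_norm_fderiv_sub_le hε
  refine ⟨δ, hδ, fun θ hθ => ?_⟩
  have hlt : ∀ t ∈ Metric.closedBall θ₀ ‖θ - θ₀‖, ‖t - θ₀‖ ≤ ‖θ - θ₀‖ := fun t ht => by
    rwa [Metric.mem_closedBall, dist_eq_norm] at ht
  -- The ball has radius exactly `‖θ - θ₀‖`, so the gradient error on it is at most `ε * ‖θ - θ₀‖`,
  -- which supplies the second power.
  have := norm_sub_taylor_two_le (k := h) (b := θ) (k' := fderiv ℝ h) hh.fderiv_fderiv_comm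
    (convex_closedBall θ₀ ‖θ - θ₀‖) (Metric.mem_closedBall_self (norm_nonneg _))
    (by simp [dist_eq_norm]) (c := ε * ‖θ - θ₀‖)
    (fun t ht => (H t ((hlt t ht).trans_lt hθ)).1.hasFDerivAt)
    (fun t ht => (H t ((hlt t ht).trans_lt hθ)).2.trans
      (mul_le_mul_of_nonneg_left (hlt t ht) hε.le))
  rwa [pow_two, ← mul_assoc]

end Taylor

/-! ### Deterministic estimates for constrained minimizers and roots. -/

section Constrained

variable {E F : Type*} [NormedAddCommGroup E] [NormedSpace ℝ E] [NormedAddCommGroup F]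
  [NormedSpace ℝ F]

/-- Finsler's lemma: a quadratic form which is positive on the kernel of `A` becomes coercive
after adding a multiple of `‖A v‖ ^ 2`. -/
theorem exists_coercive_of_pos_on_ker [FiniteDimensional ℝ E] (A : E →L[ℝ] F)
    (J : E →L[ℝ] E →L[ℝ] ℝ) (hJ : ∀ v, v ≠ 0 → A v = 0 → 0 < J v v) :
    ∃ c > 0, ∃ κ ≥ 0, ∀ v, c * ‖v‖ ^ 2 ≤ J v v + κ * ‖A v‖ ^ 2 := by
  have hS : IsCompact (Metric.sphere (0 : E) 1) := isCompact_sphere 0 1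
  have hcont : ∀ κ : ℝ, Continuous fun v => J v v + κ * ‖A v‖ ^ 2 := fun κ => by fun_prop
  -- The sets where the penalized form with weight `N` is positive are open, increase with `N` and
  -- cover the unit sphere; compactness leaves one `N`.
  obtain ⟨N, hN⟩ := hS.elim_directed_cover
    (fun N : ℕ => {v : E | 0 < J v v + N * ‖A v‖ ^ 2})
    (fun N => isOpen_lt continuous_const (hcont N))
    (fun v hv => by
      simp only [Set.mem_iUnion, Set.mem_ofPred_eq]
      have hv0 : v ≠ 0 := by rintro rfl; simp at hv
      by_cases hA : A v = 0
      · exact ⟨0, by simpa using hJ v hv0 hA⟩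
      · have hpos : 0 < ‖A v‖ ^ 2 := by positivity
        obtain ⟨N, hN⟩ := exists_nat_gt (-J v v / ‖A v‖ ^ 2)
        refine ⟨N, ?_⟩
        rw [div_lt_iff₀ hpos] at hN
        linarith)
    (directed_of_isDirected_le fun a b hab v hv => by
      simp only [Set.mem_ofPred_eq] at hv ⊢
      have : (a : ℝ) ≤ b := by exact_mod_cast hab
      nlinarith [sq_nonneg ‖A v‖])
  obtain ⟨c, hc, hcS⟩ : ∃ c > 0, ∀ v ∈ Metric.sphere (0 : E) 1, c ≤ J v v + N * ‖A v‖ ^ 2 := by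
    rcases (Metric.sphere (0 : E) 1).eq_empty_or_nonempty with he | hne
    · exact ⟨1, one_pos, by simp [he]⟩
    · obtain ⟨v, hv, hmin⟩ := hS.exists_isMinOn hne (hcont N).continuousOn
      exact ⟨_, hN hv, fun w hw => hmin hw⟩
  refine ⟨c, hc, N, Nat.cast_nonneg N, fun v => ?_⟩
  rcases eq_or_ne v 0 with rfl | hv
  · simp
  have hn : 0 < ‖v‖ := norm_pos_iff.2 hv
  have h1 := hcS (‖v‖⁻¹ • v) (by simp [norm_smul, hn.ne'])
  simp only [map_smul, _root_.smul_apply, smul_eq_mul, norm_smul, norm_inv,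
    norm_norm] at h1
  have h2 : ‖v‖⁻¹ * (‖v‖⁻¹ * J v v) + N * (‖v‖⁻¹ * ‖A v‖) ^ 2
      = (J v v + N * ‖A v‖ ^ 2) / ‖v‖ ^ 2 := by
    field_simp
  rwa [h2, le_div_iff₀ (by positivity)] at h1

variable {h : E → F} {θ₀ : E}

/-- Points near `θ₀` in the constraint set, at which a function with a second-order expansion
around `θ₀` is not larger than at `θ₀`, are controlled by the gradient of the Lagrangian. -/
theorem exists_norm_sub_le_of_le_constrained [FiniteDimensional ℝ E] (hh : ContDiffAt ℝ 2 h θ₀)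
    (hθ₀ : h θ₀ = 0) (l : F →L[ℝ] ℝ) (J : E →L[ℝ] E →L[ℝ] ℝ)
    (hJ : ∀ v, v ≠ 0 → fderiv ℝ h θ₀ v = 0 → 0 < J v v - l (fderiv ℝ (fderiv ℝ h) θ₀ v v))
    {K : ℝ} (hK : 0 ≤ K) :
    ∃ δ > 0, ∃ C > 0, ∀ (θ : E) (D : E →L[ℝ] ℝ) (D₂ : E →L[ℝ] E →L[ℝ] ℝ) (y : ℝ),
      ‖θ - θ₀‖ < δ → h θ = 0 → ‖D₂ - J‖ < δ →
      |y - D (θ - θ₀) - 1 / 2 * D₂ (θ - θ₀) (θ - θ₀)| ≤ K * ‖θ - θ₀‖ ^ 3 → y ≤ 0 →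
      ‖θ - θ₀‖ ≤ C * ‖D - l ∘L fderiv ℝ h θ₀‖ := by
  set A := fderiv ℝ h θ₀ with hA
  set A₂ := fderiv ℝ (fderiv ℝ h) θ₀ with hA₂
  obtain ⟨c, hc, κ, hκ, hcoer⟩ := exists_coercive_of_pos_on_ker A
    (J - (ContinuousLinearMap.compL ℝ E F ℝ l) ∘L A₂) (fun v hv hv' => by simpa using hJ v hv hv')
  have hcoer' : ∀ v, c * ‖v‖ ^ 2 ≤ J v v - l (A₂ v v) + κ * ‖A v‖ ^ 2 := fun v => by
    simpa using hcoer v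
  -- The four terms bound, per `‖d‖ ^ 2`, the Taylor error of the constraint seen through `l`, the
  -- replacement of `D₂` by `J`, the cubic remainder, and the penalty `κ ‖A d‖ ^ 2 / 2`. Coercivity
  -- supplies `c / 2`; spending `c / 4` on errors leaves `c / 4`, whence the constant `4 / c`.
  obtain ⟨s, hs0, hs⟩ : ∃ s > 0, ‖l‖ * s + 1 / 2 * s + K * s
      + 1 / 2 * κ * ((1 / 2 * ‖A₂‖ + s) * s) ^ 2 ≤ c / 4 := by
    have hct : Continuous fun s : ℝ => ‖l‖ * s + 1 / 2 * s + K * s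
      + 1 / 2 * κ * ((1 / 2 * ‖A₂‖ + s) * s) ^ 2 := by fun_prop
    have h0 := (hct.tendsto 0).eventually_le_const (u := c / 4) (by simpa using by linarith)
    obtain ⟨s, h1, h2⟩ := ((h0.filter_mono nhdsWithin_le_nhds).and
      (self_mem_nhdsWithin (s := Set.Ioi (0 : ℝ)))).exists
    exact ⟨s, h2, h1⟩
  obtain ⟨δ, hδ, hTay⟩ := hh.exists_norm_sub_taylor_two_le hs0
  refine ⟨min δ s, lt_min hδ hs0, 4 / c, by positivity, fun θ D D₂ y hθ hhθ hD₂ hy hy0 => ?_⟩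
  set d := θ - θ₀ with hd
  have hdδ : ‖d‖ < δ := hθ.trans_le (min_le_left _ _)
  have hds : ‖d‖ < s := hθ.trans_le (min_le_right _ _)
  have hT := hTay θ hdδ
  rw [hhθ, hθ₀, sub_zero, zero_sub] at hT
  have hT' : ‖A d + (1 / 2 : ℝ) • A₂ d d‖ ≤ s * ‖d‖ ^ 2 := by
    rwa [← norm_neg, neg_add']
  have hA₂d : ‖A₂ d d‖ ≤ ‖A₂‖ * ‖d‖ ^ 2 := by
    rw [pow_two, ← mul_assoc]
    exact A₂.le_opNorm₂ d d
  have hAd : ‖A d‖ ≤ (1 / 2 * ‖A₂‖ + s) * s * ‖d‖ := by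
    have h1 : ‖A d‖ ≤ ‖A d + (1 / 2 : ℝ) • A₂ d d‖ + 1 / 2 * ‖A₂ d d‖ := by
      have := norm_sub_le (A d + (1 / 2 : ℝ) • A₂ d d) ((1 / 2 : ℝ) • A₂ d d)
      rw [add_sub_cancel_right] at this
      simpa [norm_smul] using this
    have h2 : ‖d‖ ^ 2 ≤ s * ‖d‖ := by
      rw [pow_two]; gcongr
    have h3 : (1 / 2 * ‖A₂‖ + s) * ‖d‖ ^ 2 ≤ (1 / 2 * ‖A₂‖ + s) * (s * ‖d‖) := by gcongr
    linarith
  have hAd2 : ‖A d‖ ^ 2 ≤ ((1 / 2 * ‖A₂‖ + s) * s) ^ 2 * ‖d‖ ^ 2 := by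
    rw [← mul_pow]; gcongr
  have hl : |l (A d) + 1 / 2 * l (A₂ d d)| ≤ ‖l‖ * s * ‖d‖ ^ 2 := by
    have h1 := l.le_opNorm (A d + (1 / 2 : ℝ) • A₂ d d)
    rw [map_add, map_smul, smul_eq_mul, Real.norm_eq_abs] at h1
    exact h1.trans (by rw [mul_assoc]; gcongr)
  have hDJ : |(D₂ - J) d d| ≤ s * ‖d‖ ^ 2 := by
    have h1 := (D₂ - J).le_opNorm₂ d d
    rw [Real.norm_eq_abs, mul_assoc, ← pow_two] at h1
    exact h1.trans (by gcongr; exact (hD₂.trans_le (min_le_right _ _)).le)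
  have hDl : |(D - l ∘L A) d| ≤ ‖D - l ∘L A‖ * ‖d‖ := (D - l ∘L A).le_opNorm d
  have hd3 : K * ‖d‖ ^ 3 ≤ K * s * ‖d‖ ^ 2 := by
    have : K * ‖d‖ ^ 3 = K * ‖d‖ * ‖d‖ ^ 2 := by ring
    rw [this]; gcongr
  have hco := hcoer' d
  -- Split `D d = (D - l ∘L A) d + l (A d)`. Since `h θ = 0`, `l (A d)` is `-l (A₂ d d) / 2` up to
  -- the Taylor error, which turns `J` into the Hessian of the Lagrangian; then `y ≤ 0` bounds the
  -- coercive form by the first summand.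
  have hmain : c / 4 * ‖d‖ ^ 2 ≤ ‖D - l ∘L A‖ * ‖d‖ := by
    simp only [_root_.sub_apply, ContinuousLinearMap.comp_apply] at hDl hDJ
    rw [abs_le] at hDl hDJ hl hy
    have h4 := mul_le_mul_of_nonneg_right hs (sq_nonneg ‖d‖)
    have h5 := mul_le_mul_of_nonneg_left hAd2 hκ
    linarith
  rcases (norm_nonneg d).eq_or_lt with h0 | h0
  · rw [← h0]; positivity
  · have h1 : c / 4 * ‖d‖ ≤ ‖D - l ∘L A‖ := by
      rw [pow_two, ← mul_assoc] at hmain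
      exact le_of_mul_le_mul_right hmain h0
    rw [div_mul_eq_mul_div, le_div_iff₀ hc]
    linarith

set_option maxHeartbeats 1000000 in
/-- Linearization of a root of the equations `D = m ∘ h'(θ)`, `h θ = 0`. -/
theorem exists_norm_linearization_le (hh : ContDiffAt ℝ 2 h θ₀) (hθ₀ : h θ₀ = 0)
    {S : F →L[ℝ] E} (hS : fderiv ℝ h θ₀ ∘L S = ContinuousLinearMap.id ℝ F)
    (l : F →L[ℝ] ℝ) (J : E →L[ℝ] E →L[ℝ] ℝ) (T : (E →L[ℝ] ℝ) →L[ℝ] E) (Q : F →L[ℝ] E)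
    (hT : ∀ m : F →L[ℝ] ℝ, T (m ∘L fderiv ℝ h θ₀) = 0)
    (hTJ : ∀ d, T (J d - l ∘L fderiv ℝ (fderiv ℝ h) θ₀ d) + Q (fderiv ℝ h θ₀ d) = d)
    {K ε : ℝ} (hK : 0 ≤ K) (hε : 0 < ε) :
    ∃ δ > 0, ∀ (θ : E) (D₀ D : E →L[ℝ] ℝ) (D₂ : E →L[ℝ] E →L[ℝ] ℝ) (m : F →L[ℝ] ℝ),
      ‖θ - θ₀‖ < δ → h θ = 0 → ‖D₀ - l ∘L fderiv ℝ h θ₀‖ < δ → ‖D₂ - J‖ < δ →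
      ‖D - D₀ - D₂ (θ - θ₀)‖ ≤ K * ‖θ - θ₀‖ ^ 2 → D = m ∘L fderiv ℝ h θ →
      ‖(θ - θ₀) + T (D₀ - l ∘L fderiv ℝ h θ₀)‖ ≤ ε * ‖θ - θ₀‖ := by
  set A := fderiv ℝ h θ₀ with hA
  set A₂ := fderiv ℝ (fderiv ℝ h) θ₀ with hA₂
  -- Bound for `‖m - l‖` when all perturbations are at most `s`. It tends to `0` with `s`; the
  -- factor `2` is the price of absorbing a term `‖m - l‖ / 2` into the left side.
  set τ : ℝ → ℝ := fun s =>
    2 * (‖S‖ * (s + (‖J‖ + s) * s + K * s ^ 2 + ‖l‖ * ((‖A₂‖ + 1) * s))) with hτ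
  obtain ⟨s, hs0, hs1, hs, hsS⟩ : ∃ s > 0, s ≤ 1 ∧
      ‖Q‖ * ((‖A₂‖ + 1) * s) + ‖T‖ * (τ s * ‖A₂‖ + (‖l‖ + τ s) * s + s + K * s) ≤ ε ∧
      ‖S‖ * ((‖A₂‖ + 1) * s) ≤ 1 / 2 := by
    have hct : Continuous fun s : ℝ => ‖Q‖ * ((‖A₂‖ + 1) * s) +
        ‖T‖ * (τ s * ‖A₂‖ + (‖l‖ + τ s) * s + s + K * s) := by fun_prop
    have hct' : Continuous fun s : ℝ => ‖S‖ * ((‖A₂‖ + 1) * s) := by fun_prop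
    have h0 := (hct.tendsto 0).eventually_le_const (u := ε) (by simpa [hτ] using hε)
    have h0' := (hct'.tendsto 0).eventually_le_const (u := 1 / 2) (by simp)
    have h1 := eventually_le_nhds (zero_lt_one' ℝ)
    obtain ⟨s, ⟨h1, h2, h3⟩, h4⟩ := ((h1.and (h0.and h0')).filter_mono nhdsWithin_le_nhds |>.and
      (self_mem_nhdsWithin (s := Set.Ioi (0 : ℝ)))).exists
    exact ⟨s, h4, h1, h2, h3⟩
  obtain ⟨δ₁, hδ₁, hH⟩ := hh.exists_norm_fderiv_sub_le hs0
  obtain ⟨δ₂, hδ₂, hTay⟩ := hh.exists_norm_sub_taylor_two_le (half_pos hs0)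
  refine ⟨min s (min δ₁ δ₂), lt_min hs0 (lt_min hδ₁ hδ₂),
    fun θ D₀ D D₂ m hθ hhθ hD₀ hD₂ hD hDm => ?_⟩
  set d := θ - θ₀ with hd
  have hds : ‖d‖ < s := hθ.trans_le (min_le_left _ _)
  have hdδ₁ : ‖d‖ < δ₁ := hθ.trans_le ((min_le_right _ _).trans (min_le_left _ _))
  have hdδ₂ : ‖d‖ < δ₂ := hθ.trans_le ((min_le_right _ _).trans (min_le_right _ _))
  replace hD₀ := (hD₀.trans_le (min_le_left _ _)).le
  replace hD₂ := (hD₂.trans_le (min_le_left _ _)).le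
  have hdn := norm_nonneg d
  set R₂ := fderiv ℝ h θ - A - A₂ d with hR₂
  set R₁ := D - D₀ - D₂ d with hR₁
  have hR₂le : ‖R₂‖ ≤ s * ‖d‖ := (hH θ hdδ₁).2
  have hA₂d : ‖A₂ d‖ ≤ ‖A₂‖ * ‖d‖ := A₂.le_opNorm d
  have hHA : ‖A₂ d + R₂‖ ≤ (‖A₂‖ + 1) * ‖d‖ := by
    refine (norm_add_le _ _).trans ?_
    linarith [mul_le_mul_of_nonneg_right hs1 hdn]
  have hHs : ‖A₂ d + R₂‖ ≤ (‖A₂‖ + 1) * s := hHA.trans (by gcongr)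
  -- Both endpoints satisfy the constraint, so `A d` is of second order in `d`.
  have hAd : ‖A d‖ ≤ (‖A₂‖ + 1) * s * ‖d‖ := by
    have h1 := hTay θ hdδ₂
    rw [hhθ, hθ₀, sub_zero, zero_sub] at h1
    have h2 : ‖A d‖ ≤ ‖-A d - (1 / 2 : ℝ) • A₂ d d‖ + 1 / 2 * ‖A₂ d d‖ := by
      have := norm_add_le (-A d - (1 / 2 : ℝ) • A₂ d d) ((1 / 2 : ℝ) • A₂ d d)
      rw [sub_add_cancel, norm_neg] at this
      simpa [norm_smul] using this
    have h3 : ‖A₂ d d‖ ≤ ‖A₂‖ * ‖d‖ * ‖d‖ := A₂.le_opNorm₂ d d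
    have h4 : (‖A₂‖ + 1) * (‖d‖ * ‖d‖) ≤ (‖A₂‖ + 1) * (s * ‖d‖) := by gcongr
    have h5 : s / 2 * ‖d‖ ^ 2 ≤ ‖d‖ * ‖d‖ := by
      rw [pow_two]
      exact mul_le_of_le_one_left (by positivity) (by linarith)
    have h6 : 0 ≤ ‖A₂‖ * ‖d‖ * ‖d‖ := by positivity
    linarith
  -- the multiplier is close to `l`
  have hml : ‖m - l‖ ≤ τ s := by
    have h1 : m - l = ((D₀ - l ∘L A) + D₂ d + R₁ - m ∘L (A₂ d + R₂)) ∘L S := by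
      -- Inserting `h'(θ) = A + A₂ d + R₂` into `D = m ∘ h'(θ)` isolates `(m - l) ∘L A`; composing
      -- with the right inverse `S` of `A` then recovers `m - l`.
      have h2 : (D₀ - l ∘L A) + D₂ d + R₁ - m ∘L (A₂ d + R₂) = (m - l) ∘L A := by
        have : D₀ + D₂ d + R₁ = m ∘L (A + (A₂ d + R₂)) := by
          rw [hR₁, hR₂, show A + (A₂ d + (fderiv ℝ h θ - A - A₂ d)) = fderiv ℝ h θ by abel, ← hDm]
          abel
        rw [ContinuousLinearMap.comp_add] at this
        rw [ContinuousLinearMap.sub_comp, eq_sub_of_add_eq this.symm]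
        abel
      rw [h2, ContinuousLinearMap.comp_assoc, hS, ContinuousLinearMap.comp_id]
    have hD₂n : ‖D₂ d‖ ≤ (‖J‖ + s) * s := by
      refine (D₂.le_opNorm d).trans ?_
      have : ‖D₂‖ ≤ ‖J‖ + s := by
        linarith [norm_le_norm_add_norm_sub' D₂ J]
      gcongr
    have hR₁n : ‖R₁‖ ≤ K * s ^ 2 := hD.trans (by gcongr)
    have hmn : ‖m‖ ≤ ‖l‖ + ‖m - l‖ := norm_le_norm_add_norm_sub' m l
    have h3 : ‖m ∘L (A₂ d + R₂)‖ ≤ (‖l‖ + ‖m - l‖) * ((‖A₂‖ + 1) * s) :=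
      (ContinuousLinearMap.opNorm_comp_le _ _).trans (by gcongr)
    have h4 : ‖m - l‖ ≤ (s + (‖J‖ + s) * s + K * s ^ 2 +
        (‖l‖ + ‖m - l‖) * ((‖A₂‖ + 1) * s)) * ‖S‖ := by
      conv_lhs => rw [h1]
      refine (ContinuousLinearMap.opNorm_comp_le _ _).trans ?_
      gcongr
      refine (norm_sub_le _ _).trans (add_le_add ?_ h3)
      refine (norm_add_le _ _).trans (add_le_add ?_ hR₁n)
      exact (norm_add_le _ _).trans (add_le_add hD₀ hD₂n)
    have h5 := mul_le_mul_of_nonneg_left hsS (norm_nonneg (m - l))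
    simp only [hτ]
    linarith
  have hτ0 : 0 ≤ τ s := (norm_nonneg _).trans hml
  -- the expansion
  set W := (m - l) ∘L A₂ d + m ∘L R₂ - (D₂ - J) d - R₁ with hW
  -- `T` kills the unknown `(m - l) ∘L A`, and `hTJ` turns the Hessian term into `d - Q (A d)`. What
  -- remains, `Q (A d) + T W`, is small compared with `‖d‖`.
  have hexp : d + T (D₀ - l ∘L A) = Q (A d) + T W := by
    have h1 : D₀ - l ∘L A = (m - l) ∘L A - (J d - l ∘L A₂ d) + W := by
      have : D₀ = m ∘L (A + A₂ d + R₂) - D₂ d - R₁ := by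
        rw [hR₁, hR₂, show A + A₂ d + (fderiv ℝ h θ - A - A₂ d) = fderiv ℝ h θ by abel, ← hDm]
        abel
      rw [this, hW]
      simp only [ContinuousLinearMap.comp_add, ContinuousLinearMap.sub_comp,
        _root_.sub_apply]
      abel
    have h2 : Q (A d) = d - T (J d - l ∘L A₂ d) := eq_sub_of_add_eq' (hTJ d)
    rw [h1, map_add, map_sub, hT, h2]
    abel
  have hWn : ‖W‖ ≤ (τ s * ‖A₂‖ + (‖l‖ + τ s) * s + s + K * s) * ‖d‖ := by
    have hmn : ‖m‖ ≤ ‖l‖ + τ s := by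
      linarith [norm_le_norm_add_norm_sub' m l]
    have h1 : ‖(m - l) ∘L A₂ d‖ ≤ τ s * (‖A₂‖ * ‖d‖) :=
      (ContinuousLinearMap.opNorm_comp_le _ _).trans (by gcongr)
    have h2 : ‖m ∘L R₂‖ ≤ (‖l‖ + τ s) * (s * ‖d‖) :=
      (ContinuousLinearMap.opNorm_comp_le _ _).trans (by gcongr)
    have h3 : ‖(D₂ - J) d‖ ≤ s * ‖d‖ := ((D₂ - J).le_opNorm d).trans (by gcongr)
    have h4 : ‖R₁‖ ≤ K * (s * ‖d‖) := hD.trans (by rw [pow_two]; gcongr)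
    have := (norm_sub_le ((m - l) ∘L A₂ d + m ∘L R₂ - (D₂ - J) d) R₁).trans
      (add_le_add ((norm_sub_le _ _).trans (add_le_add ((norm_add_le _ _).trans
        (add_le_add h1 h2)) h3)) h4)
    refine this.trans (le_of_eq ?_)
    ring
  rw [hexp]
  calc ‖Q (A d) + T W‖ ≤ ‖Q‖ * ((‖A₂‖ + 1) * s * ‖d‖) +
        ‖T‖ * ((τ s * ‖A₂‖ + (‖l‖ + τ s) * s + s + K * s) * ‖d‖) := by
        refine (norm_add_le _ _).trans (add_le_add ?_ ?_)
        · exact (Q.le_opNorm _).trans (by gcongr)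
        · exact (T.le_opNorm _).trans (by gcongr)
    _ = (‖Q‖ * ((‖A₂‖ + 1) * s) + ‖T‖ * (τ s * ‖A₂‖ + (‖l‖ + τ s) * s + s + K * s)) * ‖d‖ := by
        ring
    _ ≤ ε * ‖d‖ := by gcongr

end Constrained

/-! ### Measurable selection of minimizers -/

section Argmin

variable {Y E : Type*} [MeasurableSpace Y] [TopologicalSpace E]

/-- The minimum over `K` is attained, so it is at most `c` as soon as values below `c + 1 / (n + 1)`
occur for every `n`; by continuity these can be sought in a countable dense subset of `K`. This
avoids a measurable projection theorem. -/
theorem measurableSet_exists_mem_le [TopologicalSpace.PseudoMetrizableSpace E]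
    [SecondCountableTopology E] {K : Set E} (hK : IsCompact K)
    {G : Y → E → ℝ} (hmeas : ∀ θ ∈ K, Measurable fun y => G y θ)
    (hcont : ∀ y, ContinuousOn (G y) K) (c : ℝ) : MeasurableSet {y | ∃ θ ∈ K, G y θ ≤ c} := by
  obtain ⟨D, hDc, hD⟩ := TopologicalSpace.exists_countable_dense K
  have hset : {y | ∃ θ ∈ K, G y θ ≤ c}
      = ⋂ n : ℕ, ⋃ q ∈ D, {y | G y q < c + 1 / ((n : ℝ) + 1)} := by
    ext y
    simp only [Set.mem_ofPred_eq, Set.mem_iInter, Set.mem_iUnion, exists_prop]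
    have hcy : Continuous fun q : K => G y q := (hcont y).domRestrict
    constructor
    · rintro ⟨θ, hθ, hle⟩ n
      obtain ⟨q, hq, hqD⟩ := hD.exists_mem_open
        (isOpen_lt hcy (continuous_const (y := c + 1 / ((n : ℝ) + 1))))
        ⟨⟨θ, hθ⟩, hle.trans_lt (by simp only [lt_add_iff_pos_right]; positivity)⟩
      exact ⟨q, hq, hqD⟩
    · intro hy
      obtain ⟨q₀, -, -⟩ := hy 0
      obtain ⟨θ, hθ, hmin⟩ := hK.exists_isMinOn ⟨q₀, q₀.2⟩ (hcont y)
      refine ⟨θ, hθ, le_of_forall_pos_lt_add fun ε hε => ?_⟩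
      obtain ⟨n, hn⟩ := exists_nat_one_div_lt hε
      obtain ⟨q, -, hq⟩ := hy n
      have := hmin q.2
      simp only [Set.mem_ofPred_eq] at this
      linarith
  rw [hset]
  exact MeasurableSet.iInter fun n => MeasurableSet.biUnion hDc fun q _ =>
    measurableSet_lt (hmeas q q.2) measurable_const

/-- Take the least value of `φ` on the zero set. Its sublevel sets ask for a zero in a smaller
compact set, which is a measurable condition on `y`. -/
theorem exists_measurable_value_of_zero [TopologicalSpace.PseudoMetrizableSpace E]
    [SecondCountableTopology E] {K : Set E} (hK : IsCompact K)
    {G : Y → E → ℝ} (hmeas : ∀ θ ∈ K, Measurable fun y => G y θ)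
    (hcont : ∀ y, ContinuousOn (G y) K) (hnonneg : ∀ y, ∀ θ ∈ K, 0 ≤ G y θ)
    (hzero : ∀ y, ∃ θ ∈ K, G y θ = 0) {φ : E → ℝ} (hφ : Continuous φ) :
    ∃ t : Y → ℝ, Measurable t ∧ ∀ y, ∃ θ ∈ K, G y θ = 0 ∧ φ θ = t y := by
  have hle : ∀ y, ∀ θ ∈ K, G y θ ≤ 0 ↔ G y θ = 0 := fun y θ hθ =>
    ⟨fun h => le_antisymm h (hnonneg y θ hθ), le_of_eq⟩
  have hex : ∀ y, ∃ θ ∈ {θ | θ ∈ K ∧ G y θ ≤ 0}, IsMinOn φ {θ | θ ∈ K ∧ G y θ ≤ 0} θ := by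
    intro y
    have hcomp : IsCompact {θ | θ ∈ K ∧ G y θ ≤ 0} := by
      obtain ⟨C, hC, hCK⟩ := (continuousOn_iff_isClosed.1 (hcont y)) (Set.Iic 0) isClosed_Iic
      have heq : {θ | θ ∈ K ∧ G y θ ≤ 0} = K ∩ C := by
        rw [Set.inter_comm K C, ← hCK]
        ext θ
        exact and_comm
      rw [heq]
      exact hK.inter_right hC
    obtain ⟨θ, hθ, h0⟩ := hzero y
    exact hcomp.exists_isMinOn ⟨θ, hθ, h0.le⟩ hφ.continuousOn
  choose s hs hsmin using hex
  refine ⟨fun y => φ (s y), measurable_of_Iic fun c => ?_,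
    fun y => ⟨s y, (hs y).1, (hle y _ (hs y).1).1 (hs y).2, rfl⟩⟩
  have hset : (fun y => φ (s y)) ⁻¹' Set.Iic c
      = {y | ∃ θ ∈ K ∩ {θ | φ θ ≤ c}, G y θ ≤ 0} := by
    ext y
    constructor
    · intro hy
      exact ⟨s y, ⟨(hs y).1, hy⟩, (hs y).2⟩
    · rintro ⟨θ, ⟨hθ, hφθ⟩, h0⟩
      have h1 : φ (s y) ≤ φ θ := hsmin y ⟨hθ, h0⟩
      exact h1.trans hφθ
  rw [hset]
  exact measurableSet_exists_mem_le (hK.inter_right (isClosed_le hφ continuous_const))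
    (fun θ hθ => hmeas θ hθ.1) (fun y => (hcont y).mono Set.inter_subset_left) 0

/-- Lexicographic selection: adding `|φ i θ - t i y|` to `G` restricts the zero set to points with
the values already chosen, after which the next function is minimized on what is left. -/
theorem exists_measurable_values_of_zero [TopologicalSpace.PseudoMetrizableSpace E]
    [SecondCountableTopology E] {ι : Type*} [DecidableEq ι] {K : Set E} (hK : IsCompact K)
    {G : Y → E → ℝ} (hmeas : ∀ θ ∈ K, Measurable fun y => G y θ)
    (hcont : ∀ y, ContinuousOn (G y) K) (hnonneg : ∀ y, ∀ θ ∈ K, 0 ≤ G y θ)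
    (hzero : ∀ y, ∃ θ ∈ K, G y θ = 0) {φ : ι → E → ℝ} (hφ : ∀ i, Continuous (φ i))
    (s : Finset ι) :
    ∃ t : ι → Y → ℝ, (∀ i, Measurable (t i)) ∧
      ∀ y, ∃ θ ∈ K, G y θ = 0 ∧ ∀ i ∈ s, φ i θ = t i y := by
  induction s using Finset.induction_on with
  | empty => exact ⟨fun _ _ => 0, fun _ => measurable_const, by simpa using hzero⟩
  | insert a s ha ih =>
    obtain ⟨t, ht, hts⟩ := ih
    have hsum : ∀ y θ, 0 ≤ ∑ i ∈ s, |φ i θ - t i y| := fun y θ =>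
      Finset.sum_nonneg fun i _ => abs_nonneg _
    obtain ⟨u, hu, hus⟩ := exists_measurable_value_of_zero hK
      (G := fun y θ => G y θ + ∑ i ∈ s, |φ i θ - t i y|)
      (fun θ hθ => (hmeas θ hθ).add
        (Finset.measurable_fun_sum s fun i _ => (measurable_const.sub (ht i)).abs))
      (fun y => (hcont y).add (continuous_finsetSum s fun i _ =>
        ((hφ i).sub continuous_const).abs).continuousOn)
      (fun y θ hθ => add_nonneg (hnonneg y θ hθ) (hsum y θ))
      (fun y => by
        obtain ⟨θ, hθ, h0, hi⟩ := hts y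
        refine ⟨θ, hθ, ?_⟩
        rw [h0, zero_add]
        exact Finset.sum_eq_zero fun i his => by simp [hi i his])
      (hφ a)
    refine ⟨Function.update t a u, fun i => ?_, fun y => ?_⟩
    · rcases eq_or_ne i a with rfl | h
      · simpa using hu
      · simpa [h] using ht i
    · obtain ⟨θ, hθ, h0, hau⟩ := hus y
      have h1 := hnonneg y θ hθ
      have h2 := hsum y θ
      have h3 : G y θ = 0 := by linarith
      have h4 : ∑ i ∈ s, |φ i θ - t i y| = 0 := by linarith
      refine ⟨θ, hθ, h3, fun i hi => ?_⟩
      rcases Finset.mem_insert.1 hi with rfl | his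
      · simpa using hau
      · have hne : i ≠ a := fun h => ha (h ▸ his)
        have := (Finset.sum_eq_zero_iff_of_nonneg fun i _ => abs_nonneg _).1 h4 i his
        simpa [hne, sub_eq_zero] using this

/-- A function which is continuous in the parameter and measurable in the data has a measurable
minimizer over a nonempty compact set. -/
theorem exists_measurable_isMinOn {Y E : Type*} [MeasurableSpace Y] [NormedAddCommGroup E]
    [NormedSpace ℝ E] [FiniteDimensional ℝ E] [MeasurableSpace E] [BorelSpace E] {K : Set E}
    (hK : IsCompact K) (hne : K.Nonempty) {G : Y → E → ℝ}
    (hmeas : ∀ θ ∈ K, Measurable fun y => G y θ) (hcont : ∀ y, ContinuousOn (G y) K) :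
    ∃ g : Y → E, Measurable g ∧ ∀ y, g y ∈ K ∧ IsMinOn (G y) K (g y) := by
  have : ProperSpace E := FiniteDimensional.proper_real E
  choose s hs hsmin using fun y => hK.exists_isMinOn hne (hcont y)
  have hm : Measurable fun y => G y (s y) := by
    refine measurable_of_Iic fun c => ?_
    have hset : (fun y => G y (s y)) ⁻¹' Set.Iic c = {y | ∃ θ ∈ K, G y θ ≤ c} := by
      ext y
      exact ⟨fun hy => ⟨s y, hs y, hy⟩, fun ⟨θ, hθ, hle⟩ =>
        (hsmin y hθ : G y (s y) ≤ G y θ).trans hle⟩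
    rw [hset]
    exact measurableSet_exists_mem_le hK hmeas hcont c
  set b := Module.finBasis ℝ E
  -- The zeros of the excess over the minimum are the minimizers, and the values of all basis
  -- coordinates determine the point.
  obtain ⟨t, ht, hts⟩ := exists_measurable_values_of_zero hK
    (G := fun y θ => G y θ - G y (s y)) (fun θ hθ => (hmeas θ hθ).sub hm)
    (fun y => (hcont y).sub continuousOn_const)
    (fun y θ hθ => sub_nonneg.2 (hsmin y hθ)) (fun y => ⟨s y, hs y, sub_self _⟩)
    (φ := fun i (θ : E) => b.coord i θ)
    (fun i => LinearMap.continuous_of_finiteDimensional _) Finset.univ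
  refine ⟨fun y => ∑ i, t i y • b i, ?_, fun y => ?_⟩
  · exact Finset.measurable_fun_sum _ fun i _ => (ht i).smul_const _
  · obtain ⟨θ, hθ, h0, hi⟩ := hts y
    have heq : ∑ i, t i y • b i = θ := by
      rw [← b.sum_repr θ]
      exact Finset.sum_congr rfl fun i _ => by rw [← hi i (Finset.mem_univ i)]; rfl
    simp only [heq]
    refine ⟨hθ, fun θ' hθ' => ?_⟩
    have := hsmin y hθ'
    simp only [Set.mem_ofPred_eq] at this ⊢
    linarith

end Argmin

/-! ### Constrained M-estimation -/

section SampleMean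

variable {𝒳 G G' : Type*} [NormedAddCommGroup G] [NormedSpace ℝ G] [NormedAddCommGroup G']
  [NormedSpace ℝ G'] {n : ℕ}

theorem sampleMean_sub (φ ψ : 𝒳 → G) (x : Fin n → 𝒳) :
    sampleMean (fun y => φ y - ψ y) x = sampleMean φ x - sampleMean ψ x := by
  simp [sampleMean, Finset.sum_sub_distrib, smul_sub]

theorem sampleMean_clm_apply (φ : 𝒳 → G →L[ℝ] G') (x : Fin n → 𝒳) (v : G) :
    sampleMean φ x v = sampleMean (fun y => φ y v) x := by
  simp [sampleMean]

theorem clm_sampleMean (L : G →L[ℝ] G') (φ : 𝒳 → G) (x : Fin n → 𝒳) :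
    L (sampleMean φ x) = sampleMean (fun y => L (φ y)) x := by
  simp [sampleMean]

theorem sampleMean_mul_const (φ : 𝒳 → ℝ) (x : Fin n → 𝒳) (c : ℝ) :
    sampleMean (fun y => φ y * c) x = sampleMean φ x * c := by
  simp [sampleMean, Finset.sum_mul, mul_assoc]

end SampleMean

section MEstimation

/-- A second-order Taylor expansion of `k` around `θ₀` with remainder bounded by `M`. -/
structure HasTaylorBound {E : Type*} [NormedAddCommGroup E] [NormedSpace ℝ E] (k : E → ℝ)
    (θ₀ : E) (ρ M : ℝ) : Prop where
  contDiffAt : ∀ θ ∈ Metric.ball θ₀ ρ, ContDiffAt ℝ 1 k θ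
  gradient : ∀ θ ∈ Metric.ball θ₀ ρ,
    ‖fderiv ℝ k θ - fderiv ℝ k θ₀ - fderiv ℝ (fderiv ℝ k) θ₀ (θ - θ₀)‖ ≤ M * ‖θ - θ₀‖ ^ 2
  value : ∀ θ ∈ Metric.ball θ₀ ρ,
    |k θ - k θ₀ - fderiv ℝ k θ₀ (θ - θ₀) - 1 / 2 * fderiv ℝ (fderiv ℝ k) θ₀ (θ - θ₀) (θ - θ₀)|
      ≤ M * ‖θ - θ₀‖ ^ 3

variable {E 𝒳 Ω F : Type*} [NormedAddCommGroup E] [NormedSpace ℝ E] [NormedAddCommGroup F]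
  [NormedSpace ℝ F]

/-- The gradient in the parameter of a loss function. -/
noncomputable def lossGrad (m : E → 𝒳 → ℝ) (θ : E) (x : 𝒳) : E →L[ℝ] ℝ :=
  fderiv ℝ (fun t => m t x) θ

/-- The Hessian in the parameter of a loss function, as a bilinear form. -/
noncomputable def lossHess (m : E → 𝒳 → ℝ) (θ : E) (x : 𝒳) :
    E →L[ℝ] E →L[ℝ] ℝ :=
  fderiv ℝ (fderiv ℝ fun t => m t x) θ

/-- A loss function with an integrable second-order Taylor expansion around `θ₀`. -/
structure IsSmoothLoss [MeasurableSpace 𝒳] (ν : Measure 𝒳) (m : E → 𝒳 → ℝ) (θ₀ : E) (ρ : ℝ)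
    (M : 𝒳 → ℝ) : Prop where
  radius_pos : 0 < ρ
  measurable : ∀ θ ∈ Metric.ball θ₀ ρ, Measurable (m θ)
  integrable_bound : Integrable M ν
  integrable_grad : Integrable (lossGrad m θ₀) ν
  integrable_hess : Integrable (lossHess m θ₀) ν
  taylor : ∀ᵐ x ∂ν, HasTaylorBound (fun t => m t x) θ₀ ρ (M x)

/-- `θ` satisfies the constraint `h θ = 0` and the Lagrange equations for the mean loss over the
sample `x`. -/
def IsConstrainedRoot (h : E → F) (m : E → 𝒳 → ℝ) {n : ℕ} (x : Fin n → 𝒳)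
    (θ : E) : Prop :=
  h θ = 0 ∧ ∃ l : F →L[ℝ] ℝ, sampleMean (lossGrad m θ) x = l ∘L fderiv ℝ h θ

section Sample

variable {m : E → 𝒳 → ℝ} {θ₀ θ : E} {ρ : ℝ} {M : 𝒳 → ℝ} {n : ℕ} {x : Fin n → 𝒳}

theorem hasStrictFDerivAt_sampleMean (hx : ∀ i, HasTaylorBound (fun t => m t (x i)) θ₀ ρ (M (x i)))
    (hθ : θ ∈ Metric.ball θ₀ ρ) :
    HasStrictFDerivAt (fun t => sampleMean (m t) x) (sampleMean (lossGrad m θ) x) θ := by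
  simp only [sampleMean]
  exact HasStrictFDerivAt.const_smul (c := (n : ℝ)⁻¹) (HasStrictFDerivAt.fun_sum fun i _ =>
    ((hx i).contDiffAt θ hθ).hasStrictFDerivAt one_ne_zero)

theorem norm_sampleMean_lossGrad_sub_le
    (hx : ∀ i, HasTaylorBound (fun t => m t (x i)) θ₀ ρ (M (x i))) (hθ : θ ∈ Metric.ball θ₀ ρ) :
    ‖sampleMean (lossGrad m θ) x - sampleMean (lossGrad m θ₀) x
      - sampleMean (lossHess m θ₀) x (θ - θ₀)‖ ≤ sampleMean M x * ‖θ - θ₀‖ ^ 2 := by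
  rw [sampleMean_clm_apply, ← sampleMean_sub, ← sampleMean_sub, ← sampleMean_mul_const]
  exact norm_sampleMean_le _ _ fun i => (hx i).gradient θ hθ

theorem abs_sampleMean_sub_le
    (hx : ∀ i, HasTaylorBound (fun t => m t (x i)) θ₀ ρ (M (x i))) (hθ : θ ∈ Metric.ball θ₀ ρ) :
    |sampleMean (m θ) x - sampleMean (m θ₀) x - sampleMean (lossGrad m θ₀) x (θ - θ₀)
      - 1 / 2 * sampleMean (lossHess m θ₀) x (θ - θ₀) (θ - θ₀)|
      ≤ sampleMean M x * ‖θ - θ₀‖ ^ 3 := by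
  have h1 : 1 / 2 * sampleMean (lossHess m θ₀) x (θ - θ₀) (θ - θ₀)
      = sampleMean (fun y => 1 / 2 * lossHess m θ₀ y (θ - θ₀) (θ - θ₀)) x := by
    rw [sampleMean_clm_apply, sampleMean_clm_apply, mul_comm, ← sampleMean_mul_const]
    simp only [mul_comm]
  rw [sampleMean_clm_apply, h1, ← sampleMean_sub, ← sampleMean_sub, ← sampleMean_sub,
    ← sampleMean_mul_const, ← Real.norm_eq_abs]
  exact norm_sampleMean_le _ _ fun i => (hx i).value θ hθ

end Sample

variable [MeasurableSpace 𝒳] [MeasurableSpace Ω] {P : Measure Ω} [IsProbabilityMeasure P]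
  {ν : Measure 𝒳} {X : ℕ → Ω → 𝒳}
  {m : E → 𝒳 → ℝ} {θ₀ : E} {ρ : ℝ} {M : 𝒳 → ℝ}

/-- On this event the empirical criterion is a small perturbation of the population one, with a
controlled Taylor remainder, so the deterministic estimates for constrained points apply. -/
theorem IsSmoothLoss.holdsWHP_expansion (hm : IsSmoothLoss ν m θ₀ ρ M) (hX : IsIID P ν X)
    {δ : ℝ} (hδ : 0 < δ) :
    HoldsWHP P fun n ω =>
      (∀ i, HasTaylorBound (fun t => m t (sample X n ω i)) θ₀ ρ (M (sample X n ω i))) ∧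
      ‖sampleMean (lossGrad m θ₀) (sample X n ω) - ∫ x, lossGrad m θ₀ x ∂ν‖ < δ ∧
      ‖sampleMean (lossHess m θ₀) (sample X n ω) - ∫ x, lossHess m θ₀ x ∂ν‖ < δ ∧
      sampleMean M (sample X n ω) ≤ |∫ x, M x ∂ν| + 1 := by
  have h₁ : HoldsWHP P fun n ω =>
      ∀ i, HasTaylorBound (fun t => m t (sample X n ω i)) θ₀ ρ (M (sample X n ω i)) :=
    holdsWHP_of_ae fun n => (hX.ae_forall hm.taylor).mono fun ω hω i => hω i
  have h₂ := hX.holdsWHP_norm_sampleMean_sub_lt hm.integrable_grad hδ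
  have h₃ := hX.holdsWHP_norm_sampleMean_sub_lt hm.integrable_hess hδ
  have h₄ := hX.holdsWHP_norm_sampleMean_sub_lt hm.integrable_bound one_pos
  refine (h₁.and (h₂.and (h₃.and h₄))).mono fun n ω h => ⟨h.1, h.2.1, h.2.2.1, ?_⟩
  have h1 := (abs_lt.1 h.2.2.2).2
  linarith [le_abs_self (∫ x, M x ∂ν)]

/-- With a right inverse `S` at `θ₀`, the endomorphism `h'(θ) ∘ S` is close to the identity, and
units are open. -/
theorem eventually_range_fderiv_eq_top [FiniteDimensional ℝ F] {h : E → F}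
    (hh : ContDiffAt ℝ 2 h θ₀) (hsurj : (fderiv ℝ h θ₀).range = ⊤) :
    ∀ᶠ θ in 𝓝 θ₀, (fderiv ℝ h θ).range = ⊤ := by
  obtain ⟨S, hS⟩ := (fderiv ℝ h θ₀).exists_rightInverse_of_surjective hsurj
  have hcont : ContinuousAt (fun θ => fderiv ℝ h θ ∘L S) θ₀ :=
    (hh.continuousAt_fderiv two_ne_zero).clm_comp continuousAt_const
  have hunit : ∀ᶠ θ in 𝓝 θ₀, IsUnit (fderiv ℝ h θ ∘L S) := by
    have : CompleteSpace F := FiniteDimensional.complete ℝ F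
    refine hcont (Units.isOpen.mem_nhds (?_ : IsUnit (fderiv ℝ h θ₀ ∘L S)))
    rw [hS]
    exact isUnit_one
  filter_upwards [hunit] with θ hθ
  obtain ⟨u, hu⟩ := hθ
  refine LinearMap.range_eq_top.2 fun y => ⟨S ((↑u⁻¹ : F →L[ℝ] F) y), ?_⟩
  have h1 : (u : F →L[ℝ] F) ((↑u⁻¹ : F →L[ℝ] F) y) = y := by
    rw [← ContinuousLinearMap.comp_apply]
    exact congrArg (fun f : F →L[ℝ] F => f y) u.mul_inv
  rw [hu] at h1
  exact h1

/-- Lagrange multipliers at a constrained minimizer. -/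
theorem exists_lagrange_multiplier [FiniteDimensional ℝ E] [FiniteDimensional ℝ F] {h : E → F}
    {L : E → ℝ} {L' : E →L[ℝ] ℝ} {θ : E}
    (hmin : IsLocalExtrOn L {t | h t = h θ} θ) (hL : HasStrictFDerivAt L L' θ)
    (hh : HasStrictFDerivAt h (fderiv ℝ h θ) θ) (hsurj : (fderiv ℝ h θ).range = ⊤) :
    ∃ l : F →L[ℝ] ℝ, L' = l ∘L fderiv ℝ h θ := by
  have : CompleteSpace F := FiniteDimensional.complete ℝ F
  obtain ⟨Λ, Λ₀, hne, hΛ⟩ := hmin.exists_linear_map_of_hasStrictFDerivAt hh hL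
  -- The general theorem gives a multiplier pair up to scale. Were the weight of the objective zero,
  -- `Λ` would vanish on the range of the derivative, which is everything.
  have hΛ₀ : Λ₀ ≠ 0 := by
    rintro rfl
    refine hne (Prod.ext (LinearMap.ext fun y => ?_) rfl)
    obtain ⟨v, hv⟩ := LinearMap.range_eq_top.1 hsurj y
    have := hΛ v
    rw [← hv]
    simpa using this
  refine ⟨-(Λ₀⁻¹ • LinearMap.toContinuousLinearMap Λ), ContinuousLinearMap.ext fun v => ?_⟩
  have h1 := hΛ v
  simp only [smul_eq_mul] at h1
  simp only [ContinuousLinearMap.comp_apply, _root_.neg_apply, _root_.smul_apply, smul_eq_mul,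
    LinearMap.coe_toContinuousLinearMap']
  field_simp
  linarith

/-- Existence of measurable consistent roots of the Lagrange equations. -/
theorem exists_consistent_constrainedRoot [MeasurableSpace E] [BorelSpace E]
    [FiniteDimensional ℝ E] [FiniteDimensional ℝ F]
    (hm : IsSmoothLoss ν m θ₀ ρ M) (hX : IsIID P ν X) {h : E → F}
    (hh : ContDiffAt ℝ 2 h θ₀) (hθ₀ : h θ₀ = 0) (hsurj : (fderiv ℝ h θ₀).range = ⊤)
    (l : F →L[ℝ] ℝ) (hl : ∫ x, lossGrad m θ₀ x ∂ν = l ∘L fderiv ℝ h θ₀)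
    (hJ : ∀ v, v ≠ 0 → fderiv ℝ h θ₀ v = 0 →
      0 < (∫ x, lossHess m θ₀ x ∂ν) v v - l (fderiv ℝ (fderiv ℝ h) θ₀ v v)) :
    ∃ est : (n : ℕ) → (Fin n → 𝒳) → E, (∀ n, Measurable (est n)) ∧
      TendstoInMeasure P (fun n ω => est n (sample X n ω)) atTop (fun _ => θ₀) ∧
      HoldsWHP P fun n ω => IsConstrainedRoot h m (sample X n ω) (est n (sample X n ω)) := by
  have : ProperSpace E := FiniteDimensional.proper_real E
  obtain ⟨δ, hδ, C, hC, hloc⟩ := exists_norm_sub_le_of_le_constrained hh hθ₀ l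
    (∫ x, lossHess m θ₀ x ∂ν) hJ (K := |∫ x, M x ∂ν| + 1) (by positivity)
  obtain ⟨R₁, hR₁, hnear⟩ := Metric.eventually_nhds_iff.1
    ((hh.eventually (by simp)).and (eventually_range_fderiv_eq_top hh hsurj))
  obtain ⟨R, hR0, hRlt⟩ : ∃ R > 0, R < min ρ (min δ R₁) :=
    exists_between (lt_min hm.radius_pos (lt_min hδ hR₁))
  have hRρ : R < ρ := hRlt.trans_le (min_le_left _ _)
  have hRδ : R < δ := hRlt.trans_le ((min_le_right _ _).trans (min_le_left _ _))
  have hRR₁ : R < R₁ := hRlt.trans_le ((min_le_right _ _).trans (min_le_right _ _))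
  set B := Metric.closedBall θ₀ R with hB
  have hBball : ∀ {θ}, θ ∈ B → θ ∈ Metric.ball θ₀ ρ := fun hθ =>
    Metric.closedBall_subset_ball hRρ hθ
  have hBnear : ∀ {θ}, θ ∈ B → ContDiffAt ℝ 2 h θ ∧ (fderiv ℝ h θ).range = ⊤ := fun hθ =>
    hnear ((Metric.mem_closedBall.1 hθ).trans_lt hRR₁)
  set S : Set (E) := B ∩ h ⁻¹' {0} with hS
  have hScomp : IsCompact S := by
    refine (isCompact_closedBall θ₀ R).of_isClosed_subset ?_ Set.inter_subset_left
    exact ContinuousOn.preimage_isClosed_of_isClosed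
      (fun θ hθ => (hBnear hθ).1.continuousAt.continuousWithinAt)
      Metric.isClosed_closedBall isClosed_singleton
  have hθ₀S : θ₀ ∈ S := ⟨Metric.mem_closedBall_self hR0.le, hθ₀⟩
  -- a measurable set of full measure on which the expansions hold
  obtain ⟨N, hNsub, hNm, hN0⟩ := exists_measurable_superset_of_null
    (ae_iff.1 hm.taylor : ν {x | ¬ HasTaylorBound (fun t => m t x) θ₀ ρ (M x)} = 0)
  have hNc : ∀ x, x ∉ N → HasTaylorBound (fun t => m t x) θ₀ ρ (M x) := fun x hx => by
    by_contra hcon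
    exact hx (hNsub hcon)
  -- Measurable selection needs a criterion continuous in the parameter for every sample. Zeroing
  -- the loss on the null set `N` achieves this and almost surely changes nothing.
  have hchoice : ∀ n : ℕ, ∃ g : (Fin n → 𝒳) → E, Measurable g ∧ ∀ x, g x ∈ S ∧
      IsMinOn (fun θ => sampleMean (fun y => Nᶜ.indicator (m θ) y) x) S (g x) := by
    intro n
    refine exists_measurable_isMinOn hScomp ⟨θ₀, hθ₀S⟩ (fun θ hθ => ?_) fun x => ?_
    · simp only [sampleMean]
      refine Measurable.const_smul (Finset.measurable_fun_sum _ fun i _ => ?_) (n : ℝ)⁻¹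
      exact ((hm.measurable θ (hBball hθ.1)).indicator hNm.compl).comp (measurable_pi_apply i)
    · simp only [sampleMean]
      refine ContinuousOn.const_smul (continuousOn_finsetSum _ fun i _ => ?_) (n : ℝ)⁻¹
      by_cases hi : x i ∈ N
      · simp [hi, continuousOn_const]
      · simp only [Set.indicator_of_mem (show x i ∈ Nᶜ from hi)]
        exact fun θ hθ => ((hNc _ hi).contDiffAt θ
          (hBball hθ.1)).continuousAt.continuousWithinAt
  choose est hest_meas hest using hchoice
  have hgood : ∀ {n : ℕ} {x : Fin n → 𝒳}, (∀ i, x i ∉ N) → ∀ θ ∈ S,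
      sampleMean (m (est n x)) x ≤ sampleMean (m θ) x := by
    intro n x hx θ hθ
    have heq : ∀ θ, sampleMean (fun y => Nᶜ.indicator (m θ) y) x = sampleMean (m θ) x := by
      intro θ
      simp only [sampleMean]
      congr 1
      exact Finset.sum_congr rfl fun i _ => Set.indicator_of_mem (show x i ∈ Nᶜ from hx i) _
    have := (hest n x).2 hθ
    simpa only [Set.mem_ofPred_eq, heq] using this
  have hN : HoldsWHP P fun n ω => ∀ i, sample X n ω i ∉ N :=
    holdsWHP_of_ae fun n => (hX.ae_forall (measure_eq_zero_iff_ae_notMem.1 hN0)).mono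
      fun ω hω i => hω i
  have hcons : ∀ ε > 0, HoldsWHP P fun n ω => ‖est n (sample X n ω) - θ₀‖ < ε := by
    intro ε hε
    refine (hN.and (hm.holdsWHP_expansion hX (lt_min hδ (div_pos hε hC)))).mono ?_
    rintro n ω ⟨hxN, hT, hgrad, hhess, hM⟩
    obtain ⟨⟨hb, hz⟩, -⟩ := hest n (sample X n ω)
    have hn : ‖est n (sample X n ω) - θ₀‖ < δ :=
      (mem_closedBall_iff_norm.1 hb).trans_lt hRδ
    -- The competitor `θ₀` makes the increment of the criterion nonpositive, so the distance to `θ₀`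
    -- is at most `C` times the error of the mean gradient.
    have h1 := hloc (est n (sample X n ω)) (sampleMean (lossGrad m θ₀) (sample X n ω))
      (sampleMean (lossHess m θ₀) (sample X n ω))
      (sampleMean (m (est n (sample X n ω))) (sample X n ω)
        - sampleMean (m θ₀) (sample X n ω)) hn hz (hhess.trans_le (min_le_left _ _))
      ((abs_sampleMean_sub_le hT (hBball hb)).trans (by gcongr))
      (sub_nonpos.2 (hgood hxN θ₀ hθ₀S))
    rw [← hl] at h1
    refine h1.trans_lt ?_
    have := hgrad.trans_le (min_le_right _ _)
    rw [lt_div_iff₀ hC] at this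
    linarith
  refine ⟨est, hest_meas, tendstoInMeasure_iff_holdsWHP.2 hcons, ?_⟩
  refine (hN.and ((hcons R hR0).and (hm.holdsWHP_expansion hX hδ))).mono ?_
  rintro n ω ⟨hxN, hlt, hT, -⟩
  obtain ⟨⟨hb, hz⟩, -⟩ := hest n (sample X n ω)
  refine ⟨hz, ?_⟩
  refine exists_lagrange_multiplier (L := fun t => sampleMean (m t) (sample X n ω))
    (Or.inl ?_) (hasStrictFDerivAt_sampleMean hT (hBball hb))
    ((hBnear hb).1.hasStrictFDerivAt two_ne_zero) (hBnear hb).2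
  -- Being strictly inside the ball turns the minimizer over the compact piece into a local
  -- minimizer on the whole constraint set.
  have hnhd : B ∈ 𝓝 (est n (sample X n ω)) :=
    mem_of_superset (Metric.isOpen_ball.mem_nhds (mem_ball_iff_norm.2 hlt))
      Metric.ball_subset_closedBall
  filter_upwards [mem_nhdsWithin_of_mem_nhds hnhd, self_mem_nhdsWithin] with t htB hth
  exact hgood hxN t ⟨htB, (hth : h t = _).trans hz⟩

/-- The linear representation of consistent roots of the Lagrange equations. -/
theorem tendstoInMeasure_constrainedRoot_linearization [FiniteDimensional ℝ E]
    [FiniteDimensional ℝ F]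
    (hm : IsSmoothLoss ν m θ₀ ρ M) (hX : IsIID P ν X) {h : E → F}
    (hh : ContDiffAt ℝ 2 h θ₀) (hθ₀ : h θ₀ = 0) (hsurj : (fderiv ℝ h θ₀).range = ⊤)
    (l : F →L[ℝ] ℝ) (hl : ∫ x, lossGrad m θ₀ x ∂ν = l ∘L fderiv ℝ h θ₀)
    (T : (E →L[ℝ] ℝ) →L[ℝ] E) (Q : F →L[ℝ] E)
    (hT : ∀ k : F →L[ℝ] ℝ, T (k ∘L fderiv ℝ h θ₀) = 0)
    (hTJ : ∀ d, T ((∫ x, lossHess m θ₀ x ∂ν) d - l ∘L fderiv ℝ (fderiv ℝ h) θ₀ d)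
      + Q (fderiv ℝ h θ₀ d) = d)
    (hbdd : BoundedInProb P fun n ω => √n •
      (sampleMean (lossGrad m θ₀) (sample X n ω) - ∫ x, lossGrad m θ₀ x ∂ν))
    {est : (n : ℕ) → (Fin n → 𝒳) → E}
    (hcons : TendstoInMeasure P (fun n ω => est n (sample X n ω)) atTop (fun _ => θ₀))
    (hroot : HoldsWHP P fun n ω =>
      IsConstrainedRoot h m (sample X n ω) (est n (sample X n ω))) {ε : ℝ} (hε : 0 < ε) :
    HoldsWHP P fun n ω => ‖√n • (est n (sample X n ω) - θ₀) + √n • T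
      (sampleMean (lossGrad m θ₀) (sample X n ω) - ∫ x, lossGrad m θ₀ x ∂ν)‖ < ε := by
  have : ProperSpace E := FiniteDimensional.proper_real E
  obtain ⟨S, hS⟩ := (fderiv ℝ h θ₀).exists_rightInverse_of_surjective hsurj
  refine ENNReal.tendsto_nhds_zero.2 fun e he => ?_
  obtain ⟨K, hK0, hK⟩ := hbdd (e / 2) (ENNReal.half_pos he.ne')
  -- With relative error `ε₁ ≤ 1 / 2` the displacement is at most twice `‖T E₀‖`. Its `√n`-rate thus
  -- follows from that of the gradient, and the second condition makes the remaining error at most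
  -- `ε` on `√n ‖E₀‖ < K`.
  obtain ⟨ε₁, hε₁, hε₁half, hε₁K⟩ : ∃ ε₁ > 0, ε₁ ≤ 1 / 2 ∧ 2 * ε₁ * (‖T‖ + 1) * K ≤ ε := by
    refine ⟨min (1 / 2) (ε / (2 * (‖T‖ + 1) * K)), lt_min (by norm_num) (by positivity),
      min_le_left _ _, ?_⟩
    have h1 : min (1 / 2) (ε / (2 * (‖T‖ + 1) * K)) ≤ ε / (2 * (‖T‖ + 1) * K) := min_le_right _ _
    rw [le_div_iff₀ (by positivity)] at h1
    linarith
  obtain ⟨δ, hδ, hlin⟩ := exists_norm_linearization_le hh hθ₀ hS l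
    (∫ x, lossHess m θ₀ x ∂ν) T Q hT hTJ (K := |∫ x, M x ∂ν| + 1) (by positivity) hε₁
  have hgood : HoldsWHP P fun n ω => ‖(est n (sample X n ω) - θ₀) + T
      (sampleMean (lossGrad m θ₀) (sample X n ω) - ∫ x, lossGrad m θ₀ x ∂ν)‖
        ≤ ε₁ * ‖est n (sample X n ω) - θ₀‖ := by
    refine ((tendstoInMeasure_iff_holdsWHP.1 hcons (min δ ρ) (lt_min hδ hm.radius_pos)).and
      (hroot.and (hm.holdsWHP_expansion hX hδ))).mono ?_
    rintro n ω ⟨hd, ⟨hz, k, hk⟩, hTay, hgrad, hhess, hM⟩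
    rw [hl] at hgrad ⊢
    refine hlin _ _ _ _ k (hd.trans_le (min_le_left _ _)) hz hgrad hhess ?_ hk
    exact (norm_sampleMean_lossGrad_sub_le hTay
      (mem_ball_iff_norm.2 (hd.trans_le (min_le_right _ _)))).trans (by gcongr)
  filter_upwards [ENNReal.tendsto_nhds_zero.1 hgood (e / 2) (ENNReal.half_pos he.ne')] with n hn
  refine le_trans (measure_mono fun ω hω => ?_) ((measure_union_le _ _).trans
    ((add_le_add hn (hK n)).trans (ENNReal.add_halves e).le))
  by_contra hcon
  simp only [Set.mem_union, Set.mem_ofPred_eq, not_or, not_le] at hcon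
  obtain ⟨h1, h2⟩ := hcon
  rw [not_lt] at h1
  refine hω (?_ : _ < _)
  set d := est n (sample X n ω) - θ₀
  set E₀ := sampleMean (lossGrad m θ₀) (sample X n ω) - ∫ x, lossGrad m θ₀ x ∂ν
  have h3 : ‖d‖ ≤ 2 * ‖T E₀‖ := by
    have h4 := norm_sub_le (d + T E₀) (T E₀)
    rw [add_sub_cancel_right] at h4
    have h5 := mul_le_mul_of_nonneg_right hε₁half (norm_nonneg d)
    linarith
  have h6 : ‖T E₀‖ ≤ (‖T‖ + 1) * ‖E₀‖ := (T.le_opNorm E₀).trans (by gcongr; linarith)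
  rw [norm_smul, Real.norm_of_nonneg (Real.sqrt_nonneg _)] at h2
  rw [← smul_add, norm_smul, Real.norm_of_nonneg (Real.sqrt_nonneg _)]
  calc √n * ‖d + T E₀‖ ≤ √n * (ε₁ * (2 * ((‖T‖ + 1) * ‖E₀‖))) := by
        gcongr
        exact h1.trans (by gcongr; linarith)
    _ = 2 * ε₁ * (‖T‖ + 1) * (√n * ‖E₀‖) := by ring
    _ < 2 * ε₁ * (‖T‖ + 1) * K := by gcongr
    _ ≤ ε := hε₁K

end MEstimation

/-! ### The multivariate central limit theorem -/

section CLT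

variable {𝒳 Ω : Type*} [MeasurableSpace 𝒳] [MeasurableSpace Ω] {P : Measure Ω}
  [IsProbabilityMeasure P] {ν : Measure 𝒳} {X : ℕ → Ω → 𝒳}

theorem IsIID.isProbabilityMeasure (hX : IsIID P ν X) : IsProbabilityMeasure ν := by
  rw [← hX.map_eq 0]
  exact Measure.isProbabilityMeasure_map (hX.measurable 0).aemeasurable

/-- The central limit theorem for sample means of a square integrable function. -/
theorem IsIID.tendstoInDistribution_sampleMean (hX : IsIID P ν X) {φ : 𝒳 → ℝ}
    (hφ : MemLp φ 2 ν) :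
    TendstoInDistribution
      (fun (n : ℕ) ω => √n * (sampleMean φ (sample X n ω) - ∫ x, φ x ∂ν)) atTop (id : ℝ → ℝ)
      (fun _ => P) (gaussianReal 0 Var[φ; ν].toNNReal) := by
  have hlaw : HasLaw (id : ℝ → ℝ) (gaussianReal 0 Var[fun ω => φ (X 0 ω); P].toNNReal)
      (gaussianReal 0 Var[φ; ν].toNNReal) := by
    rw [hX.variance_comp hφ.aemeasurable]
    exact HasLaw.id
  have h := tendstoInDistribution_inv_sqrt_mul_sum_sub (X := fun i ω => φ (X i ω)) hlaw
    (hX.memLp_comp hφ 0)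
    (hX.iIndepFun_comp hφ.aemeasurable) (hX.identDistrib_comp hφ.aemeasurable)
  refine h.congr (fun n => ae_of_all _ fun ω => ?_) (ae_of_all _ fun _ => rfl)
  simp only [sampleMean_sample, hX.integral_comp hφ.aestronglyMeasurable, smul_eq_mul]
  rcases Nat.eq_zero_or_pos n with rfl | hn
  · simp
  have hn' : (0 : ℝ) < n := by exact_mod_cast hn
  have hsq : 0 < √(n : ℝ) := Real.sqrt_pos.2 hn'
  field_simp
  rw [Real.sq_sqrt hn'.le]

variable {ι : Type*} [Fintype ι]

/-- The matrix of covariances of the coordinates of `W`. -/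
noncomputable def covMatrix (ν : Measure 𝒳) (W : 𝒳 → EuclideanSpace ℝ ι) : Matrix ι ι ℝ :=
  Matrix.of fun i j => cov[fun x => W x i, fun x => W x j; ν]

theorem variance_inner_eq [IsProbabilityMeasure ν] {W : 𝒳 → EuclideanSpace ℝ ι}
    (hW : ∀ i, MemLp (fun x => W x i) 2 ν) (t : ι → ℝ) :
    Var[fun x => ∑ i, t i * W x i; ν] = t ⬝ᵥ covMatrix ν W *ᵥ t := by
  have hm : ∀ i, MemLp (fun x => t i * W x i) 2 ν := fun i => (hW i).const_mul (t i)
  rw [← covariance_self (memLp_finsetSum _ fun i _ => hm i).aemeasurable,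
    covariance_fun_sum_fun_sum hm hm]
  simp only [dotProduct, mulVec, covMatrix, Matrix.of_apply, Finset.mul_sum]
  refine Finset.sum_congr rfl fun i _ => Finset.sum_congr rfl fun j _ => ?_
  rw [covariance_const_mul_left, covariance_const_mul_right]
  ring

theorem posSemidef_covMatrix [IsProbabilityMeasure ν] {W : 𝒳 → EuclideanSpace ℝ ι}
    (hW : ∀ i, MemLp (fun x => W x i) 2 ν) : (covMatrix ν W).PosSemidef := by
  refine Matrix.PosSemidef.of_dotProduct_mulVec_nonneg ?_ fun t => ?_
  · ext i j
    simp [covMatrix, covariance_comm]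
  · rw [star_trivial, ← variance_inner_eq hW]
    exact variance_nonneg _ _

/-- The multivariate central limit theorem for sample means. -/
theorem IsIID.tendstoInDistribution_sampleMean_euclidean [DecidableEq ι] (hX : IsIID P ν X)
    {W : 𝒳 → EuclideanSpace ℝ ι} (hW : ∀ i, MemLp (fun x => W x i) 2 ν) :
    TendstoInDistribution
      (fun (n : ℕ) ω => √n • (sampleMean W (sample X n ω) - ∫ x, W x ∂ν)) atTop
      (id : EuclideanSpace ℝ ι → _) (fun _ => P) (multivariateGaussian 0 (covMatrix ν W)) := by
  have hν := hX.isProbabilityMeasure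
  have hWL : MemLp W 2 ν := MemLp.of_eval_piLp hW
  have hmeas : ∀ n : ℕ, AEMeasurable
      (fun ω => √n • (sampleMean W (sample X n ω) - ∫ x, W x ∂ν)) P := by
    intro n
    simp only [sampleMean_sample]
    refine AEMeasurable.const_smul (AEMeasurable.sub_const (AEMeasurable.const_smul
      (c := (n : ℝ)⁻¹) ?_) _) (√n)
    refine Finset.aemeasurable_fun_sum _ fun i _ => ?_
    exact AEMeasurable.comp_measurable (by rw [hX.map_eq i]; exact hWL.aemeasurable)
      (hX.measurable i)
  refine ⟨hmeas, by fun_prop, ProbabilityMeasure.tendsto_iff_tendsto_charFun.2 fun t => ?_⟩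
  have hφ : MemLp (fun x => ∑ i, t i * W x i) 2 ν :=
    memLp_finsetSum _ fun i _ => (hW i).const_mul _
  -- Cramér–Wold: the characteristic function at `t` is that of the scalar sample mean of `⟨W, t⟩`,
  -- evaluated at `1`.
  have h1 := ProbabilityMeasure.tendsto_iff_tendsto_charFun.1
    (hX.tendstoInDistribution_sampleMean hφ).tendsto 1
  have hint : ∀ x, (∑ i, t i * W x i) = inner ℝ (W x) t := fun x => by
    simp [PiLp.inner_apply]
  have hlim : charFun (multivariateGaussian 0 (covMatrix ν W)) t
      = charFun (gaussianReal 0 Var[fun x => ∑ i, t i * W x i; ν].toNNReal) 1 := by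
    rw [charFun_multivariateGaussian (posSemidef_covMatrix hW), charFun_gaussianReal,
      variance_inner_eq hW, Real.coe_toNNReal _ (by
        rw [← variance_inner_eq hW]; exact variance_nonneg _ _)]
    simp
  simp only [ProbabilityMeasure.coe_mk, Measure.map_id] at h1 ⊢
  rw [hlim]
  refine h1.congr fun n => ?_
  rw [charFun_apply, charFun_apply, integral_map ?_ (by fun_prop), integral_map (hmeas n)
    (by fun_prop)]
  · congr 1
    ext ω
    have hmean : (∫ x, ∑ i, t i * W x i ∂ν) = inner ℝ (∫ x, W x ∂ν) t := by
      simp only [hint]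
      rw [real_inner_comm, ← integral_inner (hWL.integrable one_le_two)]
      simp only [real_inner_comm]
    have hsm : sampleMean (fun x => ∑ i, t i * W x i) (sample X n ω)
        = inner ℝ (sampleMean W (sample X n ω)) t := by
      simp only [hint, sampleMean, inner_smul_left, sum_inner, smul_eq_mul]
      simp
    rw [hmean, hsm, ← inner_sub_left, inner_smul_left]
    simp
  · exact (hX.tendstoInDistribution_sampleMean hφ).forall_aemeasurable n

end CLT

/-! ### Uniform convergence of tail probabilities -/

/-- Pólya's theorem for tail functions. -/
theorem eventually_forall_abs_sub_lt_of_antitone {G : ℕ → ℝ → ℝ} {F : ℝ → ℝ}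
    (hG : ∀ n, Antitone (G n)) (hG0 : ∀ n t, 0 ≤ G n t) (hG1 : ∀ n t, G n t ≤ 1)
    (hFanti : Antitone F) (hFc : Continuous F) (hbot : Tendsto F atBot (𝓝 1))
    (htop : Tendsto F atTop (𝓝 0)) (hlim : ∀ t, Tendsto (fun n => G n t) atTop (𝓝 (F t)))
    {ε : ℝ} (hε : 0 < ε) : ∀ᶠ n in atTop, ∀ t, |G n t - F t| < ε := by
  have hF1 : ∀ t, F t ≤ 1 := fun t => hFanti.ge_of_tendsto hbot t
  have hF0 : ∀ t, 0 ≤ F t := fun t => hFanti.le_of_tendsto htop t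
  obtain ⟨a, ha⟩ := (hbot.eventually_const_lt (show 1 - ε / 2 < 1 by linarith)).exists
  obtain ⟨b, hb⟩ := (htop.eventually_lt_const (half_pos hε)).exists
  have hclose : ∀ t, ∀ᶠ n in atTop, |G n t - F t| < ε / 4 := fun t => by
    simpa [Real.dist_eq] using Metric.tendsto_nhds.1 (hlim t) (ε / 4) (by linarith)
  -- On `[a, b]` compactness replaces the usual finite grid: near each `t`, monotonicity traps both
  -- functions between their values at `t ± δ / 2`. Outside `[a, b]` the limits `1` and `0` do the
  -- trapping.
  have hmid : ∀ᶠ n in atTop, ∀ t ∈ Set.Icc a b, |G n t - F t| < ε := by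
    refine isCompact_Icc.induction_on (p := fun s => ∀ᶠ n in atTop, ∀ t ∈ s, |G n t - F t| < ε)
      (by simp) (fun s u hsu hu => hu.mono fun n hn t ht => hn t (hsu ht))
      (fun s u hs hu => (hs.and hu).mono fun n hn t ht => ht.elim (hn.1 t) (hn.2 t)) fun t _ => ?_
    obtain ⟨δ, hδ, hδF⟩ := Metric.continuousAt_iff.1 (hFc.continuousAt (x := t)) (ε / 4)
      (by linarith)
    have h1 := hδF (x := t - δ / 2) (by rw [Real.dist_eq, abs_lt]; constructor <;> linarith)
    have h2 := hδF (x := t + δ / 2) (by rw [Real.dist_eq, abs_lt]; constructor <;> linarith)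
    rw [Real.dist_eq, abs_lt] at h1 h2
    refine ⟨Set.Ioo (t - δ / 2) (t + δ / 2), mem_nhdsWithin_of_mem_nhds
      (Ioo_mem_nhds (by linarith) (by linarith)), ?_⟩
    filter_upwards [hclose (t - δ / 2), hclose (t + δ / 2)] with n hn1 hn2 s hs
    rw [abs_lt] at hn1 hn2 ⊢
    have h3 := hG n hs.1.le
    have h4 := hG n hs.2.le
    have h5 := hFanti hs.1.le
    have h6 := hFanti hs.2.le
    constructor <;> linarith
  filter_upwards [hmid, hclose a, hclose b] with n hn hna hnb t
  rw [abs_lt] at hna hnb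
  rcases le_total t a with hta | hta
  · have h1 := hG n hta
    have h2 := hFanti hta
    have h3 := hG1 n t
    have h4 := hF1 t
    rw [abs_lt]
    constructor <;> linarith
  rcases le_total b t with htb | htb
  · have h1 := hG n htb
    have h2 := hFanti htb
    have h3 := hG0 n t
    have h4 := hF0 t
    rw [abs_lt]
    constructor <;> linarith
  · exact hn t ⟨hta, htb⟩

/-- The jump of the distribution function at a point is the mass of that point. -/
theorem continuous_cdf (ν : Measure ℝ) [IsProbabilityMeasure ν] (hν : ∀ x, ν {x} = 0) :
    Continuous (cdf ν) := by
  refine continuous_iff_continuousAt.2 fun x => ?_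
  rw [(monotone_cdf ν).continuousAt_iff_leftLim_eq_rightLim, StieltjesFunction.rightLim_eq]
  refine le_antisymm ((monotone_cdf ν).leftLim_le le_rfl) ?_
  have h1 := StieltjesFunction.measure_singleton (cdf ν) x
  rw [measure_cdf, hν x] at h1
  have h2 := ENNReal.ofReal_eq_zero.1 h1.symm
  linarith

/-! ### Tail probabilities under asymptotic normality. -/

section Power

variable {Ω : Type*} [MeasurableSpace Ω] {P : Measure Ω} [IsProbabilityMeasure P]

theorem gaussianReal_real_Ioi {v : NNReal} (hv : v ≠ 0) (t : ℝ) :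
    (gaussianReal 0 v).real (Set.Ioi t) = 1 - cdf (gaussianReal 0 1) (t / √v) := by
  have hs : 0 < √(v : ℝ) := Real.sqrt_pos.2 (NNReal.coe_pos.2 (pos_iff_ne_zero.2 hv))
  have hmap : (gaussianReal 0 1).map (√(v : ℝ) * ·) = gaussianReal 0 v := by
    rw [gaussianReal_map_const_mul]
    congr 1
    · simp
    · ext
      simp
  rw [← hmap, map_measureReal_apply (by fun_prop) measurableSet_Ioi, cdf_eq_real,
    ← probReal_compl_eq_one_sub measurableSet_Iic]
  congr 1
  ext x
  simp [div_lt_iff₀ hs, mul_comm]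

/-- The tail probabilities of `Z n` converge uniformly to those of a nondegenerate normal law if
`Z n`, which need not be measurable, is asymptotically equivalent to a sequence converging to it
in distribution. -/
theorem eventually_forall_abs_tail_sub_lt {Y Z : ℕ → Ω → ℝ} {v : NNReal} (hv : v ≠ 0)
    (hY : TendstoInDistribution Y atTop (id : ℝ → ℝ) (fun _ => P) (gaussianReal 0 v))
    (hZ : ∀ ε > 0, HoldsWHP P fun n ω => |Z n ω - Y n ω| < ε) {ε : ℝ} (hε : 0 < ε) :
    ∀ᶠ n in atTop, ∀ t : ℝ,
      |P.real {ω | t < Z n ω} - (1 - cdf (gaussianReal 0 1) (t / √v))| < ε := by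
  have hcdf : Continuous (cdf (gaussianReal 0 1)) := by
    have : NullSingletonClass (gaussianReal 0 1) :=
      nullSingletonClass_gaussianReal (one_ne_zero : (1 : NNReal) ≠ 0)
    exact continuous_cdf _ fun x => measure_singleton x
  have hs : 0 < √(v : ℝ) := Real.sqrt_pos.2 (NNReal.coe_pos.2 (pos_iff_ne_zero.2 hv))
  set F : ℝ → ℝ := fun t => 1 - cdf (gaussianReal 0 1) (t / √v) with hF
  have hFc : Continuous F := continuous_const.sub (hcdf.comp (continuous_id.div_const _))
  have hFanti : Antitone F := fun a b hab =>
    sub_le_sub_left (monotone_cdf _ (div_le_div_of_nonneg_right hab hs.le)) 1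
  have hYlim : ∀ t, Tendsto (fun n => P.real {ω | t < Y n ω}) atTop (𝓝 (F t)) := by
    intro t
    have : NullSingletonClass (gaussianReal 0 v) := nullSingletonClass_gaussianReal hv
    have h := ProbabilityMeasure.tendsto_measure_of_null_frontier_of_tendsto' hY.tendsto
      (E := Set.Ioi t) (by simp)
    simp only [ProbabilityMeasure.coe_mk, Measure.map_id] at h
    have h' := (ENNReal.tendsto_toReal (measure_ne_top _ _)).comp h
    rw [← measureReal_def, gaussianReal_real_Ioi hv] at h'
    refine h'.congr fun n => ?_
    simp only [Function.comp_apply]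
    rw [← measureReal_def, map_measureReal_apply_of_aemeasurable (hY.forall_aemeasurable n)
      measurableSet_Ioi]
    rfl
  -- Slutsky's theorem by hand, since `Z n` need not be measurable: up to an event of small outer
  -- probability, `t < Z n` lies between `t + δ / 2 < Y n` and `t - δ / 2 < Y n`.
  have hZlim : ∀ t, Tendsto (fun n => P.real {ω | t < Z n ω}) atTop (𝓝 (F t)) := by
    intro t
    refine Metric.tendsto_nhds.2 fun e he => ?_
    obtain ⟨δ, hδ, hδF⟩ := Metric.continuousAt_iff.1 (hFc.continuousAt (x := t)) (e / 3)
      (by linarith)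
    have h1 := hδF (x := t - δ / 2) (by rw [Real.dist_eq, abs_lt]; constructor <;> linarith)
    have h2 := hδF (x := t + δ / 2) (by rw [Real.dist_eq, abs_lt]; constructor <;> linarith)
    have hbad : Tendsto (fun n => P.real {ω | ¬ |Z n ω - Y n ω| < δ / 2}) atTop (𝓝 0) := by
      simpa [Measure.real, Function.comp_def] using
        (ENNReal.tendsto_toReal ENNReal.zero_ne_top).comp (hZ (δ / 2) (half_pos hδ))
    filter_upwards [Metric.tendsto_nhds.1 (hYlim (t - δ / 2)) (e / 3) (by linarith),
      Metric.tendsto_nhds.1 (hYlim (t + δ / 2)) (e / 3) (by linarith),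
      hbad.eventually_lt_const (show 0 < e / 3 by linarith)] with n h3 h4 h5
    rw [Real.dist_eq, abs_lt] at h1 h2 h3 h4 ⊢
    have h6 : P.real {ω | t < Z n ω}
        ≤ P.real {ω | t - δ / 2 < Y n ω} + P.real {ω | ¬ |Z n ω - Y n ω| < δ / 2} := by
      refine le_trans (measureReal_mono fun ω hω => ?_) (measureReal_union_le _ _)
      by_cases h : |Z n ω - Y n ω| < δ / 2
      · left
        have := (abs_lt.1 h).2
        simp only [Set.mem_ofPred_eq] at hω ⊢
        linarith
      · exact Or.inr h
    have h7 : P.real {ω | t + δ / 2 < Y n ω}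
        ≤ P.real {ω | t < Z n ω} + P.real {ω | ¬ |Z n ω - Y n ω| < δ / 2} := by
      refine le_trans (measureReal_mono fun ω hω => ?_) (measureReal_union_le _ _)
      by_cases h : |Z n ω - Y n ω| < δ / 2
      · left
        have := (abs_lt.1 h).1
        simp only [Set.mem_ofPred_eq] at hω ⊢
        linarith
      · exact Or.inr h
    constructor <;> linarith
  refine eventually_forall_abs_sub_lt_of_antitone (F := F)
    (fun n a b hab => measureReal_mono fun ω hω => ?_) (fun n t => measureReal_nonneg)
    (fun n t => measureReal_le_one) hFanti hFc ?_ ?_ hZlim hε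
  · exact lt_of_le_of_lt hab hω
  · simpa using tendsto_const_nhds.sub ((tendsto_cdf_atBot (gaussianReal 0 1)).comp
      (tendsto_id.atBot_div_const hs))
  · simpa using (tendsto_const_nhds (x := (1 : ℝ))).sub
      ((tendsto_cdf_atTop (gaussianReal 0 1)).comp (tendsto_id.atTop_div_const hs))

end Power

/-! ### Positivity of the `S`-divergence -/

section SDivergence

/-- The function `∫₀ᵈ exp (c z) dz`. -/
noncomputable def expPrimitive (c d : ℝ) : ℝ := if c = 0 then d else (Real.exp (c * d) - 1) / c

theorem hasDerivAt_expPrimitive (c d : ℝ) :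
    HasDerivAt (expPrimitive c) (Real.exp (c * d)) d := by
  by_cases hc : c = 0
  · have : expPrimitive c = fun d => d := by ext d; simp [expPrimitive, hc]
    rw [this, hc]
    simpa using hasDerivAt_id' d
  · have : expPrimitive c = fun d => (Real.exp (c * d) - 1) / c := by ext d; simp [expPrimitive, hc]
    rw [this]
    have h1 : HasDerivAt (fun d => c * d) c d := by simpa using (hasDerivAt_id d).const_mul c
    have := ((h1.exp).sub_const 1).div_const c
    rwa [mul_div_cancel_right₀ _ hc] at this

theorem expPrimitive_zero (c : ℝ) : expPrimitive c 0 = 0 := by simp [expPrimitive]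

/-- The difference of the two sides vanishes at `0`, and its derivative `exp (c' z) - exp (c z)` has
the sign of `z`. -/
theorem expPrimitive_lt_expPrimitive {c c' d : ℝ} (hc : c < c') (hd : d ≠ 0) :
    expPrimitive c d < expPrimitive c' d := by
  have hder : ∀ z, HasDerivAt (fun z => expPrimitive c' z - expPrimitive c z)
      (Real.exp (c' * z) - Real.exp (c * z)) z := fun z =>
    (hasDerivAt_expPrimitive c' z).sub (hasDerivAt_expPrimitive c z)
  have hcont : Continuous fun z => expPrimitive c' z - expPrimitive c z :=
    continuous_iff_continuousAt.2 fun z => (hder z).continuousAt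
  have h0 : expPrimitive c' 0 - expPrimitive c 0 = 0 := by simp [expPrimitive_zero]
  rcases hd.lt_or_gt with hd | hd
  · have hanti := strictAntiOn_of_deriv_neg (convex_Iic (0 : ℝ)) hcont.continuousOn fun z hz => by
      rw [interior_Iic] at hz
      rw [(hder z).deriv, sub_neg]
      exact Real.exp_lt_exp.2 (mul_lt_mul_of_neg_right hc hz)
    have := hanti hd.le Set.self_mem_Iic hd
    simp only [h0] at this
    linarith
  · have hmono := strictMonoOn_of_deriv_pos (convex_Ici (0 : ℝ)) hcont.continuousOn fun z hz => by
      rw [interior_Ici] at hz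
      rw [(hder z).deriv, sub_pos]
      exact Real.exp_lt_exp.2 (mul_lt_mul_of_pos_right hc hz)
    have := hmono Set.self_mem_Ici hd.le hd
    simp only [h0] at this
    linarith

/-- The integrand of the `S`-divergence. -/
noncomputable def sDivIntegrand (A B g f : ℝ) : ℝ :=
  f ^ B * g ^ A * (expPrimitive A (Real.log f - Real.log g)
    - expPrimitive (-B) (Real.log f - Real.log g))

/-- `A + B > 0` says `-B < A`, and `expPrimitive` is monotone in its exponent. -/
theorem sDivIntegrand_nonneg {A B g f : ℝ} (hAB : 0 < A + B) (hg : 0 ≤ g) (hf : 0 ≤ f) :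
    0 ≤ sDivIntegrand A B g f := by
  refine mul_nonneg (mul_nonneg (Real.rpow_nonneg hf _) (Real.rpow_nonneg hg _)) (sub_nonneg.2 ?_)
  by_cases hd : Real.log f - Real.log g = 0
  · rw [hd, expPrimitive_zero, expPrimitive_zero]
  · exact (expPrimitive_lt_expPrimitive (by linarith) hd).le

theorem eq_of_sDivIntegrand_eq_zero {A B g f : ℝ} (hAB : 0 < A + B) (hg : 0 < g) (hf : 0 < f)
    (h : sDivIntegrand A B g f = 0) : g = f := by
  have hne : f ^ B * g ^ A ≠ 0 := (mul_pos (Real.rpow_pos_of_pos hf _)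
    (Real.rpow_pos_of_pos hg _)).ne'
  have h1 := (mul_eq_zero.1 h).resolve_left hne
  by_contra hgf
  have hd : Real.log f - Real.log g ≠ 0 := fun h0 =>
    hgf (Real.log_injOn_pos hg hf (sub_eq_zero.1 h0).symm)
  have := expPrimitive_lt_expPrimitive (show -B < A by linarith) hd
  linarith

theorem rpow_mul_rpow_mul_exp_left {A B g f : ℝ} (hg : 0 < g) (hf : 0 < f) :
    f ^ B * g ^ A * Real.exp (A * (Real.log f - Real.log g)) = f ^ (A + B) := by
  rw [Real.rpow_def_of_pos hg, Real.rpow_def_of_pos hf, Real.rpow_def_of_pos hf, ← Real.exp_add,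
    ← Real.exp_add]
  congr 1
  ring

theorem rpow_mul_rpow_mul_exp_right {A B g f : ℝ} (hg : 0 < g) (hf : 0 < f) :
    f ^ B * g ^ A * Real.exp (-B * (Real.log f - Real.log g)) = g ^ (A + B) := by
  rw [Real.rpow_def_of_pos hg, Real.rpow_def_of_pos hg, Real.rpow_def_of_pos hf, ← Real.exp_add,
    ← Real.exp_add]
  congr 1
  ring

/-- One expression covers the generic formula and both continuous limits, because `expPrimitive`
already degenerates correctly at exponent `0`. The exponentials turn `f ^ B * g ^ A` into pure
powers with exponent `A + B`. -/
theorem sDivIntegrand_eq {A B g f : ℝ} (hAB : 0 < A + B) (hg : 0 ≤ g) (hsupp : 0 < g ↔ 0 < f)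
    (hf : 0 ≤ f) :
    sDivIntegrand A B g f =
      if A = 0 then f ^ (A + B) * Real.log (f / g) - 1 / (A + B) * (f ^ (A + B) - g ^ (A + B))
      else if B = 0 then
        g ^ (A + B) * Real.log (g / f) - 1 / (A + B) * (g ^ (A + B) - f ^ (A + B))
      else 1 / A * f ^ (A + B) - (A + B) / (A * B) * (f ^ B * g ^ A) + 1 / B * g ^ (A + B) := by
  -- Off the common support both sides are `0`; in the generic case this uses `0 ^ A = 0` for every
  -- `A ≠ 0`, negative ones included.
  rcases hg.eq_or_lt with rfl | hg
  · have hf0 : f = 0 := le_antisymm (not_lt.1 fun h => lt_irrefl _ (hsupp.2 h)) hf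
    subst hf0
    rw [sDivIntegrand, Real.zero_rpow hAB.ne']
    split_ifs with hA hB
    · rw [hA, zero_add] at hAB
      simp [Real.zero_rpow hAB.ne']
    · rw [hB, add_zero] at hAB
      simp [Real.zero_rpow hAB.ne']
    · simp [Real.zero_rpow hA]
  have hf := hsupp.1 hg
  have h1 := rpow_mul_rpow_mul_exp_left (A := A) (B := B) hg hf
  have h2 := rpow_mul_rpow_mul_exp_right (A := A) (B := B) hg hf
  rw [sDivIntegrand, expPrimitive, expPrimitive, mul_sub]
  simp only [neg_eq_zero]
  split_ifs with hA hB hB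
  · rw [hA, hB] at hAB; simp at hAB
  · subst hA
    rw [Real.log_div hf.ne' hg.ne']
    simp only [zero_add, Real.rpow_zero, mul_one] at h2 ⊢
    rw [← h2]
    field_simp
    ring
  · subst hB
    rw [Real.log_div hg.ne' hf.ne']
    simp only [add_zero, Real.rpow_zero, one_mul] at h1 ⊢
    rw [← h1]
    field_simp
    ring
  · rw [← h1, ← h2]
    field_simp
    ring

variable {𝒳 : Type*} [MeasurableSpace 𝒳] {μ : Measure 𝒳} {γ lam : ℝ} {g f : 𝒳 → ℝ}

theorem cA_add_cB (γ lam : ℝ) : cA γ lam + cB γ lam = 1 + γ := by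
  simp only [cA, cB]; ring

theorem sDiv_eq_integral_sDivIntegrand (hγ : 0 ≤ γ) (hg : ∀ x, 0 ≤ g x) (hf : ∀ x, 0 ≤ f x)
    (hsupp : ∀ x, 0 < g x ↔ 0 < f x) (hfin : SDivFinite μ γ lam g f) :
    Integrable (fun x => sDivIntegrand (cA γ lam) (cB γ lam) (g x) (f x)) μ ∧
      sDiv μ γ lam g f = ∫ x, sDivIntegrand (cA γ lam) (cB γ lam) (g x) (f x) ∂μ := by
  have hAB := cA_add_cB γ lam
  have hpos : 0 < cA γ lam + cB γ lam := by rw [hAB]; linarith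
  simp only [fun x => sDivIntegrand_eq hpos (hg x) (hsupp x) (hf x), hAB]
  obtain ⟨h1, h2, h3⟩ := hfin
  rw [sDiv]
  split_ifs at h3 ⊢ with hA hB
  · have h4 : Integrable (fun x => 1 / (1 + γ) * (f x ^ (1 + γ) - g x ^ (1 + γ))) μ :=
      (h2.sub h1).const_mul _
    refine ⟨h3.sub h4, ?_⟩
    rw [← integral_sub h2 h1, ← integral_const_mul, ← integral_sub h3 h4]
  · have h4 : Integrable (fun x => 1 / (1 + γ) * (g x ^ (1 + γ) - f x ^ (1 + γ))) μ :=
      (h1.sub h2).const_mul _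
    refine ⟨h3.sub h4, ?_⟩
    rw [← integral_sub h1 h2, ← integral_const_mul, ← integral_sub h3 h4]
  · have h4 := h2.const_mul (1 / cA γ lam)
    have h5 := h3.const_mul ((1 + γ) / (cA γ lam * cB γ lam))
    have h6 := h1.const_mul (1 / cB γ lam)
    have h7 : Integrable (fun x => 1 / cA γ lam * f x ^ (1 + γ)
        - (1 + γ) / (cA γ lam * cB γ lam) * (f x ^ cB γ lam * g x ^ cA γ lam)) μ := h4.sub h5
    refine ⟨h7.add h6, ?_⟩
    rw [← integral_const_mul, ← integral_const_mul, ← integral_const_mul, ← integral_sub h4 h5,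
      ← integral_add h7 h6]

/-- The `S`-divergence between different densities with common support is positive. -/
theorem sDiv_pos (hγ : 0 ≤ γ) (hg : ∀ x, 0 ≤ g x) (hf : ∀ x, 0 ≤ f x)
    (hsupp : ∀ x, 0 < g x ↔ 0 < f x) (hfin : SDivFinite μ γ lam g f) (hne : law μ g ≠ law μ f) :
    0 < sDiv μ γ lam g f := by
  have hpos : 0 < cA γ lam + cB γ lam := by rw [cA_add_cB]; linarith
  obtain ⟨hint, heq⟩ := sDiv_eq_integral_sDivIntegrand hγ hg hf hsupp hfin
  have hnn : 0 ≤ fun x => sDivIntegrand (cA γ lam) (cB γ lam) (g x) (f x) := fun x =>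
    sDivIntegrand_nonneg hpos (hg x) (hf x)
  rw [heq]
  refine (integral_nonneg hnn).lt_of_ne fun h0 => hne ?_
  refine withDensity_congr_ae ?_
  filter_upwards [(integral_eq_zero_iff_of_nonneg hnn hint).1 h0.symm] with x hx
  rcases (hg x).eq_or_lt with h | h
  · have : f x = 0 := le_antisymm (not_lt.1 fun h' => by
      have := (hsupp x).2 h'; linarith) (hf x)
    rw [← h, this]
  · rw [eq_of_sDivIntegrand_eq_zero hpos h ((hsupp x).1 h) hx]

end SDivergence

/-! ### Iterated derivatives as iterated Fréchet derivatives -/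

section IteratedDerivatives

variable {E : Type*} [NormedAddCommGroup E] [NormedSpace ℝ E]

/-- A continuous bilinear form on `E`, as a curried continuous linear map. -/
noncomputable def curryTwo : (E [×2]→L[ℝ] ℝ) →L[ℝ] E →L[ℝ] E →L[ℝ] ℝ :=
  (ContinuousLinearMap.compL ℝ E (E [×1]→L[ℝ] ℝ) (E →L[ℝ] ℝ)
    (continuousMultilinearCurryFin1 ℝ E ℝ).toContinuousLinearEquiv.toContinuousLinearMap) ∘L
  (continuousMultilinearCurryLeftEquiv ℝ (fun _ : Fin 2 => E)
    ℝ).toContinuousLinearEquiv.toContinuousLinearMap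

theorem curryTwo_apply (A : E [×2]→L[ℝ] ℝ) (v w : E) : curryTwo A v w = A ![v, w] := by
  refine congrArg A (a₁ := Fin.cons v (Fin.snoc 0 w)) (funext fun i => ?_)
  fin_cases i <;> rfl

theorem norm_curryTwo_le (A : E [×2]→L[ℝ] ℝ) : ‖curryTwo A‖ ≤ ‖A‖ := by
  refine ContinuousLinearMap.opNorm_le_bound₂ _ (norm_nonneg _) fun v w => ?_
  rw [curryTwo_apply]
  refine (A.le_opNorm _).trans_eq ?_
  simp [Fin.prod_univ_two, mul_assoc]

theorem curryTwo_iteratedFDeriv (k : E → ℝ) (θ : E) :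
    curryTwo (iteratedFDeriv ℝ 2 k θ) = fderiv ℝ (fderiv ℝ k) θ := by
  ext v w
  rw [curryTwo_apply, iteratedFDeriv_two_apply]
  rfl

/-- Evaluation of a one-fold multilinear map, as a continuous linear map. -/
noncomputable def curryOne : (E [×1]→L[ℝ] ℝ) →L[ℝ] E →L[ℝ] ℝ :=
  (continuousMultilinearCurryFin1 ℝ E ℝ).toContinuousLinearEquiv.toContinuousLinearMap

theorem curryOne_iteratedFDeriv (k : E → ℝ) (θ : E) :
    curryOne (iteratedFDeriv ℝ 1 k θ) = fderiv ℝ k θ := by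
  ext v
  exact iteratedFDeriv_one_apply (𝕜 := ℝ) (f := k) (x := θ) _

/-- Evaluation of a constant multilinear map, as a continuous linear map. -/
noncomputable def curryZero : (E [×0]→L[ℝ] ℝ) →L[ℝ] ℝ :=
  (continuousMultilinearCurryFin0 ℝ E ℝ).toContinuousLinearEquiv.toContinuousLinearMap

theorem norm_fderiv_fderiv_sub_le {k : E → ℝ} {s : Set E} (hs : Convex ℝ s) {M : ℝ}
    (hd : ∀ t ∈ s, DifferentiableAt ℝ (iteratedFDeriv ℝ 2 k) t)
    (hM : ∀ t ∈ s, ‖iteratedFDeriv ℝ 3 k t‖ ≤ M) {a b : E} (ha : a ∈ s) (hb : b ∈ s) :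
    ‖fderiv ℝ (fderiv ℝ k) b - fderiv ℝ (fderiv ℝ k) a‖ ≤ M * ‖b - a‖ := by
  rw [← curryTwo_iteratedFDeriv, ← curryTwo_iteratedFDeriv, ← map_sub]
  refine (norm_curryTwo_le _).trans
    (hs.norm_image_sub_le_of_norm_fderiv_le hd (fun t ht => ?_) ha hb)
  rw [norm_fderiv_iteratedFDeriv]
  exact hM t ht

/-- A bounded third derivative makes the Hessian Lipschitz, and two mean value inequalities yield
the remainders; the sharp factorial constants are not needed. Only differentiability of the second
derivative is asked for, which is what `DiffUnderIntegral` provides. -/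
theorem hasTaylorBound_of_norm_iteratedFDeriv_le {k : E → ℝ} {θ₀ : E} {ρ M : ℝ}
    (hk : ∀ t ∈ Metric.ball θ₀ ρ, ContDiffAt ℝ 2 k t)
    (hd : ∀ t ∈ Metric.ball θ₀ ρ, DifferentiableAt ℝ (iteratedFDeriv ℝ 2 k) t)
    (hM : ∀ t ∈ Metric.ball θ₀ ρ, ‖iteratedFDeriv ℝ 3 k t‖ ≤ M) : HasTaylorBound k θ₀ ρ M := by
  have hgrad : ∀ θ ∈ Metric.ball θ₀ ρ,
      ‖fderiv ℝ k θ - fderiv ℝ k θ₀ - fderiv ℝ (fderiv ℝ k) θ₀ (θ - θ₀)‖ ≤ M * ‖θ - θ₀‖ ^ 2 := by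
    intro θ hθ
    have h0 : θ₀ ∈ Metric.ball θ₀ ρ := Metric.mem_ball_self (Metric.pos_of_mem_ball hθ)
    have hseg : segment ℝ θ₀ θ ⊆ Metric.ball θ₀ ρ := (convex_ball θ₀ ρ).segment_subset h0 hθ
    have hM0 : 0 ≤ M := (norm_nonneg _).trans (hM θ hθ)
    rw [pow_two, ← mul_assoc]
    refine Convex.norm_image_sub_le_of_norm_hasFDerivWithin_le' (𝕜 := ℝ)
      (f' := fderiv ℝ (fderiv ℝ k)) (fun t ht => ?_) (fun t ht => ?_) (convex_segment θ₀ θ)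
      (left_mem_segment ℝ θ₀ θ) (right_mem_segment ℝ θ₀ θ)
    · exact (((hk t (hseg ht)).fderiv_right (m := 1) (by norm_num)).differentiableAt
        one_ne_zero).hasFDerivAt.hasFDerivWithinAt
    · refine (norm_fderiv_fderiv_sub_le (convex_ball θ₀ ρ) hd hM h0 (hseg ht)).trans ?_
      gcongr
      exact norm_sub_le_of_mem_segment ht
  refine ⟨fun t ht => (hk t ht).of_le (by norm_num), hgrad, fun θ hθ => ?_⟩
  have h0 : θ₀ ∈ Metric.ball θ₀ ρ := Metric.mem_ball_self (Metric.pos_of_mem_ball hθ)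
  have hseg : segment ℝ θ₀ θ ⊆ Metric.ball θ₀ ρ := (convex_ball θ₀ ρ).segment_subset h0 hθ
  have hM0 : 0 ≤ M := (norm_nonneg _).trans (hM θ hθ)
  have h1 := norm_sub_taylor_two_le (B := fderiv ℝ (fderiv ℝ k) θ₀) (A := fderiv ℝ k θ₀)
    (hk θ₀ h0).fderiv_fderiv_comm (convex_segment θ₀ θ)
    (left_mem_segment ℝ θ₀ θ) (right_mem_segment ℝ θ₀ θ) (c := M * ‖θ - θ₀‖ ^ 2)
    (fun t ht => ((hk t (hseg ht)).differentiableAt two_ne_zero).hasFDerivAt) fun t ht =>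
      (hgrad t (hseg ht)).trans (by gcongr; exact norm_sub_le_of_mem_segment ht)
  rw [Real.norm_eq_abs, smul_eq_mul] at h1
  exact h1.trans_eq (by ring)

end IteratedDerivatives

/-! ### Differentiation under the integral sign -/

namespace DiffUnderIntegral

variable {p : ℕ} {𝒳 : Type*} [MeasurableSpace 𝒳] {ν : Measure 𝒳} {F : Param p → 𝒳 → ℝ}
  {ω : Set (Param p)} {θ : Param p}

theorem contDiffAt (hF : DiffUnderIntegral ν F ω) (hω : IsOpen ω) (hθ : θ ∈ ω) :
    ContDiffAt ℝ 2 (fun t => ∫ x, F t x ∂ν) θ :=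
  hF.1.1.contDiffAt (hω.mem_nhds hθ)

theorem differentiableAt (hF : DiffUnderIntegral ν F ω) (hω : IsOpen ω) (hθ : θ ∈ ω) :
    DifferentiableAt ℝ (iteratedFDeriv ℝ 2 (fun t => ∫ x, F t x ∂ν)) θ :=
  hF.1.2.differentiableAt (hω.mem_nhds hθ)

theorem integrable (hF : DiffUnderIntegral ν F ω) (hθ : θ ∈ ω) : Integrable (F θ) ν :=
  curryZero.integrable_comp (hF.2 θ hθ 0 (by norm_num)).1

theorem integrable_fderiv (hF : DiffUnderIntegral ν F ω) (hθ : θ ∈ ω) :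
    Integrable (fun x => fderiv ℝ (fun t => F t x) θ) ν := by
  simpa only [curryOne_iteratedFDeriv] using
    curryOne.integrable_comp (hF.2 θ hθ 1 (by norm_num)).1

theorem fderiv_integral (hF : DiffUnderIntegral ν F ω) (hθ : θ ∈ ω) :
    fderiv ℝ (fun t => ∫ x, F t x ∂ν) θ = ∫ x, fderiv ℝ (fun t => F t x) θ ∂ν := by
  obtain ⟨h1, h2⟩ := hF.2 θ hθ 1 (by norm_num)
  rw [← curryOne_iteratedFDeriv, h2, ← ContinuousLinearMap.integral_comp_comm _ h1]
  simp only [curryOne_iteratedFDeriv]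

theorem integrable_fderiv_fderiv (hF : DiffUnderIntegral ν F ω) (hθ : θ ∈ ω) :
    Integrable (fun x => fderiv ℝ (fderiv ℝ fun t => F t x) θ) ν := by
  simpa only [curryTwo_iteratedFDeriv] using
    curryTwo.integrable_comp (hF.2 θ hθ 2 (by norm_num)).1

theorem fderiv_fderiv_integral (hF : DiffUnderIntegral ν F ω) (hθ : θ ∈ ω) :
    fderiv ℝ (fderiv ℝ fun t => ∫ x, F t x ∂ν) θ
      = ∫ x, fderiv ℝ (fderiv ℝ fun t => F t x) θ ∂ν := by
  obtain ⟨h1, h2⟩ := hF.2 θ hθ 2 (by norm_num)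
  rw [← curryTwo_iteratedFDeriv, h2, ← ContinuousLinearMap.integral_comp_comm _ h1]
  simp only [curryTwo_iteratedFDeriv]

end DiffUnderIntegral

/-! ### Derivatives of powers in terms of the logarithmic derivatives -/

section Powers

/-- Derivatives of powers are computed through the logarithm, since score and information are
logarithmic derivatives. -/
theorem eventually_rpow_eq_exp {E : Type*} [TopologicalSpace E] {k : E → ℝ} {θ : E}
    (hk : ContinuousAt k θ) (hpos : 0 < k θ) (c : ℝ) :
    (fun t => k t ^ c) =ᶠ[𝓝 θ] fun t => Real.exp (c * Real.log (k t)) := by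
  filter_upwards [hk.eventually (lt_mem_nhds hpos)] with t ht
  rw [Real.rpow_def_of_pos ht, mul_comm]

variable {E : Type*} [NormedAddCommGroup E] [NormedSpace ℝ E] {k φ : E → ℝ} {θ : E}

theorem fderiv_exp_const_mul (hφ : DifferentiableAt ℝ φ θ) (c : ℝ) :
    fderiv ℝ (fun t => Real.exp (c * φ t)) θ = (c * Real.exp (c * φ θ)) • fderiv ℝ φ θ := by
  have h : HasFDerivAt (fun t => Real.exp (c * φ t)) (Real.exp (c * φ θ) • c • fderiv ℝ φ θ) θ :=
    (hφ.hasFDerivAt.const_mul c).exp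
  rw [h.fderiv, smul_smul, mul_comm]

theorem fderiv_fderiv_exp_const_mul (hφ : ContDiffAt ℝ 2 φ θ) (c : ℝ) (v w : E) :
    fderiv ℝ (fderiv ℝ fun t => Real.exp (c * φ t)) θ v w = Real.exp (c * φ θ) *
      (c * fderiv ℝ (fderiv ℝ φ) θ v w + c ^ 2 * (fderiv ℝ φ θ v * fderiv ℝ φ θ w)) := by
  have h1 : fderiv ℝ (fun t => Real.exp (c * φ t)) =ᶠ[𝓝 θ]
      fun t => (c * Real.exp (c * φ t)) • fderiv ℝ φ t := by
    filter_upwards [hφ.eventually (by simp)] with t ht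
    exact fderiv_exp_const_mul (ht.differentiableAt two_ne_zero) c
  have hd : DifferentiableAt ℝ φ θ := hφ.differentiableAt two_ne_zero
  have h2 : HasFDerivAt (fun t => c * Real.exp (c * φ t))
      (c • Real.exp (c * φ θ) • c • fderiv ℝ φ θ) θ :=
    ((hd.hasFDerivAt.const_mul c).exp).const_mul c
  have h3 : HasFDerivAt (fderiv ℝ φ) (fderiv ℝ (fderiv ℝ φ) θ) θ :=
    ((hφ.fderiv_right (m := 1) (by norm_num)).differentiableAt one_ne_zero).hasFDerivAt
  rw [h1.fderiv_eq, (h2.fun_smul h3).fderiv]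
  simp only [_root_.add_apply, _root_.smul_apply, ContinuousLinearMap.smulRight_apply, smul_eq_mul]
  ring

theorem fderiv_rpow_eq (hk : ContDiffAt ℝ 2 k θ) (hpos : 0 < k θ) (c : ℝ) :
    fderiv ℝ (fun t => k t ^ c) θ = (c * k θ ^ c) • fderiv ℝ (fun t => Real.log (k t)) θ := by
  rw [(eventually_rpow_eq_exp hk.continuousAt hpos c).fderiv_eq,
    fderiv_exp_const_mul ((hk.log hpos.ne').differentiableAt two_ne_zero),
    Real.rpow_def_of_pos hpos, mul_comm (Real.log _)]

theorem fderiv_fderiv_rpow_eq (hk : ContDiffAt ℝ 2 k θ) (hpos : 0 < k θ) (c : ℝ) (v w : E) :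
    fderiv ℝ (fderiv ℝ fun t => k t ^ c) θ v w = k θ ^ c *
      (c * fderiv ℝ (fderiv ℝ fun t => Real.log (k t)) θ v w + c ^ 2 *
        (fderiv ℝ (fun t => Real.log (k t)) θ v * fderiv ℝ (fun t => Real.log (k t)) θ w)) := by
  rw [(eventually_rpow_eq_exp hk.continuousAt hpos c).fderiv.fderiv_eq,
    fderiv_fderiv_exp_const_mul (hk.log hpos.ne'),
    Real.rpow_def_of_pos hpos, mul_comm (Real.log _)]

/-- Dividing by `β` gives the power and the logarithm the same derivative formula, so `β = 0` needs
no separate treatment later. -/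
theorem fderiv_boxCox_eq (hk : ContDiffAt ℝ 2 k θ) (hpos : 0 < k θ) (β : ℝ) :
    fderiv ℝ (fun t => boxCox β (k t)) θ = (k θ ^ β) • fderiv ℝ (fun t => Real.log (k t)) θ := by
  by_cases hβ : β = 0
  · simp [boxCox, hβ]
  · simp only [boxCox, hβ, if_false, div_eq_inv_mul]
    rw [fderiv_const_mul ((hk.rpow_const_of_ne hpos.ne').differentiableAt two_ne_zero),
      fderiv_rpow_eq hk hpos, smul_smul]
    congr 1
    field_simp

theorem fderiv_fderiv_boxCox_eq (hk : ContDiffAt ℝ 2 k θ) (hpos : 0 < k θ) (β : ℝ) (v w : E) :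
    fderiv ℝ (fderiv ℝ fun t => boxCox β (k t)) θ v w = k θ ^ β *
      (fderiv ℝ (fderiv ℝ fun t => Real.log (k t)) θ v w + β *
        (fderiv ℝ (fun t => Real.log (k t)) θ v * fderiv ℝ (fun t => Real.log (k t)) θ w)) := by
  by_cases hβ : β = 0
  · simp [boxCox, hβ]
  · have h1 : fderiv ℝ (fun t => boxCox β (k t)) =ᶠ[𝓝 θ]
        fun t => β⁻¹ • fderiv ℝ (fun t => k t ^ β) t := by
      filter_upwards [hk.eventually (by simp), hk.continuousAt.eventually (lt_mem_nhds hpos)]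
        with t ht hpt
      simp only [boxCox, hβ, if_false, div_eq_inv_mul]
      exact fderiv_const_mul ((ht.rpow_const_of_ne hpt.ne').differentiableAt two_ne_zero) _
    have h2 : DifferentiableAt ℝ (fderiv ℝ fun t => k t ^ β) θ :=
      ((hk.rpow_const_of_ne hpos.ne').fderiv_right (m := 1) (by norm_num)).differentiableAt
        one_ne_zero
    rw [h1.fderiv_eq, fderiv_fun_const_smul h2]
    simp only [_root_.smul_apply, smul_eq_mul]
    rw [fderiv_fderiv_rpow_eq hk hpos]
    field_simp

theorem contDiffAt_boxCox {n : WithTop ℕ∞} (hk : ContDiffAt ℝ n k θ) (hpos : 0 < k θ) (β : ℝ) :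
    ContDiffAt ℝ n (fun t => boxCox β (k t)) θ := by
  by_cases hβ : β = 0
  · simpa [boxCox, hβ] using hk.log hpos.ne'
  · simp only [boxCox, hβ, if_false]
    exact (hk.rpow_const_of_ne hpos.ne').div_const β

end Powers

/-! ### The law of an observation -/

section Law

variable {𝒳 : Type*} [MeasurableSpace 𝒳] {μ : Measure 𝒳} {g : 𝒳 → ℝ}

theorem ae_law_of_ae {A : 𝒳 → Prop} (h : ∀ᵐ x ∂μ, A x) : ∀ᵐ x ∂(law μ g), A x :=
  (withDensity_absolutelyContinuous μ _).ae_le h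

theorem integral_law (hg : Measurable g) (h0 : ∀ x, 0 ≤ g x) (φ : 𝒳 → ℝ) :
    ∫ x, φ x ∂(law μ g) = ∫ x, g x * φ x ∂μ := by
  rw [law, integral_withDensity_eq_integral_toReal_smul hg.ennreal_ofReal (by simp)]
  simp [ENNReal.toReal_ofReal, h0]

theorem integrable_law_iff (hg : Measurable g) (h0 : ∀ x, 0 ≤ g x) {φ : 𝒳 → ℝ} :
    Integrable φ (law μ g) ↔ Integrable (fun x => g x * φ x) μ := by
  rw [law, integrable_withDensity_iff_integrable_smul' hg.ennreal_ofReal (by simp)]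
  simp [ENNReal.toReal_ofReal, h0]

variable {p : ℕ} {Θ : Set (Param p)} {f : Param p → 𝒳 → ℝ} {θs : Param p}

theorem IsModel.isProbabilityMeasure_law (hmodel : IsModel μ Θ f) (hθs : θs ∈ Θ) :
    IsProbabilityMeasure (law μ (f θs)) :=
  ⟨by rw [law, withDensity_apply _ MeasurableSet.univ, Measure.restrict_univ,
    hmodel.lintegral_eq_one θs hθs]⟩

/-- The logarithmic formulas need positivity. Common support leaves only points where the likelihood
is positive on all of `Θ` or vanishes identically in the parameter. -/
theorem IsModel.forall_pos_or_forall_eq_zero (hmodel : IsModel μ Θ f) (x : 𝒳) :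
    (∀ t ∈ Θ, 0 < f t x) ∨ ∀ t ∈ Θ, f t x = 0 := by
  by_cases h : ∃ t ∈ Θ, 0 < f t x
  · obtain ⟨t, ht, hpos⟩ := h
    exact Or.inl fun t' ht' => (hmodel.common_support t ht t' ht' x).1 hpos
  · push Not at h
    exact Or.inr fun t ht => le_antisymm (h t ht) (hmodel.nonneg t ht x)

theorem IsModel.ae_law_pos (hmodel : IsModel μ Θ f) (hθs : θs ∈ Θ) :
    ∀ᵐ x ∂(law μ (f θs)), ∀ t ∈ Θ, 0 < f t x := by
  rw [law, ae_withDensity_iff (hmodel.measurable θs hθs).ennreal_ofReal]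
  refine Eventually.of_forall fun x hx => ?_
  refine (hmodel.forall_pos_or_forall_eq_zero x).resolve_right fun h => hx ?_
  simp [h θs hθs]

end Law

/-! ### The density power divergence loss in coordinates -/

section Coordinates

variable {p : ℕ} {𝒳 : Type*} {f : Param p → 𝒳 → ℝ} {β : ℝ} {θ : Param p} {x : 𝒳}

theorem hess_apply (F : Param p → ℝ) (θ : Param p) (j k : Fin p) :
    hess F θ j k = fderiv ℝ (fderiv ℝ F) θ (EuclideanSpace.single j 1)
      (EuclideanSpace.single k 1) := by
  rw [hess, Matrix.of_apply, iteratedFDeriv_two_apply]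
  rfl

theorem fderiv_fderiv_log_single (j k : Fin p) :
    fderiv ℝ (fderiv ℝ fun t => Real.log (f t x)) θ (EuclideanSpace.single j 1)
      (EuclideanSpace.single k 1) = -info f θ x j k := by
  rw [info, Matrix.neg_apply, neg_neg, hess_apply]

theorem fderiv_boxCox_single (hf : ContDiffAt ℝ 2 (fun t => f t x) θ) (hpos : 0 < f θ x)
    (j : Fin p) :
    fderiv ℝ (fun t => boxCox β (f t x)) θ (EuclideanSpace.single j 1) = wscore f β θ x j := by
  rw [fderiv_boxCox_eq hf hpos, _root_.smul_apply, smul_eq_mul, mul_comm]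
  rfl

theorem fderiv_fderiv_boxCox_single (hf : ContDiffAt ℝ 2 (fun t => f t x) θ) (hpos : 0 < f θ x)
    (j k : Fin p) :
    fderiv ℝ (fderiv ℝ fun t => boxCox β (f t x)) θ (EuclideanSpace.single j 1)
      (EuclideanSpace.single k 1)
      = f θ x ^ β * (-info f θ x j k + β * (score f θ x j * score f θ x k)) := by
  rw [fderiv_fderiv_boxCox_eq hf hpos, fderiv_fderiv_log_single]
  rfl

variable [MeasurableSpace 𝒳] {μ : Measure 𝒳} {Θ ω : Set (Param p)}

theorem IsModel.fderiv_rpow_single (hmodel : IsModel μ Θ f) (hβ : 0 ≤ β) (hω : IsOpen ω)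
    (hωΘ : ω ⊆ Θ) (hf : ContDiffOn ℝ 3 (fun t => f t x) ω) (hθ : θ ∈ ω) (j : Fin p) :
    fderiv ℝ (fun t => f t x ^ (1 + β)) θ (EuclideanSpace.single j 1)
      = (1 + β) * (score f θ x j * f θ x ^ (1 + β)) := by
  have hf2 : ContDiffAt ℝ 2 (fun t => f t x) θ :=
    (hf.contDiffAt (hω.mem_nhds hθ)).of_le (by norm_num)
  rcases hmodel.forall_pos_or_forall_eq_zero x with h | h
  · rw [fderiv_rpow_eq hf2 (h θ (hωΘ hθ)), _root_.smul_apply, smul_eq_mul]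
    change _ * score f θ x j = _
    ring
  · have h0 : (fun t => f t x ^ (1 + β)) =ᶠ[𝓝 θ] fun _ => 0 := by
      filter_upwards [hω.mem_nhds hθ] with t ht
      rw [h t (hωΘ ht), Real.zero_rpow (by positivity)]
    rw [h0.fderiv_eq, h θ (hωΘ hθ), Real.zero_rpow (by positivity)]
    simp

theorem IsModel.fderiv_fderiv_rpow_single (hmodel : IsModel μ Θ f) (hβ : 0 ≤ β) (hω : IsOpen ω)
    (hωΘ : ω ⊆ Θ) (hf : ContDiffOn ℝ 3 (fun t => f t x) ω) (hθ : θ ∈ ω) (j k : Fin p) :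
    fderiv ℝ (fderiv ℝ fun t => f t x ^ (1 + β)) θ (EuclideanSpace.single j 1)
      (EuclideanSpace.single k 1) = (1 + β) * (f θ x ^ (1 + β) *
        (-info f θ x j k + (1 + β) * (score f θ x j * score f θ x k))) := by
  have hf2 : ContDiffAt ℝ 2 (fun t => f t x) θ :=
    (hf.contDiffAt (hω.mem_nhds hθ)).of_le (by norm_num)
  rcases hmodel.forall_pos_or_forall_eq_zero x with h | h
  · rw [fderiv_fderiv_rpow_eq hf2 (h θ (hωΘ hθ)), fderiv_fderiv_log_single]
    change _ * (_ + _ * (score f θ x j * score f θ x k)) = _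
    ring
  · have h0 : (fun t => f t x ^ (1 + β)) =ᶠ[𝓝 θ] fun _ => 0 := by
      filter_upwards [hω.mem_nhds hθ] with t ht
      rw [h t (hωΘ ht), Real.zero_rpow (by positivity)]
    rw [h0.fderiv.fderiv_eq, h θ (hωΘ hθ), Real.zero_rpow (by positivity)]
    simp

end Coordinates

/-! ### The density power divergence loss as a smooth loss -/

/-- The smoothness conditions of `IsRegularAt`, on a given open set. -/
structure IsRegularOn {p : ℕ} {𝒳 : Type*} [MeasurableSpace 𝒳] (μ : Measure 𝒳) (Θ : Set (Param p))
    (f : Param p → 𝒳 → ℝ) (β : ℝ) (g : 𝒳 → ℝ) (ω : Set (Param p)) : Prop where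
  isOpen : IsOpen ω
  subset : ω ⊆ Θ
  smooth : ∀ᵐ x ∂μ, ContDiffOn ℝ 3 (fun t => f t x) ω
  diff_rpow : DiffUnderIntegral μ (fun t x => f t x ^ (1 + β)) ω
  diff_boxCox : DiffUnderIntegral (law μ g) (fun t x => boxCox β (f t x)) ω

namespace IsRegularOn

variable {p : ℕ} {𝒳 : Type*} [MeasurableSpace 𝒳] {μ : Measure 𝒳} {Θ ω : Set (Param p)}
  {f : Param p → 𝒳 → ℝ} {β : ℝ} {θs θ : Param p}

theorem fderiv_integral_rpow_single (hω : IsRegularOn μ Θ f β (f θs) ω) (hmodel : IsModel μ Θ f)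
    (hβ : 0 ≤ β) (hθ : θ ∈ ω) (j : Fin p) :
    fderiv ℝ (fun t => ∫ x, f t x ^ (1 + β) ∂μ) θ (EuclideanSpace.single j 1)
      = (1 + β) * ∫ x, score f θ x j * f θ x ^ (1 + β) ∂μ := by
  rw [hω.diff_rpow.fderiv_integral hθ,
    ContinuousLinearMap.integral_apply (hω.diff_rpow.integrable_fderiv hθ), ← integral_const_mul]
  refine integral_congr_ae ?_
  filter_upwards [hω.smooth] with x hx
  exact hmodel.fderiv_rpow_single hβ hω.isOpen hω.subset hx hθ j

theorem integrable_fderiv_fderiv_rpow_single (hω : IsRegularOn μ Θ f β (f θs) ω)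
    (hmodel : IsModel μ Θ f) (hβ : 0 ≤ β) (hθ : θ ∈ ω) (j k : Fin p) :
    Integrable (fun x => f θ x ^ (1 + β) *
        (-info f θ x j k + (1 + β) * (score f θ x j * score f θ x k))) μ := by
  have h1 := ((hω.diff_rpow.integrable_fderiv_fderiv hθ).apply_continuousLinearMap
    (EuclideanSpace.single j (1 : ℝ))).apply_continuousLinearMap (EuclideanSpace.single k (1 : ℝ))
  refine (h1.const_mul (1 + β)⁻¹).congr ?_
  filter_upwards [hω.smooth] with x hx
  rw [hmodel.fderiv_fderiv_rpow_single hβ hω.isOpen hω.subset hx hθ j k]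
  field_simp

theorem fderiv_fderiv_integral_rpow_single (hω : IsRegularOn μ Θ f β (f θs) ω)
    (hmodel : IsModel μ Θ f) (hβ : 0 ≤ β) (hθ : θ ∈ ω) (j k : Fin p) :
    fderiv ℝ (fderiv ℝ fun t => ∫ x, f t x ^ (1 + β) ∂μ) θ (EuclideanSpace.single j 1)
      (EuclideanSpace.single k 1) = (1 + β) * ∫ x, f θ x ^ (1 + β) *
        (-info f θ x j k + (1 + β) * (score f θ x j * score f θ x k)) ∂μ := by
  have h1 := hω.diff_rpow.integrable_fderiv_fderiv hθ
  rw [hω.diff_rpow.fderiv_fderiv_integral hθ, ContinuousLinearMap.integral_apply h1,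
    ContinuousLinearMap.integral_apply (h1.apply_continuousLinearMap _), ← integral_const_mul]
  refine integral_congr_ae ?_
  filter_upwards [hω.smooth] with x hx
  exact hmodel.fderiv_fderiv_rpow_single hβ hω.isOpen hω.subset hx hθ j k

/-- Almost all observations have a smooth and positive likelihood. -/
theorem ae_contDiffAt_and_pos (hω : IsRegularOn μ Θ f β (f θs) ω) (hmodel : IsModel μ Θ f)
    (hθs : θs ∈ Θ) :
    ∀ᵐ x ∂(law μ (f θs)), ∀ t ∈ ω, ContDiffAt ℝ 3 (fun t => f t x) t ∧ 0 < f t x := by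
  filter_upwards [ae_law_of_ae hω.smooth, hmodel.ae_law_pos hθs] with x hx hpos t ht
  exact ⟨hx.contDiffAt (hω.isOpen.mem_nhds ht), hpos t (hω.subset ht)⟩

section Observation

variable {x : 𝒳}

theorem contDiffAt_dpdLoss (hω : IsRegularOn μ Θ f β (f θs) ω)
    (hx : ∀ t ∈ ω, ContDiffAt ℝ 3 (fun t => f t x) t ∧ 0 < f t x)
    (hθ : θ ∈ ω) : ContDiffAt ℝ 2 (fun t => dpdLoss μ f β t x) θ :=
  (contDiffAt_const.mul (hω.diff_rpow.contDiffAt hω.isOpen hθ)).sub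
    (contDiffAt_boxCox ((hx θ hθ).1.of_le (by norm_num)) (hx θ hθ).2 β)

theorem lossGrad_dpdLoss (hω : IsRegularOn μ Θ f β (f θs) ω)
    (hx : ∀ t ∈ ω, ContDiffAt ℝ 3 (fun t => f t x) t ∧ 0 < f t x)
    (hθ : θ ∈ ω) :
    lossGrad (dpdLoss μ f β) θ x = (1 / (1 + β)) • fderiv ℝ (fun t => ∫ y, f t y ^ (1 + β) ∂μ) θ
      - fderiv ℝ (fun t => boxCox β (f t x)) θ := by
  have hI := (hω.diff_rpow.contDiffAt hω.isOpen hθ).differentiableAt two_ne_zero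
  have hB := (contDiffAt_boxCox (hx θ hθ).1 (hx θ hθ).2 β).differentiableAt (by norm_num)
  exact ((hI.hasFDerivAt.const_mul (1 / (1 + β))).sub hB.hasFDerivAt).fderiv

theorem lossHess_dpdLoss (hω : IsRegularOn μ Θ f β (f θs) ω)
    (hx : ∀ t ∈ ω, ContDiffAt ℝ 3 (fun t => f t x) t ∧ 0 < f t x)
    (hθ : θ ∈ ω) :
    lossHess (dpdLoss μ f β) θ x
      = (1 / (1 + β)) • fderiv ℝ (fderiv ℝ fun t => ∫ y, f t y ^ (1 + β) ∂μ) θ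
        - fderiv ℝ (fderiv ℝ fun t => boxCox β (f t x)) θ := by
  have h1 : fderiv ℝ (fun t => dpdLoss μ f β t x) =ᶠ[𝓝 θ]
      fun t => (1 / (1 + β)) • fderiv ℝ (fun t => ∫ y, f t y ^ (1 + β) ∂μ) t
        - fderiv ℝ (fun t => boxCox β (f t x)) t := by
    filter_upwards [hω.isOpen.mem_nhds hθ] with t ht using hω.lossGrad_dpdLoss hx ht
  have hI := ((hω.diff_rpow.contDiffAt hω.isOpen hθ).fderiv_right (m := 1)
    (by norm_num)).differentiableAt one_ne_zero
  have hB := ((contDiffAt_boxCox (hx θ hθ).1 (hx θ hθ).2 β).fderiv_right (m := 1)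
    (by norm_num)).differentiableAt one_ne_zero
  rw [lossHess, h1.fderiv_eq]
  exact ((hI.hasFDerivAt.const_smul (1 / (1 + β))).sub hB.hasFDerivAt).fderiv

theorem differentiableAt_iteratedFDeriv_dpdLoss (hω : IsRegularOn μ Θ f β (f θs) ω)
    (hx : ∀ t ∈ ω, ContDiffAt ℝ 3 (fun t => f t x) t ∧ 0 < f t x)
    (hθ : θ ∈ ω) :
    DifferentiableAt ℝ (iteratedFDeriv ℝ 2 (fun t => dpdLoss μ f β t x)) θ := by
  have h1 : iteratedFDeriv ℝ 2 (fun t => dpdLoss μ f β t x) =ᶠ[𝓝 θ]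
      fun t => (1 / (1 + β)) • iteratedFDeriv ℝ 2 (fun t => ∫ y, f t y ^ (1 + β) ∂μ) t
        - iteratedFDeriv ℝ 2 (fun t => boxCox β (f t x)) t := by
    filter_upwards [hω.isOpen.mem_nhds ‹_›] with t ht
    have hI := hω.diff_rpow.contDiffAt hω.isOpen ht
    have hB := (contDiffAt_boxCox (hx t ht).1 (hx t ht).2 β).of_le (m := 2) (by norm_num)
    rw [← iteratedFDeriv_const_smul_apply' (i := 2) hI,
      ← fun_iteratedFDeriv_sub_apply (i := 2) (hI.const_smul (1 / (1 + β))) hB]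
    rfl
  refine DifferentiableAt.congr_of_eventuallyEq ?_ h1
  refine ((hω.diff_rpow.differentiableAt hω.isOpen hθ).fun_const_smul _).fun_sub ?_
  exact (contDiffAt_boxCox (hx θ hθ).1 (hx θ hθ).2 β).differentiableAt_iteratedFDeriv (by norm_num)

theorem lossGrad_dpdLoss_single (hω : IsRegularOn μ Θ f β (f θs) ω)
    (hx : ∀ t ∈ ω, ContDiffAt ℝ 3 (fun t => f t x) t ∧ 0 < f t x)
    (hmodel : IsModel μ Θ f) (hβ : 0 ≤ β) (hθ : θ ∈ ω) (j : Fin p) :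
    lossGrad (dpdLoss μ f β) θ x (EuclideanSpace.single j 1)
      = (∫ y, score f θ y j * f θ y ^ (1 + β) ∂μ) - wscore f β θ x j := by
  rw [hω.lossGrad_dpdLoss hx hθ, _root_.sub_apply, _root_.smul_apply,
    hω.fderiv_integral_rpow_single hmodel hβ hθ,
    fderiv_boxCox_single ((hx θ hθ).1.of_le (by norm_num)) (hx θ hθ).2, smul_eq_mul]
  field_simp

theorem lossHess_dpdLoss_single (hω : IsRegularOn μ Θ f β (f θs) ω)
    (hx : ∀ t ∈ ω, ContDiffAt ℝ 3 (fun t => f t x) t ∧ 0 < f t x)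
    (hmodel : IsModel μ Θ f) (hβ : 0 ≤ β) (hθ : θ ∈ ω) (j k : Fin p) :
    lossHess (dpdLoss μ f β) θ x (EuclideanSpace.single j 1) (EuclideanSpace.single k 1)
      = (∫ y, f θ y ^ (1 + β) * (-info f θ y j k + (1 + β) * (score f θ y j * score f θ y k)) ∂μ)
        - f θ x ^ β * (-info f θ x j k + β * (score f θ x j * score f θ x k)) := by
  rw [hω.lossHess_dpdLoss hx hθ, _root_.sub_apply, _root_.sub_apply, _root_.smul_apply,
    _root_.smul_apply, hω.fderiv_fderiv_integral_rpow_single hmodel hβ hθ,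
    fderiv_fderiv_boxCox_single ((hx θ hθ).1.of_le (by norm_num)) (hx θ hθ).2, smul_eq_mul]
  field_simp

end Observation

theorem integrable_lossGrad (hω : IsRegularOn μ Θ f β (f θs) ω) (hmodel : IsModel μ Θ f)
    (hθs : θs ∈ Θ) (hθ : θ ∈ ω) : Integrable (lossGrad (dpdLoss μ f β) θ) (law μ (f θs)) := by
  have := hmodel.isProbabilityMeasure_law hθs
  refine ((integrable_const ((1 / (1 + β)) • fderiv ℝ (fun t => ∫ y, f t y ^ (1 + β) ∂μ) θ)).sub
    (hω.diff_boxCox.integrable_fderiv hθ)).congr ?_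
  filter_upwards [hω.ae_contDiffAt_and_pos hmodel hθs] with x hx
  exact (hω.lossGrad_dpdLoss hx hθ).symm

theorem integrable_lossHess (hω : IsRegularOn μ Θ f β (f θs) ω) (hmodel : IsModel μ Θ f)
    (hθs : θs ∈ Θ) (hθ : θ ∈ ω) : Integrable (lossHess (dpdLoss μ f β) θ) (law μ (f θs)) := by
  have := hmodel.isProbabilityMeasure_law hθs
  refine ((integrable_const ((1 / (1 + β)) •
    fderiv ℝ (fderiv ℝ fun t => ∫ y, f t y ^ (1 + β) ∂μ) θ)).sub
    (hω.diff_boxCox.integrable_fderiv_fderiv hθ)).congr ?_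
  filter_upwards [hω.ae_contDiffAt_and_pos hmodel hθs] with x hx
  exact (hω.lossHess_dpdLoss hx hθ).symm

theorem integrable_wscore (hω : IsRegularOn μ Θ f β (f θs) ω) (hmodel : IsModel μ Θ f)
    (hθs : θs ∈ Θ) (hθ : θ ∈ ω) (j : Fin p) :
    Integrable (fun x => wscore f β θ x j) (law μ (f θs)) := by
  refine ((hω.diff_boxCox.integrable_fderiv hθ).apply_continuousLinearMap
    (EuclideanSpace.single j (1 : ℝ))).congr ?_
  filter_upwards [hω.ae_contDiffAt_and_pos hmodel hθs] with x hx
  exact fderiv_boxCox_single ((hx θ hθ).1.of_le (by norm_num)) (hx θ hθ).2 j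

theorem integral_lossGrad_single (hω : IsRegularOn μ Θ f β (f θs) ω) (hmodel : IsModel μ Θ f)
    (hβ : 0 ≤ β) (hθs : θs ∈ Θ) (hθ : θ ∈ ω) (j : Fin p) :
    (∫ x, lossGrad (dpdLoss μ f β) θ x ∂(law μ (f θs))) (EuclideanSpace.single j 1)
      = -popEstFun μ f β (f θs) θ j := by
  have := hmodel.isProbabilityMeasure_law hθs
  have h1 : ∫ x, lossGrad (dpdLoss μ f β) θ x (EuclideanSpace.single j 1) ∂(law μ (f θs))
      = ∫ x, ((∫ y, score f θ y j * f θ y ^ (1 + β) ∂μ) - wscore f β θ x j) ∂(law μ (f θs)) := by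
    refine integral_congr_ae ?_
    filter_upwards [hω.ae_contDiffAt_and_pos hmodel hθs] with x hx
    exact hω.lossGrad_dpdLoss_single hx hmodel hβ hθ j
  rw [ContinuousLinearMap.integral_apply (hω.integrable_lossGrad hmodel hθs hθ), h1,
    integral_sub (integrable_const _) (hω.integrable_wscore hmodel hθs hθ j)]
  simp [popEstFun]

theorem integral_lossHess_single (hω : IsRegularOn μ Θ f β (f θs) ω) (hmodel : IsModel μ Θ f)
    (hβ : 0 ≤ β) (hθs : θs ∈ Θ) (hθ : θ ∈ ω) (j k : Fin p) :
    (∫ x, lossHess (dpdLoss μ f β) θ x ∂(law μ (f θs))) (EuclideanSpace.single j 1)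
      (EuclideanSpace.single k 1) = matJ μ f β (f θs) θ j k := by
  have := hmodel.isProbabilityMeasure_law hθs
  have hmeas := hmodel.measurable θs hθs
  have hnn := hmodel.nonneg θs hθs
  set c := ∫ y, f θ y ^ (1 + β) * (-info f θ y j k + (1 + β) * (score f θ y j * score f θ y k)) ∂μ
    with hc
  have hA : Integrable (fun x => f θ x ^ β * (-info f θ x j k + β * (score f θ x j * score f θ x k)))
      (law μ (f θs)) := by
    refine (((hω.diff_boxCox.integrable_fderiv_fderiv hθ).apply_continuousLinearMap
      (EuclideanSpace.single j (1 : ℝ))).apply_continuousLinearMap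
      (EuclideanSpace.single k (1 : ℝ))).congr ?_
    filter_upwards [hω.ae_contDiffAt_and_pos hmodel hθs] with x hx
    exact fderiv_fderiv_boxCox_single ((hx θ hθ).1.of_le (by norm_num)) (hx θ hθ).2 j k
  have h1 : ∫ x, lossHess (dpdLoss μ f β) θ x (EuclideanSpace.single j 1)
        (EuclideanSpace.single k 1) ∂(law μ (f θs))
      = ∫ x, (c - f θ x ^ β * (-info f θ x j k + β * (score f θ x j * score f θ x k)))
        ∂(law μ (f θs)) := by
    refine integral_congr_ae ?_
    filter_upwards [hω.ae_contDiffAt_and_pos hmodel hθs] with x hx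
    exact hω.lossHess_dpdLoss_single hx hmodel hβ hθ j k
  have hL := hω.integrable_lossHess hmodel hθs hθ
  rw [ContinuousLinearMap.integral_apply hL,
    ContinuousLinearMap.integral_apply (hL.apply_continuousLinearMap _), h1,
    integral_sub (integrable_const _) hA, integral_const, probReal_univ, one_smul,
    integral_law hmeas hnn (fun x => f θ x ^ β * _), hc,
    ← integral_sub (hω.integrable_fderiv_fderiv_rpow_single hmodel hβ hθ j k)
    ((integrable_law_iff hmeas hnn).1 hA), matJ, Matrix.of_apply]
  -- Expanding the product with `g - f_θ` in `matJ` gives `f_θ ^ (1 + β) (-i + (1 + β) u uᵀ) - g f_θ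
  -- ^ β (-i + β u uᵀ)`.
  refine integral_congr_ae (Eventually.of_forall fun x => ?_)
  have hx : f θ x ^ (1 + β) = f θ x * f θ x ^ β :=
    Real.rpow_one_add' (hmodel.nonneg θ (hω.subset hθ) x) (by positivity)
  simp only [hx]
  ring

theorem isSmoothLoss {θ₀ : Param p} {ρ : ℝ} (hω : IsRegularOn μ Θ f β (f θs) ω)
    (hmodel : IsModel μ Θ f) (hθs : θs ∈ Θ) (hρ : 0 < ρ) (hball : Metric.ball θ₀ ρ ⊆ ω)
    {M : 𝒳 → ℝ} (hM : Integrable M (law μ (f θs)))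
    (hle : ∀ᵐ x ∂(law μ (f θs)), ∀ t ∈ ω,
      ‖iteratedFDeriv ℝ 3 (fun s => dpdLoss μ f β s x) t‖ ≤ M x) :
    IsSmoothLoss (law μ (f θs)) (dpdLoss μ f β) θ₀ ρ M where
  radius_pos := hρ
  measurable θ hθ := by
    have h := hmodel.measurable θ (hω.subset (hball hθ))
    refine measurable_const.sub ?_
    unfold boxCox
    split_ifs
    · exact Real.measurable_log.comp h
    · exact (h.pow_const β).div_const β
  integrable_bound := hM
  integrable_grad := hω.integrable_lossGrad hmodel hθs (hball (Metric.mem_ball_self hρ))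
  integrable_hess := hω.integrable_lossHess hmodel hθs (hball (Metric.mem_ball_self hρ))
  taylor := by
    filter_upwards [hω.ae_contDiffAt_and_pos hmodel hθs, hle] with x hx hMx
    exact hasTaylorBound_of_norm_iteratedFDeriv_le
      (fun t ht => hω.contDiffAt_dpdLoss hx (hball ht))
      (fun t ht => hω.differentiableAt_iteratedFDeriv_dpdLoss hx (hball ht))
      fun t ht => hMx t (hball ht)

/-- Strict differentiability is what the Lagrange multiplier theorem requires of the risk at the
best fitting parameter. -/
theorem hasStrictFDerivAt_dpdRisk (hω : IsRegularOn μ Θ f β (f θs) ω) (hmodel : IsModel μ Θ f)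
    (hθs : θs ∈ Θ) (hθ : θ ∈ ω) :
    HasStrictFDerivAt (dpdRisk μ f β (f θs))
      (∫ x, lossGrad (dpdLoss μ f β) θ x ∂(law μ (f θs))) θ := by
  have := hmodel.isProbabilityMeasure_law hθs
  have h1 : dpdRisk μ f β (f θs) =ᶠ[𝓝 θ] fun t => (1 / (1 + β)) * (∫ y, f t y ^ (1 + β) ∂μ)
      - ∫ x, boxCox β (f t x) ∂(law μ (f θs)) := by
    filter_upwards [hω.isOpen.mem_nhds hθ] with t ht
    unfold dpdRisk dpdLoss
    rw [integral_sub (integrable_const _) (hω.diff_boxCox.integrable ht)]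
    simp
  have hI := (hω.diff_rpow.contDiffAt hω.isOpen hθ).hasStrictFDerivAt two_ne_zero
  have hB := (hω.diff_boxCox.contDiffAt hω.isOpen hθ).hasStrictFDerivAt two_ne_zero
  have h2 := (hI.const_mul (1 / (1 + β))).sub hB
  have h3 : ∫ x, lossGrad (dpdLoss μ f β) θ x ∂(law μ (f θs))
      = (1 / (1 + β)) • fderiv ℝ (fun t => ∫ y, f t y ^ (1 + β) ∂μ) θ
        - fderiv ℝ (fun t => ∫ x, boxCox β (f t x) ∂(law μ (f θs))) θ := by
    have h4 : ∫ x, lossGrad (dpdLoss μ f β) θ x ∂(law μ (f θs))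
        = ∫ x, ((1 / (1 + β)) • fderiv ℝ (fun t => ∫ y, f t y ^ (1 + β) ∂μ) θ
          - fderiv ℝ (fun t => boxCox β (f t x)) θ) ∂(law μ (f θs)) := by
      refine integral_congr_ae ?_
      filter_upwards [hω.ae_contDiffAt_and_pos hmodel hθs] with x hx
      exact hω.lossGrad_dpdLoss hx hθ
    rw [h4, integral_sub (integrable_const _) (hω.diff_boxCox.integrable_fderiv hθ),
      hω.diff_boxCox.fderiv_integral hθ]
    simp
  rw [h3]
  exact h2.congr_of_eventuallyEq h1.symm

theorem sampleMean_lossGrad_single (hω : IsRegularOn μ Θ f β (f θs) ω) (hmodel : IsModel μ Θ f)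
    (hβ : 0 ≤ β) (hθ : θ ∈ ω) {n : ℕ} (hn : n ≠ 0) {x : Fin n → 𝒳}
    (hx : ∀ i, ∀ t ∈ ω, ContDiffAt ℝ 3 (fun t => f t (x i)) t ∧ 0 < f t (x i)) (j : Fin p) :
    sampleMean (lossGrad (dpdLoss μ f β) θ) x (EuclideanSpace.single j 1)
      = -estFun μ f β x θ j := by
  rw [sampleMean_clm_apply, sampleMean,
    Finset.sum_congr rfl fun i _ => hω.lossGrad_dpdLoss_single (hx i) hmodel hβ hθ j]
  have : (n : ℝ) ≠ 0 := by exact_mod_cast hn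
  simp only [estFun, Finset.sum_sub_distrib, Finset.sum_const, Finset.card_univ, Fintype.card_fin,
    smul_eq_mul, nsmul_eq_mul]
  field_simp
  ring

end IsRegularOn

section

variable {p : ℕ} {𝒳 : Type*} [MeasurableSpace 𝒳] {μ : Measure 𝒳} {Θ : Set (Param p)}
  {f : Param p → 𝒳 → ℝ} {β : ℝ} {θs θ₀ : Param p}

/-- The estimating equations are unbiased under the model. -/
theorem IsModel.popEstFun_self (hmodel : IsModel μ Θ f) (hβ : 0 ≤ β) (hθs : θs ∈ Θ) :
    popEstFun μ f β (f θs) θs = 0 := by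
  funext j
  rw [popEstFun, integral_law (hmodel.measurable θs hθs) (hmodel.nonneg θs hθs), Pi.zero_apply,
    sub_eq_zero]
  refine integral_congr_ae (Eventually.of_forall fun x => ?_)
  have hx : f θs x ^ (1 + β) = f θs x * f θs x ^ β :=
    Real.rpow_one_add' (hmodel.nonneg θs hθs x) (by positivity)
  simp only [hx, wscore]
  ring

theorem IsRegularAt.exists_isSmoothLoss (hreg : IsRegularAt μ Θ f β (f θs) θ₀)
    (hmodel : IsModel μ Θ f) (hθs : θs ∈ Θ) :
    ∃ ω ρ M, IsRegularOn μ Θ f β (f θs) ω ∧ Metric.ball θ₀ ρ ⊆ ω ∧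
      IsSmoothLoss (law μ (f θs)) (dpdLoss μ f β) θ₀ ρ M := by
  obtain ⟨ω, hω, hsub, hθ₀, hsm, hI, hB, M, hM, hle⟩ := hreg.exists_nhd
  have hreg' : IsRegularOn μ Θ f β (f θs) ω := ⟨hω, hsub, hsm, hI, hB⟩
  obtain ⟨ρ, hρ, hball⟩ := Metric.isOpen_iff.1 hω θ₀ hθ₀
  exact ⟨ω, ρ, M, hreg', hball, hreg'.isSmoothLoss hmodel hθs hρ hball hM hle⟩

end

/-! ### Linear maps in coordinates -/

section Coordinates

variable {p r : ℕ}

theorem sum_smul_single (v : Param p) : ∑ j, v j • EuclideanSpace.single j (1 : ℝ) = v := by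
  ext i
  simp [Finset.sum_apply, Pi.single_apply]

theorem clm_apply_eq_sum {G : Type*} [NormedAddCommGroup G] [NormedSpace ℝ G]
    (φ : Param p →L[ℝ] G) (v : Param p) : φ v = ∑ j, v j • φ (EuclideanSpace.single j 1) := by
  conv_lhs => rw [← sum_smul_single v]
  simp only [map_sum, map_smul]

theorem clm_ext_single {G : Type*} [NormedAddCommGroup G] [NormedSpace ℝ G]
    {φ ψ : Param p →L[ℝ] G}
    (h : ∀ j, φ (EuclideanSpace.single j 1) = ψ (EuclideanSpace.single j 1)) : φ = ψ := by
  ext1 v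
  rw [clm_apply_eq_sum, clm_apply_eq_sum ψ]
  simp only [h]

theorem norm_clm_le_sum {G : Type*} [NormedAddCommGroup G] [NormedSpace ℝ G] (φ : Param p →L[ℝ] G) :
    ‖φ‖ ≤ ∑ j, ‖φ (EuclideanSpace.single j 1)‖ := by
  refine φ.opNorm_le_bound (Finset.sum_nonneg fun _ _ => norm_nonneg _) fun v => ?_
  rw [clm_apply_eq_sum, Finset.sum_mul]
  refine (norm_sum_le _ _).trans (Finset.sum_le_sum fun j _ => ?_)
  rw [norm_smul, mul_comm]
  gcongr
  exact PiLp.norm_apply_le v j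

theorem clm_pi_apply (l : (Fin r → ℝ) →L[ℝ] ℝ) (y : Fin r → ℝ) :
    l y = ∑ k, y k * l (Pi.single k 1) := by
  conv_lhs => rw [← Finset.univ_sum_single y]
  rw [map_sum]
  refine Finset.sum_congr rfl fun k _ => ?_
  rw [← smul_eq_mul, ← map_smul, ← Pi.single_smul, smul_eq_mul, mul_one]

/-- The linear map from covectors to vectors with matrix `A`. -/
noncomputable def covectorMap (A : Matrix (Fin p) (Fin p) ℝ) :
    (Param p →L[ℝ] ℝ) →L[ℝ] Param p :=
  ∑ j, (ContinuousLinearMap.apply ℝ ℝ (EuclideanSpace.single j (1 : ℝ))).smulRight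
    (WithLp.toLp 2 fun i => A i j)

theorem covectorMap_apply (A : Matrix (Fin p) (Fin p) ℝ) (φ : Param p →L[ℝ] ℝ) :
    covectorMap A φ = WithLp.toLp 2 (A *ᵥ fun j => φ (EuclideanSpace.single j 1)) := by
  ext i
  simp [covectorMap, mulVec, dotProduct, mul_comm]

/-- The linear map with matrix `B`, from `Fin r → ℝ` to the Euclidean space. -/
noncomputable def piMap (B : Matrix (Fin p) (Fin r) ℝ) : (Fin r → ℝ) →L[ℝ] Param p :=
  ∑ k, (ContinuousLinearMap.proj (R := ℝ) (φ := fun _ : Fin r => ℝ) k).smulRight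
    (WithLp.toLp 2 fun i => B i k)

theorem piMap_apply (B : Matrix (Fin p) (Fin r) ℝ) (y : Fin r → ℝ) :
    piMap B y = WithLp.toLp 2 (B *ᵥ y) := by
  ext i
  simp [piMap, mulVec, dotProduct, mul_comm]

variable {h : Param p → Fin r → ℝ} {θ : Param p}

theorem fderiv_single_apply (hh : DifferentiableAt ℝ h θ) (j : Fin p) (k : Fin r) :
    fderiv ℝ h θ (EuclideanSpace.single j 1) k = restrMatrix h θ j k := by
  have h1 : HasFDerivAt (fun t => h t k)
      ((ContinuousLinearMap.proj (R := ℝ) (φ := fun _ : Fin r => ℝ) k).comp (fderiv ℝ h θ)) θ :=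
    (ContinuousLinearMap.proj (R := ℝ) (φ := fun _ : Fin r => ℝ) k).hasFDerivAt.comp θ
      hh.hasFDerivAt
  rw [restrMatrix, Matrix.of_apply, grad, h1.fderiv]
  rfl

theorem fderiv_eq_mulVec (hh : DifferentiableAt ℝ h θ) (v : Param p) :
    fderiv ℝ h θ v = (restrMatrix h θ)ᵀ *ᵥ v.ofLp := by
  funext k
  rw [clm_apply_eq_sum, Finset.sum_apply]
  simp only [Pi.smul_apply, fderiv_single_apply hh, smul_eq_mul, mulVec, dotProduct, transpose_apply,
    mul_comm]

theorem comp_fderiv_single (hh : DifferentiableAt ℝ h θ) (l : (Fin r → ℝ) →L[ℝ] ℝ) (j : Fin p) :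
    (l ∘L fderiv ℝ h θ) (EuclideanSpace.single j 1)
      = (restrMatrix h θ *ᵥ fun k => l (Pi.single k 1)) j := by
  rw [ContinuousLinearMap.comp_apply, clm_pi_apply]
  simp only [fderiv_single_apply hh, mulVec, dotProduct]

theorem fderiv_fderiv_single_apply (hh : ContDiffAt ℝ 2 h θ) (i j : Fin p) (k : Fin r) :
    fderiv ℝ (fderiv ℝ h) θ (EuclideanSpace.single i 1) (EuclideanSpace.single j 1) k
      = hess (fun t => h t k) θ i j := by
  let L : (Param p →L[ℝ] Fin r → ℝ) →L[ℝ] Param p →L[ℝ] ℝ :=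
    ContinuousLinearMap.compL ℝ (Param p) (Fin r → ℝ) ℝ
      (ContinuousLinearMap.proj (R := ℝ) (φ := fun _ : Fin r => ℝ) k)
  have h1 : fderiv ℝ (fun t => h t k) =ᶠ[𝓝 θ] fun t => L (fderiv ℝ h t) := by
    filter_upwards [hh.eventually (by simp)] with t ht
    exact ((ContinuousLinearMap.proj (R := ℝ) (φ := fun _ : Fin r => ℝ) k).hasFDerivAt.comp t
      (ht.differentiableAt two_ne_zero).hasFDerivAt).fderiv
  have h2 : HasFDerivAt (fun t => L (fderiv ℝ h t)) (L ∘L fderiv ℝ (fderiv ℝ h) θ) θ :=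
    L.hasFDerivAt.comp θ
      ((hh.fderiv_right (m := 1) (by norm_num)).differentiableAt one_ne_zero).hasFDerivAt
  rw [hess_apply, h1.fderiv_eq, h2.fderiv]
  rfl

theorem range_fderiv_eq_top (hh : DifferentiableAt ℝ h θ) (hH : (restrMatrix h θ).rank = r) :
    (fderiv ℝ h θ).range = ⊤ := by
  refine LinearMap.range_eq_top.2 fun y => ?_
  have h1 : ((restrMatrix h θ)ᵀ).mulVecLin.range = ⊤ := by
    refine Submodule.eq_top_of_finrank_eq ?_
    have h2 := Matrix.rank_transpose (restrMatrix h θ)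
    rw [hH] at h2
    rw [Module.finrank_fin_fun]
    exact h2
  obtain ⟨v, hv⟩ := LinearMap.range_eq_top.1 h1 y
  refine ⟨WithLp.toLp 2 v, ?_⟩
  rw [← hv]
  exact fderiv_eq_mulVec hh _

theorem mulVec_injective_of_rank_eq {H : Matrix (Fin p) (Fin r) ℝ} (hH : H.rank = r)
    {v : Fin r → ℝ} (hv : H *ᵥ v = 0) : v = 0 := by
  have h1 := H.mulVecLin.finrank_range_add_finrank_ker
  have h2 : Module.finrank ℝ H.mulVecLin.range = r := hH
  rw [h2, Module.finrank_fin_fun] at h1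
  have h3 : H.mulVecLin.ker = ⊥ := Submodule.finrank_eq_zero.1 (by omega)
  exact LinearMap.ker_eq_bot'.1 h3 v hv

/-- `vᵀ Hᵀ H v` is the squared length of `H v`. -/
theorem isUnit_det_transpose_mul_self {H : Matrix (Fin p) (Fin r) ℝ} (hH : H.rank = r) :
    IsUnit (Hᵀ * H).det := by
  rw [isUnit_iff_ne_zero]
  intro h0
  obtain ⟨v, hv0, hv⟩ := Matrix.exists_mulVec_eq_zero_iff.2 h0
  refine hv0 (mulVec_injective_of_rank_eq hH ?_)
  have h1 : (H *ᵥ v) ⬝ᵥ (H *ᵥ v) = 0 := by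
    rw [← Matrix.mulVec_mulVec] at hv
    rw [← Matrix.dotProduct_transpose_mulVec, hv, dotProduct_zero]
  exact dotProduct_self_eq_zero.1 h1

/-- For a kernel vector `(v, w)`, pairing `J v + H w = 0` with `v` and using `Hᵀ v = 0` leaves `vᵀ J
v = 0`, so `v = 0`; then `H w = 0` and full rank gives `w = 0`. `J` itself need not be invertible.
-/
theorem isUnit_det_fromBlocks {J : Matrix (Fin p) (Fin p) ℝ} {H : Matrix (Fin p) (Fin r) ℝ}
    (hH : H.rank = r) (hJ : ∀ v : Fin p → ℝ, v ≠ 0 → Hᵀ *ᵥ v = 0 → 0 < v ⬝ᵥ J *ᵥ v) :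
    IsUnit (Matrix.fromBlocks J H Hᵀ 0).det := by
  rw [isUnit_iff_ne_zero]
  intro h0
  obtain ⟨z, hz0, hz⟩ := Matrix.exists_mulVec_eq_zero_iff.2 h0
  rw [← Sum.elim_comp_inl_inr z, Matrix.fromBlocks_mulVec] at hz
  have h1 : J *ᵥ (z ∘ Sum.inl) + H *ᵥ (z ∘ Sum.inr) = 0 := funext fun i => congrFun hz (Sum.inl i)
  have h2 : Hᵀ *ᵥ (z ∘ Sum.inl) = 0 := by
    funext i
    simpa using congrFun hz (Sum.inr i)
  have h3 : z ∘ Sum.inl = 0 := by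
    by_contra hne
    have hpos := hJ _ hne h2
    have h4 : (z ∘ Sum.inl) ⬝ᵥ (J *ᵥ (z ∘ Sum.inl) + H *ᵥ (z ∘ Sum.inr)) = 0 := by
      rw [h1, dotProduct_zero]
    rw [dotProduct_add, dotProduct_mulVec _ H, ← mulVec_transpose, h2, zero_dotProduct,
      add_zero] at h4
    exact hpos.ne' h4
  have h5 : z ∘ Sum.inr = 0 := by
    refine mulVec_injective_of_rank_eq hH ?_
    rwa [h3, mulVec_zero, zero_add] at h1
  refine hz0 ?_
  rw [← Sum.elim_comp_inl_inr z, h3, h5]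
  funext i
  cases i <;> rfl

/-- The two identities that characterize the upper blocks of the inverse of the bordered matrix. -/
theorem exists_blockP_mul_add {J : Matrix (Fin p) (Fin p) ℝ} {H : Matrix (Fin p) (Fin r) ℝ}
    (hH : H.rank = r) (hJ : ∀ v : Fin p → ℝ, v ≠ 0 → Hᵀ *ᵥ v = 0 → 0 < v ⬝ᵥ J *ᵥ v) :
    blockP J H * H = 0 ∧ ∃ B : Matrix (Fin p) (Fin r) ℝ, blockP J H * J + B * Hᵀ = 1 := by
  have h1 := Matrix.nonsing_inv_mul _ (isUnit_det_fromBlocks hH hJ)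
  rw [← Matrix.fromBlocks_toBlocks (Matrix.fromBlocks J H Hᵀ 0)⁻¹, Matrix.fromBlocks_multiply,
    ← Matrix.fromBlocks_one, Matrix.fromBlocks_inj] at h1
  refine ⟨?_, _, h1.1⟩
  simpa [blockP] using h1.2.1

theorem transpose_blockP {J : Matrix (Fin p) (Fin p) ℝ} (H : Matrix (Fin p) (Fin r) ℝ)
    (hJ : Jᵀ = J) : (blockP J H)ᵀ = blockP J H := by
  have h1 : (Matrix.fromBlocks J H Hᵀ 0)ᵀ = Matrix.fromBlocks J H Hᵀ 0 := by
    rw [Matrix.fromBlocks_transpose, hJ, transpose_transpose, transpose_zero]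
  have h2 := Matrix.transpose_nonsing_inv (Matrix.fromBlocks J H Hᵀ 0)
  rw [h1] at h2
  ext i j
  exact congrFun (congrFun h2 (Sum.inl i)) (Sum.inl j)

theorem blockP_of_isEmpty {J : Matrix (Fin p) (Fin p) ℝ} (H : Matrix (Fin p) (Fin 0) ℝ)
    (hJ : IsUnit J.det) : blockP J H = J⁻¹ := by
  have h1 : Matrix.fromBlocks J H Hᵀ 0 * Matrix.fromBlocks J⁻¹ 0 0 0 = 1 := by
    rw [Matrix.fromBlocks_multiply, ← Matrix.fromBlocks_one, Matrix.fromBlocks_inj]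
    refine ⟨?_, Subsingleton.elim _ _, Subsingleton.elim _ _, Subsingleton.elim _ _⟩
    rw [Matrix.mul_nonsing_inv _ hJ, Matrix.mul_zero, add_zero]
  rw [blockP, Matrix.inv_eq_right_inv h1, Matrix.toBlocks_fromBlocks₁₁]

end Coordinates

/-! ### Restricted minimum density power divergence estimators -/

/-- The assumptions on the restricted estimation problem at `θ₀`. -/
structure RestrictedProblem {p r : ℕ} {𝒳 : Type*} [MeasurableSpace 𝒳] (μ : Measure 𝒳)
    (Θ : Set (Param p)) (f : Param p → 𝒳 → ℝ) (h : Param p → Fin r → ℝ) (β : ℝ)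
    (θs θ₀ : Param p) : Prop where
  model : IsModel μ Θ f
  nonneg : 0 ≤ β
  mem : θs ∈ Θ
  mem_null : θ₀ ∈ nullSpace Θ h
  contDiffAt : ContDiffAt ℝ 2 h θ₀
  rank_eq : (restrMatrix h θ₀).rank = r
  regular : IsRegularAt μ Θ f β (f θs) θ₀
  pos : ∀ v : Fin p → ℝ, v ≠ 0 → (restrMatrix h θ₀)ᵀ *ᵥ v = 0 →
    0 < v ⬝ᵥ matJres μ f h β (f θs) θ₀ *ᵥ v
  -- Stationarity is all that is needed of the target: the restricted problem gets it from
  -- minimality of the risk, the unrestricted one from unbiasedness of the estimating equations.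
  stationary : ∃ l : (Fin r → ℝ) →L[ℝ] ℝ,
    ∫ x, lossGrad (dpdLoss μ f β) θ₀ x ∂(law μ (f θs)) = l ∘L fderiv ℝ h θ₀

namespace RestrictedProblem

variable {p r : ℕ} {𝒳 Ω : Type*} [MeasurableSpace 𝒳] [MeasurableSpace Ω] {μ : Measure 𝒳}
  {Θ ω : Set (Param p)} {f : Param p → 𝒳 → ℝ} {h : Param p → Fin r → ℝ} {β : ℝ}
  {θs θ₀ : Param p} {l : (Fin r → ℝ) →L[ℝ] ℝ} {ρ : ℝ} {M : 𝒳 → ℝ}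

/-- Stationarity makes the linear system for the multiplier solvable, so its least squares solution
is exact, and full rank makes it unique. -/
theorem multiplier_eq (hp : RestrictedProblem μ Θ f h β θs θ₀) (hω : IsRegularOn μ Θ f β (f θs) ω)
    (hθ₀ : θ₀ ∈ ω)
    (hl : ∫ x, lossGrad (dpdLoss μ f β) θ₀ x ∂(law μ (f θs)) = l ∘L fderiv ℝ h θ₀) (k : Fin r) :
    multiplier μ f h β (f θs) θ₀ k = l (Pi.single k 1) := by
  have h1 : popEstFun μ f β (f θs) θ₀ = -(restrMatrix h θ₀ *ᵥ fun k => l (Pi.single k 1)) := by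
    funext j
    rw [Pi.neg_apply, ← comp_fderiv_single (hp.contDiffAt.differentiableAt two_ne_zero), ← hl,
      hω.integral_lossGrad_single hp.model hp.nonneg hp.mem hθ₀, neg_neg]
  rw [multiplier, h1, mulVec_neg, neg_neg, mulVec_mulVec, Matrix.mul_assoc,
    Matrix.nonsing_inv_mul _ (isUnit_det_transpose_mul_self hp.rank_eq), one_mulVec]

theorem lagrangian_hess_single (hp : RestrictedProblem μ Θ f h β θs θ₀)
    (hω : IsRegularOn μ Θ f β (f θs) ω) (hθ₀ : θ₀ ∈ ω)
    (hl : ∫ x, lossGrad (dpdLoss μ f β) θ₀ x ∂(law μ (f θs)) = l ∘L fderiv ℝ h θ₀) (i j : Fin p) :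
    (∫ x, lossHess (dpdLoss μ f β) θ₀ x ∂(law μ (f θs))) (EuclideanSpace.single i 1)
        (EuclideanSpace.single j 1)
      - l (fderiv ℝ (fderiv ℝ h) θ₀ (EuclideanSpace.single i 1) (EuclideanSpace.single j 1))
      = matJres μ f h β (f θs) θ₀ i j := by
  rw [hω.integral_lossHess_single hp.model hp.nonneg hp.mem hθ₀, clm_pi_apply, matJres,
    Matrix.sub_apply, Matrix.sum_apply]
  simp only [fderiv_fderiv_single_apply hp.contDiffAt, Matrix.smul_apply, smul_eq_mul,
    hp.multiplier_eq hω hθ₀ hl, mul_comm]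

theorem integral_lossHess_comm (hp : RestrictedProblem μ Θ f h β θs θ₀)
    (hω : IsRegularOn μ Θ f β (f θs) ω) (hθ₀ : θ₀ ∈ ω) (v w : Param p) :
    (∫ x, lossHess (dpdLoss μ f β) θ₀ x ∂(law μ (f θs))) v w
      = (∫ x, lossHess (dpdLoss μ f β) θ₀ x ∂(law μ (f θs))) w v := by
  have hL := hω.integrable_lossHess hp.model hp.mem hθ₀
  rw [ContinuousLinearMap.integral_apply hL,
    ContinuousLinearMap.integral_apply (hL.apply_continuousLinearMap _),
    ContinuousLinearMap.integral_apply hL,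
    ContinuousLinearMap.integral_apply (hL.apply_continuousLinearMap _)]
  refine integral_congr_ae ?_
  filter_upwards [hω.ae_contDiffAt_and_pos hp.model hp.mem] with x hx
  exact (hω.contDiffAt_dpdLoss hx hθ₀).fderiv_fderiv_comm v w

/-- Symmetry is inherited from the second derivatives of the loss and of `h`. It makes `P`
symmetric, hence the covariance `P V P` rather than `P V Pᵀ`. -/
theorem transpose_matJres (hp : RestrictedProblem μ Θ f h β θs θ₀) :
    (matJres μ f h β (f θs) θ₀)ᵀ = matJres μ f h β (f θs) θ₀ := by
  obtain ⟨ω, ρ, M, hω, hball, hm⟩ := hp.regular.exists_isSmoothLoss hp.model hp.mem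
  obtain ⟨l, hl⟩ := hp.stationary
  have hθ₀ := hball (Metric.mem_ball_self hm.radius_pos)
  ext i j
  rw [transpose_apply, ← hp.lagrangian_hess_single hω hθ₀ hl, ← hp.lagrangian_hess_single hω hθ₀ hl,
    hp.integral_lossHess_comm hω hθ₀, hp.contDiffAt.fderiv_fderiv_comm]

theorem lagrangian_hess_apply (hp : RestrictedProblem μ Θ f h β θs θ₀)
    (hω : IsRegularOn μ Θ f β (f θs) ω) (hθ₀ : θ₀ ∈ ω)
    (hl : ∫ x, lossGrad (dpdLoss μ f β) θ₀ x ∂(law μ (f θs)) = l ∘L fderiv ℝ h θ₀)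
    (v : Param p) (j : Fin p) :
    (∫ x, lossHess (dpdLoss μ f β) θ₀ x ∂(law μ (f θs))) v (EuclideanSpace.single j 1)
      - l (fderiv ℝ (fderiv ℝ h) θ₀ v (EuclideanSpace.single j 1))
      = (matJres μ f h β (f θs) θ₀ *ᵥ v.ofLp) j := by
  rw [clm_apply_eq_sum _ v, clm_apply_eq_sum (fderiv ℝ (fderiv ℝ h) θ₀) v, mulVec, dotProduct]
  simp only [_root_.sum_apply, _root_.smul_apply, map_sum, map_smul, smul_eq_mul,
    ← Finset.sum_sub_distrib, ← mul_sub, hp.lagrangian_hess_single hω hθ₀ hl]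
  refine Finset.sum_congr rfl fun i _ => ?_
  rw [mul_comm, ← transpose_apply (matJres μ f h β (f θs) θ₀), hp.transpose_matJres]

theorem lagrangian_hess_apply_self (hp : RestrictedProblem μ Θ f h β θs θ₀)
    (hω : IsRegularOn μ Θ f β (f θs) ω) (hθ₀ : θ₀ ∈ ω)
    (hl : ∫ x, lossGrad (dpdLoss μ f β) θ₀ x ∂(law μ (f θs)) = l ∘L fderiv ℝ h θ₀)
    (v : Param p) :
    (∫ x, lossHess (dpdLoss μ f β) θ₀ x ∂(law μ (f θs))) v v
      - l (fderiv ℝ (fderiv ℝ h) θ₀ v v) = v.ofLp ⬝ᵥ matJres μ f h β (f θs) θ₀ *ᵥ v.ofLp := by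
  rw [clm_apply_eq_sum _ v, clm_apply_eq_sum (fderiv ℝ (fderiv ℝ h) θ₀ v) v, dotProduct]
  simp only [map_sum, map_smul, smul_eq_mul, ← Finset.sum_sub_distrib, ← mul_sub,
    hp.lagrangian_hess_apply hω hθ₀ hl]

theorem exists_isConsistentRestrictedRoot (hp : RestrictedProblem μ Θ f h β θs θ₀) {P : Measure Ω}
    [IsProbabilityMeasure P] {X : ℕ → Ω → 𝒳} (hX : IsIID P (law μ (f θs)) X) :
    ∃ rest : (n : ℕ) → (Fin n → 𝒳) → Param p,
      IsConsistentRestrictedRoot μ Θ h f β P X θ₀ rest := by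
  obtain ⟨ω, ρ, M, hω, hball, hm⟩ := hp.regular.exists_isSmoothLoss hp.model hp.mem
  obtain ⟨l, hl⟩ := hp.stationary
  have hθ₀ := hball (Metric.mem_ball_self hm.radius_pos)
  have hd := hp.contDiffAt.differentiableAt two_ne_zero
  obtain ⟨est, hmeas, hcons, hroot⟩ := exists_consistent_constrainedRoot hm hX hp.contDiffAt
    hp.mem_null.2 (range_fderiv_eq_top hd hp.rank_eq) l hl fun v hv0 hv => by
      rw [hp.lagrangian_hess_apply_self hω hθ₀ hl]
      refine hp.pos _ (fun h0 => hv0 ?_) ?_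
      · ext i
        exact congrFun h0 i
      · rw [← fderiv_eq_mulVec hd, hv]
  refine ⟨est, hmeas, hcons, ?_⟩
  obtain ⟨δ, hδ, hnear⟩ := Metric.eventually_nhds_iff.1
    ((hp.contDiffAt.eventually (by simp)).and (hω.isOpen.mem_nhds hθ₀))
  have hgood : HoldsWHP P fun n ω' => ∀ i, ∀ t ∈ ω,
      ContDiffAt ℝ 3 (fun t => f t (sample X n ω' i)) t ∧ 0 < f t (sample X n ω' i) :=
    holdsWHP_of_ae fun n => (hX.ae_forall (hω.ae_contDiffAt_and_pos hp.model hp.mem)).mono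
      fun ω' hω' i => hω' i
  have hclose := tendstoInMeasure_iff_holdsWHP.1 hcons δ hδ
  refine ((hroot.and hgood).and hclose).mono_eventually ?_
  filter_upwards [eventually_ne_atTop 0] with n hn ω' hA
  obtain ⟨⟨⟨h0, l', hl'⟩, hx⟩, hdist⟩ := hA
  rw [← dist_eq_norm] at hdist
  obtain ⟨hC2, hmem⟩ := hnear hdist
  refine ⟨⟨hω.subset hmem, h0⟩, fun k => l' (Pi.single k 1), ?_⟩
  funext j
  rw [Pi.add_apply, ← comp_fderiv_single (hC2.differentiableAt two_ne_zero), ← hl',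
    hω.sampleMean_lossGrad_single hp.model hp.nonneg hmem hn hx, add_neg_cancel, Pi.zero_apply]

end RestrictedProblem

/-- The influence function of the restricted estimator. -/
noncomputable def influence {p r : ℕ} {𝒳 : Type*} [MeasurableSpace 𝒳] (μ : Measure 𝒳)
    (f : Param p → 𝒳 → ℝ) (h : Param p → Fin r → ℝ) (β : ℝ) (g : 𝒳 → ℝ) (θ : Param p) (x : 𝒳) :
    Param p :=
  WithLp.toLp 2 (matP μ f h β g θ *ᵥ wscore f β θ x)

/-! ### Linear representation by influence functions. -/

namespace RestrictedProblem

variable {p r : ℕ} {𝒳 Ω : Type*} [MeasurableSpace 𝒳] [MeasurableSpace Ω] {μ : Measure 𝒳}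
  {Θ ω : Set (Param p)} {f : Param p → 𝒳 → ℝ} {h : Param p → Fin r → ℝ} {β : ℝ}
  {θs θ₀ : Param p} {l : (Fin r → ℝ) →L[ℝ] ℝ} {ρ : ℝ} {M : 𝒳 → ℝ}

theorem memLp_influence (hp : RestrictedProblem μ Θ f h β θs θ₀) (j : Fin p) :
    MemLp (fun x => influence μ f h β (f θs) θ₀ x j) 2 (law μ (f θs)) := by
  have h1 : (fun x => influence μ f h β (f θs) θ₀ x j)
      = fun x => ∑ k, matP μ f h β (f θs) θ₀ j k * wscore f β θ₀ x k := rfl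
  rw [h1]
  exact memLp_finsetSum _ fun k _ => (hp.regular.memLp_wscore k).const_mul _

theorem integrable_influence (hp : RestrictedProblem μ Θ f h β θs θ₀) :
    Integrable (influence μ f h β (f θs) θ₀) (law μ (f θs)) := by
  have := hp.model.isProbabilityMeasure_law hp.mem
  exact (MemLp.of_eval_piLp hp.memLp_influence).integrable (by norm_num)

theorem covectorMap_lossGrad (hp : RestrictedProblem μ Θ f h β θs θ₀)
    (hω : IsRegularOn μ Θ f β (f θs) ω) (hθ₀ : θ₀ ∈ ω) {x : 𝒳}
    (hx : ∀ t ∈ ω, ContDiffAt ℝ 3 (fun t => f t x) t ∧ 0 < f t x) :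
    covectorMap (matP μ f h β (f θs) θ₀) (lossGrad (dpdLoss μ f β) θ₀ x)
      = WithLp.toLp 2 (matP μ f h β (f θs) θ₀ *ᵥ
          fun j => ∫ y, score f θ₀ y j * f θ₀ y ^ (1 + β) ∂μ)
        - influence μ f h β (f θs) θ₀ x := by
  rw [covectorMap_apply, influence, ← WithLp.toLp_sub, ← mulVec_sub]
  congr 2
  funext j
  exact hω.lossGrad_dpdLoss_single hx hp.model hp.nonneg hθ₀ j

/-- Centring cancels the integral term of the gradient, which does not depend on the observation;
the loss contains the weighted score with a minus sign, hence the minus here. -/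
theorem covectorMap_sampleMean_sub (hp : RestrictedProblem μ Θ f h β θs θ₀)
    (hω : IsRegularOn μ Θ f β (f θs) ω) (hθ₀ : θ₀ ∈ ω) {n : ℕ} (hn : n ≠ 0) {x : Fin n → 𝒳}
    (hx : ∀ i, ∀ t ∈ ω, ContDiffAt ℝ 3 (fun t => f t (x i)) t ∧ 0 < f t (x i)) :
    covectorMap (matP μ f h β (f θs) θ₀) (sampleMean (lossGrad (dpdLoss μ f β) θ₀) x
        - ∫ y, lossGrad (dpdLoss μ f β) θ₀ y ∂(law μ (f θs)))
      = -(sampleMean (influence μ f h β (f θs) θ₀) x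
        - ∫ y, influence μ f h β (f θs) θ₀ y ∂(law μ (f θs))) := by
  have := hp.model.isProbabilityMeasure_law hp.mem
  set c : Param p := WithLp.toLp 2 (matP μ f h β (f θs) θ₀ *ᵥ
    fun j => ∫ y, score f θ₀ y j * f θ₀ y ^ (1 + β) ∂μ) with hc
  have h1 : covectorMap (matP μ f h β (f θs) θ₀) (sampleMean (lossGrad (dpdLoss μ f β) θ₀) x)
      = c - sampleMean (influence μ f h β (f θs) θ₀) x := by
    rw [clm_sampleMean, sampleMean, sampleMean,
      Finset.sum_congr rfl fun i _ => hp.covectorMap_lossGrad hω hθ₀ (hx i),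
      Finset.sum_sub_distrib, smul_sub, Finset.sum_const, Finset.card_univ, Fintype.card_fin,
      ← Nat.cast_smul_eq_nsmul ℝ, inv_smul_smul₀ (Nat.cast_ne_zero.2 hn)]
  have h2 : covectorMap (matP μ f h β (f θs) θ₀)
      (∫ y, lossGrad (dpdLoss μ f β) θ₀ y ∂(law μ (f θs)))
      = c - ∫ y, influence μ f h β (f θs) θ₀ y ∂(law μ (f θs)) := by
    rw [← ContinuousLinearMap.integral_comp_comm _
      (hω.integrable_lossGrad hp.model hp.mem hθ₀)]
    have h3 : ∫ y, covectorMap (matP μ f h β (f θs) θ₀) (lossGrad (dpdLoss μ f β) θ₀ y)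
          ∂(law μ (f θs))
        = ∫ y, (c - influence μ f h β (f θs) θ₀ y) ∂(law μ (f θs)) := by
      refine integral_congr_ae ?_
      filter_upwards [hω.ae_contDiffAt_and_pos hp.model hp.mem] with y hy
      exact hp.covectorMap_lossGrad hω hθ₀ hy
    rw [h3, integral_sub (integrable_const _) hp.integrable_influence]
    simp
  rw [map_sub, h1, h2]
  abel

theorem boundedInProb_lossGrad (hp : RestrictedProblem μ Θ f h β θs θ₀)
    (hω : IsRegularOn μ Θ f β (f θs) ω) (hθ₀ : θ₀ ∈ ω) {P : Measure Ω}
    [IsProbabilityMeasure P] {X : ℕ → Ω → 𝒳} (hX : IsIID P (law μ (f θs)) X) :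
    BoundedInProb P fun n ω' => √n • (sampleMean (lossGrad (dpdLoss μ f β) θ₀) (sample X n ω')
      - ∫ x, lossGrad (dpdLoss μ f β) θ₀ x ∂(law μ (f θs))) := by
  have := hp.model.isProbabilityMeasure_law hp.mem
  have hLp : ∀ j, MemLp (fun x => lossGrad (dpdLoss μ f β) θ₀ x (EuclideanSpace.single j 1)) 2
      (law μ (f θs)) := by
    intro j
    refine ((memLp_const (∫ y, score f θ₀ y j * f θ₀ y ^ (1 + β) ∂μ)).sub
      (hp.regular.memLp_wscore j)).ae_eq ?_
    filter_upwards [hω.ae_contDiffAt_and_pos hp.model hp.mem] with x hx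
    exact (hω.lossGrad_dpdLoss_single hx hp.model hp.nonneg hθ₀ j).symm
  refine BoundedInProb.of_norm_le_sum (fun j => hX.boundedInProb_sampleMean (hLp j))
    fun n ω' => (norm_clm_le_sum _).trans_eq (Finset.sum_congr rfl fun j _ => ?_)
  rw [_root_.smul_apply, _root_.sub_apply, sampleMean_clm_apply,
    ContinuousLinearMap.integral_apply (hω.integrable_lossGrad hp.model hp.mem hθ₀), smul_eq_mul]

/-- The identities `P H = 0` and `P J̃ + B Hᵀ = 1` for the bordered inverse are precisely the
hypotheses of the abstract linearization, with `T` given by `P` and `Q` by `B`. -/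
theorem holdsWHP_linearization (hp : RestrictedProblem μ Θ f h β θs θ₀) {P : Measure Ω}
    [IsProbabilityMeasure P] {X : ℕ → Ω → 𝒳} (hX : IsIID P (law μ (f θs)) X)
    {rest : (n : ℕ) → (Fin n → 𝒳) → Param p}
    (hr : IsConsistentRestrictedRoot μ Θ h f β P X θ₀ rest) {ε : ℝ} (hε : 0 < ε) :
    HoldsWHP P fun n ω' => ‖√n • (rest n (sample X n ω') - θ₀)
      - √n • (sampleMean (influence μ f h β (f θs) θ₀) (sample X n ω')
        - ∫ x, influence μ f h β (f θs) θ₀ x ∂(law μ (f θs)))‖ < ε := by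
  obtain ⟨ω, ρ, M, hω, hball, hm⟩ := hp.regular.exists_isSmoothLoss hp.model hp.mem
  obtain ⟨l, hl⟩ := hp.stationary
  have hθ₀ := hball (Metric.mem_ball_self hm.radius_pos)
  have hd := hp.contDiffAt.differentiableAt two_ne_zero
  obtain ⟨δ, hδ, hnear⟩ := Metric.eventually_nhds_iff.1
    ((hp.contDiffAt.eventually (by simp)).and (hω.isOpen.mem_nhds hθ₀))
  have hgood : HoldsWHP P fun n ω' => ∀ i, ∀ t ∈ ω,
      ContDiffAt ℝ 3 (fun t => f t (sample X n ω' i)) t ∧ 0 < f t (sample X n ω' i) :=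
    holdsWHP_of_ae fun n => (hX.ae_forall (hω.ae_contDiffAt_and_pos hp.model hp.mem)).mono
      fun ω' hω' i => hω' i
  have hclose := tendstoInMeasure_iff_holdsWHP.1 hr.consistent δ hδ
  have hroot : HoldsWHP P fun n ω' => IsConstrainedRoot h (dpdLoss μ f β) (sample X n ω')
      (rest n (sample X n ω')) := by
    have hroot' : HoldsWHP P fun n ω' => rest n (sample X n ω') ∈ nullSpace Θ h ∧
      ∃ ℓ : Fin r → ℝ, estFun μ f β (sample X n ω') (rest n (sample X n ω'))
        + restrMatrix h (rest n (sample X n ω')) *ᵥ ℓ = 0 := hr.root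
    refine ((hroot'.and hgood).and hclose).mono_eventually ?_
    filter_upwards [eventually_ne_atTop 0] with n hn ω' hA
    obtain ⟨⟨⟨h0, ℓ, hℓ⟩, hx⟩, hdist⟩ := hA
    rw [← dist_eq_norm] at hdist
    obtain ⟨hC2, hmem⟩ := hnear hdist
    refine ⟨h0.2, ∑ k, ℓ k • ContinuousLinearMap.proj (R := ℝ) (φ := fun _ : Fin r => ℝ) k,
      clm_ext_single fun j => ?_⟩
    rw [comp_fderiv_single (hC2.differentiableAt two_ne_zero),
      hω.sampleMean_lossGrad_single hp.model hp.nonneg hmem hn hx]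
    have h1 : (fun k => (∑ k, ℓ k • ContinuousLinearMap.proj (R := ℝ)
        (φ := fun _ : Fin r => ℝ) k) (Pi.single k 1)) = ℓ := by
      funext k
      simp [Pi.single_apply]
    rw [h1]
    exact neg_eq_of_add_eq_zero_right (congrFun hℓ j)
  obtain ⟨hPH, B, hPJ⟩ := exists_blockP_mul_add hp.rank_eq hp.pos
  have hlin := tendstoInMeasure_constrainedRoot_linearization hm hX hp.contDiffAt hp.mem_null.2
    (range_fderiv_eq_top hd hp.rank_eq) l hl (covectorMap (matP μ f h β (f θs) θ₀)) (piMap B)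
    (fun k => by
      rw [covectorMap_apply, funext (comp_fderiv_single hd k), mulVec_mulVec, matP, hPH, zero_mulVec]
      rfl)
    (fun d => by
      have h2 : (fun j => ((∫ x, lossHess (dpdLoss μ f β) θ₀ x ∂(law μ (f θs))) d
          - l ∘L fderiv ℝ (fderiv ℝ h) θ₀ d) (EuclideanSpace.single j 1))
          = matJres μ f h β (f θs) θ₀ *ᵥ d.ofLp :=
        funext fun j => hp.lagrangian_hess_apply hω hθ₀ hl d j
      rw [covectorMap_apply, piMap_apply, h2, fderiv_eq_mulVec hd, mulVec_mulVec, mulVec_mulVec,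
        ← WithLp.toLp_add, ← add_mulVec, matP, hPJ, one_mulVec])
    (hp.boundedInProb_lossGrad hω hθ₀ hX) hr.consistent hroot hε
  refine (hlin.and hgood).mono_eventually ?_
  filter_upwards [eventually_ne_atTop 0] with n hn ω' hA
  have h3 := hA.1
  rwa [hp.covectorMap_sampleMean_sub hω hθ₀ hn hA.2, smul_neg, ← sub_eq_add_neg] at h3

end RestrictedProblem

/-! ### The delta method -/

section Delta

variable {Ω : Type*} [MeasurableSpace Ω] {P : Measure Ω}

/-- Allows an argument about probable events to treat `Y` as bounded by an arbitrary constant. -/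
theorem BoundedInProb.holdsWHP {G : Type*} [SeminormedAddCommGroup G] {Y : ℕ → Ω → G}
    (hY : BoundedInProb P Y) {A : ℕ → Ω → Prop}
    (hA : ∀ K > 0, HoldsWHP P fun n ω => ‖Y n ω‖ < K → A n ω) : HoldsWHP P A := by
  refine ENNReal.tendsto_nhds_zero.2 fun ε hε => ?_
  have hε2 : 0 < ε / 2 := ENNReal.half_pos hε.ne'
  obtain ⟨K, hK0, hK⟩ := hY (ε / 2) hε2
  filter_upwards [ENNReal.tendsto_nhds_zero.1 (hA K hK0) (ε / 2) hε2] with n hn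
  calc P {ω | ¬ A n ω}
      ≤ P ({ω | K ≤ ‖Y n ω‖} ∪ {ω | ¬ (‖Y n ω‖ < K → A n ω)}) := measure_mono fun ω hω => by
        by_cases h : ‖Y n ω‖ < K
        · exact Or.inr fun h' => hω (h' h)
        · exact Or.inl (not_lt.1 h)
    _ ≤ ε / 2 + ε / 2 := (measure_union_le _ _).trans (add_le_add (hK n) hn)
    _ = ε := ENNReal.add_halves ε

variable {E : Type*} [NormedAddCommGroup E] [NormedSpace ℝ E]

/-- Differentiability at the single point `q₀` suffices: `√n` times the Fréchet remainder is at most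
`η ‖√n (q - q₀)‖`, and the rescaled displacement is bounded in probability. -/
theorem holdsWHP_delta {S : E → ℝ} {S' : E →L[ℝ] ℝ} {q₀ : E} (hS : HasFDerivAt S S' q₀)
    {q V : ℕ → Ω → E} (hq : ∀ ε > 0, HoldsWHP P fun n ω => ‖q n ω - q₀‖ < ε)
    (hV : BoundedInProb P V)
    (hqV : ∀ ε > 0, HoldsWHP P fun n ω => ‖√n • (q n ω - q₀) - V n ω‖ < ε) {ε : ℝ} (hε : 0 < ε) :
    HoldsWHP P fun n ω => |√n * (S (q n ω) - S q₀) - S' (V n ω)| < ε := by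
  refine hV.holdsWHP fun K hK => ?_
  -- `K + 1` will bound the rescaled displacement, so the remainder costs `ε / 2`; replacing that
  -- displacement by `V` inside `S'` costs less than another `ε / 2`.
  set η := ε / (2 * (K + 1)) with hη
  have hη0 : 0 < η := by positivity
  obtain ⟨δ, hδ, hnear⟩ := Metric.eventually_nhds_iff.1 (hS.isLittleO.def hη0)
  have hτ0 : 0 < ε / (2 * (‖S'‖ + 1)) := by positivity
  refine ((hq δ hδ).and (hqV (min 1 (ε / (2 * (‖S'‖ + 1)))) (lt_min one_pos hτ0))).mono
    fun n ω hA hVK => ?_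
  obtain ⟨h1, h2⟩ := hA
  rw [← dist_eq_norm] at h1
  have h3 := hnear h1
  have hs : 0 ≤ √(n : ℝ) := Real.sqrt_nonneg _
  have h4 : ‖√n • (q n ω - q₀)‖ < K + 1 := by
    have : √n • (q n ω - q₀) = (√n • (q n ω - q₀) - V n ω) + V n ω := by abel
    rw [this]
    have := h2.trans_le (min_le_left _ _)
    linarith [norm_add_le (√n • (q n ω - q₀) - V n ω) (V n ω)]
  have h5 : √n * (S (q n ω) - S q₀) - S' (V n ω)
      = √n * (S (q n ω) - S q₀ - S' (q n ω - q₀)) + S' (√n • (q n ω - q₀) - V n ω) := by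
    simp only [map_sub, map_smul, smul_eq_mul]
    ring
  have h6 : |√n * (S (q n ω) - S q₀ - S' (q n ω - q₀))| ≤ η * (K + 1) := by
    rw [abs_mul, abs_of_nonneg hs]
    calc √n * |S (q n ω) - S q₀ - S' (q n ω - q₀)|
        ≤ √n * (η * ‖q n ω - q₀‖) := by gcongr; exact h3
      _ = η * ‖√n • (q n ω - q₀)‖ := by rw [norm_smul, Real.norm_of_nonneg hs]; ring
      _ ≤ η * (K + 1) := by gcongr
  have h7 : |S' (√n • (q n ω - q₀) - V n ω)| < ε / 2 := by
    calc |S' (√n • (q n ω - q₀) - V n ω)| ≤ ‖S'‖ * ‖√n • (q n ω - q₀) - V n ω‖ := S'.le_opNorm _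
      _ ≤ ‖S'‖ * (ε / (2 * (‖S'‖ + 1))) := by
        gcongr
        exact (h2.trans_le (min_le_right _ _)).le
      _ < ε / 2 := by
        rw [mul_div_assoc', div_lt_div_iff₀ (by positivity) two_pos]
        nlinarith [norm_nonneg S']
  have h8 : η * (K + 1) = ε / 2 := by
    rw [hη]
    field_simp
  rw [h5]
  refine (abs_add_le _ _).trans_lt ?_
  linarith

end Delta

/-! ### Pairs of parameters -/

section Pairs

variable {p : ℕ}

/-- A pair of parameters, as one Euclidean vector. -/
noncomputable def pairLp : Param p × Param p →L[ℝ] EuclideanSpace ℝ (Fin p ⊕ Fin p) :=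
  LinearMap.toContinuousLinearMap
    { toFun := fun u => WithLp.toLp 2 (Sum.elim u.1.ofLp u.2.ofLp)
      map_add' := fun u v => by
        ext i
        cases i <;> simp
      map_smul' := fun c u => by
        ext i
        cases i <;> simp }

theorem pairLp_apply_inl (u : Param p × Param p) (j : Fin p) : pairLp u (Sum.inl j) = u.1 j := rfl

theorem pairLp_apply_inr (u : Param p × Param p) (j : Fin p) : pairLp u (Sum.inr j) = u.2 j := rfl

theorem norm_pair_le_sum (u : Param p × Param p) : ‖u‖ ≤ ∑ i, ‖pairLp u i‖ := by
  have h1 : ∀ v : Param p, ‖v‖ ≤ ∑ j, ‖v j‖ := by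
    intro v
    conv_lhs => rw [← sum_smul_single v]
    refine (norm_sum_le _ _).trans (Finset.sum_le_sum fun j _ => ?_)
    simp [norm_smul]
  rw [Fintype.sum_sum_type, Prod.norm_def]
  have ha := h1 u.1
  have hb := h1 u.2
  have ha0 : 0 ≤ ∑ j, ‖u.1 j‖ := Finset.sum_nonneg fun _ _ => norm_nonneg _
  have hb0 : 0 ≤ ∑ j, ‖u.2 j‖ := Finset.sum_nonneg fun _ _ => norm_nonneg _
  exact max_le (ha.trans (le_add_of_nonneg_right hb0)) (hb.trans (le_add_of_nonneg_left ha0))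

theorem clm_pair_eq_sum (S : Param p × Param p →L[ℝ] ℝ) (u : Param p × Param p) :
    S u = ∑ i, Sum.elim (fun j => S (EuclideanSpace.single j 1, 0))
      (fun j => S (0, EuclideanSpace.single j 1)) i * pairLp u i := by
  have h1 : S u = (S ∘L ContinuousLinearMap.inl ℝ _ _) u.1
      + (S ∘L ContinuousLinearMap.inr ℝ _ _) u.2 := by
    simp [← map_add]
  rw [h1, clm_apply_eq_sum _ u.1, clm_apply_eq_sum _ u.2, Fintype.sum_sum_type]
  simp only [Sum.elim_inl, Sum.elim_inr, pairLp_apply_inl, pairLp_apply_inr, smul_eq_mul, mul_comm]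
  rfl

variable {𝒳 Ω : Type*} [MeasurableSpace 𝒳] [MeasurableSpace Ω] {P : Measure Ω}
  [IsProbabilityMeasure P] {ν : Measure 𝒳} {X : ℕ → Ω → 𝒳} {U : 𝒳 → Param p × Param p}

theorem boundedInProb_pair (hX : IsIID P ν X) (hU : Integrable U ν)
    (hLp : ∀ i, MemLp (fun x => pairLp (U x) i) 2 ν) :
    BoundedInProb P fun n ω => √n • (sampleMean U (sample X n ω) - ∫ x, U x ∂ν) := by
  refine BoundedInProb.of_norm_le_sum (fun i => hX.boundedInProb_sampleMean (hLp i))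
    fun n ω => (norm_pair_le_sum _).trans_eq (Finset.sum_congr rfl fun i _ => ?_)
  let L : Param p × Param p →L[ℝ] ℝ := EuclideanSpace.proj i ∘L pairLp
  change ‖L _‖ = _
  rw [map_smul, map_sub, clm_sampleMean, ← ContinuousLinearMap.integral_comp_comm _ hU]
  rfl

end Pairs

/-! ### Joint asymptotic normality -/

section Joint

variable {p r : ℕ} {𝒳 : Type*} [MeasurableSpace 𝒳] {μ : Measure 𝒳}
  {f : Param p → 𝒳 → ℝ} {β : ℝ} {g : 𝒳 → ℝ} {θ θ' : Param p}

theorem covariance_mulVec [IsProbabilityMeasure (law μ g)]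
    (h : ∀ j, MemLp (fun x => wscore f β θ x j) 2 (law μ g))
    (h' : ∀ j, MemLp (fun x => wscore f β θ' x j) 2 (law μ g))
    (A B : Matrix (Fin p) (Fin p) ℝ) (i j : Fin p) :
    cov[fun x => (A *ᵥ wscore f β θ x) i, fun x => (B *ᵥ wscore f β θ' x) j; law μ g]
      = (A * matC μ f β g θ θ' * Bᵀ) i j := by
  simp only [mulVec, dotProduct]
  rw [covariance_fun_sum_fun_sum (fun k => (h k).const_mul _) fun k => (h' k).const_mul _]
  simp only [covariance_const_mul_left, covariance_const_mul_right, Matrix.mul_apply,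
    transpose_apply, Finset.sum_mul, matC, Matrix.of_apply]
  rw [Finset.sum_comm]
  refine Finset.sum_congr rfl fun k _ => Finset.sum_congr rfl fun l _ => ?_
  ring

theorem transpose_matC : (matC μ f β g θ θ')ᵀ = matC μ f β g θ' θ := by
  ext i j
  exact covariance_comm _ _

theorem sigmaSq_eq (h : Param p → Fin r → ℝ) (γ lam : ℝ) (θs θ₀ : Param p) :
    sigmaSq μ f h β γ lam θs θ₀
      = Sum.elim (gradM1 μ f γ lam θs θ₀) (gradM2 μ f γ lam θs θ₀) ⬝ᵥ covJoint μ f h β θs θ₀ *ᵥ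
        Sum.elim (gradM1 μ f γ lam θs θ₀) (gradM2 μ f γ lam θs θ₀) := by
  rw [covJoint, Matrix.fromBlocks_mulVec, Sum.elim_comp_inl, Sum.elim_comp_inr,
    sumElim_dotProduct_sumElim, dotProduct_add, dotProduct_add, sigmaSq]
  ring

variable {Θ : Set (Param p)} {θs θ₀ : Param p} {h : Param p → Fin r → ℝ}

theorem RestrictedProblem.transpose_matP (hp : RestrictedProblem μ Θ f h β θs θ₀) :
    (matP μ f h β (f θs) θ₀)ᵀ = matP μ f h β (f θs) θ₀ :=
  transpose_blockP _ hp.transpose_matJres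

/-- Without restrictions, the matrix `P` is the inverse of `J`. -/
theorem matP_of_isEmpty (h₁ : Param p → Fin 0 → ℝ) (hJ : IsUnit (matJ μ f β g θ).det) :
    matP μ f h₁ β g θ = (matJ μ f β g θ)⁻¹ := by
  have h1 : matJres μ f h₁ β g θ = matJ μ f β g θ := by simp [matJres]
  rw [matP, h1, blockP_of_isEmpty _ hJ]

/-- Each block is a sandwich `P C Pᵀ`; symmetry removes the transpose, and in the unrestricted
problem `P` is `J⁻¹`. -/
theorem covMatrix_influence {h₁ : Param p → Fin 0 → ℝ}
    (hp₁ : RestrictedProblem μ Θ f h₁ β θs θs) (hp : RestrictedProblem μ Θ f h β θs θ₀)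
    (hJ : IsUnit (matJ μ f β (f θs) θs).det) :
    covMatrix (law μ (f θs)) (fun x => pairLp (influence μ f h₁ β (f θs) θs x,
      influence μ f h β (f θs) θ₀ x)) = covJoint μ f h β θs θ₀ := by
  have := hp.model.isProbabilityMeasure_law hp.mem
  have hP₁ := matP_of_isEmpty h₁ hJ
  have hJt := hp₁.transpose_matP
  have hPt := hp.transpose_matP
  have hm₁ := hp₁.regular.memLp_wscore
  have hm := hp.regular.memLp_wscore
  ext i j
  rcases i with i | i <;> rcases j with j | j
  · refine (covariance_mulVec hm₁ hm₁ (matP μ f h₁ β (f θs) θs) (matP μ f h₁ β (f θs) θs)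
      i j).trans ?_
    rw [hJt, hP₁]
    rfl
  · refine (covariance_mulVec hm₁ hm (matP μ f h₁ β (f θs) θs) (matP μ f h β (f θs) θ₀)
      i j).trans ?_
    rw [hPt, hP₁]
    rfl
  · refine (covariance_mulVec hm hm₁ (matP μ f h β (f θs) θ₀) (matP μ f h₁ β (f θs) θs)
      i j).trans ?_
    have h1 : matP μ f h β (f θs) θ₀ * matC μ f β (f θs) θ₀ θs * (matP μ f h₁ β (f θs) θs)ᵀ
        = (covCross μ f h β θs θ₀)ᵀ := by
      rw [covCross, Matrix.transpose_mul, Matrix.transpose_mul, transpose_matC, hPt, hP₁,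
        Matrix.mul_assoc]
    rw [h1]
    rfl
  · refine (covariance_mulVec hm hm (matP μ f h β (f θs) θ₀) (matP μ f h β (f θs) θ₀)
      i j).trans ?_
    rw [hPt]
    rfl

end Joint

/-! ### Both estimation problems in one form. -/

section Problems

variable {p r : ℕ} {𝒳 Ω : Type*} [MeasurableSpace 𝒳] [MeasurableSpace Ω] {μ : Measure 𝒳}
  {Θ : Set (Param p)} {f : Param p → 𝒳 → ℝ} {h : Param p → Fin r → ℝ} {β : ℝ} {θs θ₀ : Param p}

/-- A restricted best fitting parameter satisfies the Lagrange equations. -/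
theorem IsRegularAt.exists_multiplier (hreg : IsRegularAt μ Θ f β (f θs) θ₀)
    (hmodel : IsModel μ Θ f) (hθs : θs ∈ Θ) (hθ₀ : θ₀ ∈ nullSpace Θ h)
    (hbest : IsLocalMinOn (dpdRisk μ f β (f θs)) (nullSpace Θ h) θ₀) (hh : ContDiffAt ℝ 2 h θ₀)
    (hH : (restrMatrix h θ₀).rank = r) :
    ∃ l : (Fin r → ℝ) →L[ℝ] ℝ,
      ∫ x, lossGrad (dpdLoss μ f β) θ₀ x ∂(law μ (f θs)) = l ∘L fderiv ℝ h θ₀ := by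
  obtain ⟨ω, ρ, M, hω, hball, hm⟩ := hreg.exists_isSmoothLoss hmodel hθs
  have hmem := hball (Metric.mem_ball_self hm.radius_pos)
  refine exists_lagrange_multiplier (Or.inl ?_) (hω.hasStrictFDerivAt_dpdRisk hmodel hθs hmem)
    (hh.hasStrictFDerivAt two_ne_zero) (range_fderiv_eq_top (hh.differentiableAt two_ne_zero) hH)
  have h1 := eventually_nhdsWithin_iff.1 hbest
  refine eventually_nhdsWithin_iff.2 ?_
  filter_upwards [h1, hω.isOpen.mem_nhds hmem] with t ht htω hth
  exact ht ⟨hω.subset htω, hth.trans hθ₀.2⟩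

/-- The unrestricted problem at the true parameter, as a restricted problem without equations. -/
theorem RestrictedProblem.unrestricted (hmodel : IsModel μ Θ f) (hβ : 0 ≤ β) (hθs : θs ∈ Θ)
    (hreg : IsRegularAt μ Θ f β (f θs) θs) (hJ : (matJ μ f β (f θs) θs).PosDef) :
    RestrictedProblem μ Θ f (fun _ => (0 : Fin 0 → ℝ)) β θs θs where
  model := hmodel
  nonneg := hβ
  mem := hθs
  mem_null := ⟨hθs, rfl⟩
  contDiffAt := contDiffAt_const
  rank_eq := Nat.le_zero.1 ((Matrix.rank_le_card_width _).trans_eq (Fintype.card_fin 0))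
  regular := hreg
  pos v hv _ := by
    have h1 : matJres μ f (fun _ => (0 : Fin 0 → ℝ)) β (f θs) θs = matJ μ f β (f θs) θs := by
      simp [matJres]
    rw [h1]
    simpa using hJ.dotProduct_mulVec_pos hv
  stationary := by
    obtain ⟨ω, ρ, M, hω, hball, hm⟩ := hreg.exists_isSmoothLoss hmodel hθs
    refine ⟨0, clm_ext_single fun j => ?_⟩
    rw [hω.integral_lossGrad_single hmodel hβ hθs (hball (Metric.mem_ball_self hm.radius_pos)),
      hmodel.popEstFun_self hβ hθs]
    simp

/-- With no equations the null space is all of `Θ` and the multiplier term vanishes. -/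
theorem isConsistentRoot_iff {P : Measure Ω} {X : ℕ → Ω → 𝒳}
    {est : (n : ℕ) → (Fin n → 𝒳) → Param p} :
    IsConsistentRoot μ Θ f β P X θs est ↔
      IsConsistentRestrictedRoot μ Θ (fun _ => (0 : Fin 0 → ℝ)) f β P X θs est := by
  have h1 : ∀ (t : Param p) (ℓ : Fin 0 → ℝ),
      restrMatrix (fun _ : Param p => (0 : Fin 0 → ℝ)) t *ᵥ ℓ = 0 := fun t ℓ => by
    funext j
    simp [mulVec, dotProduct]
  have h2 : ∀ (n : ℕ) (x : Fin n → 𝒳), (est n x ∈ Θ ∧ estFun μ f β x (est n x) = 0) ↔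
      (est n x ∈ nullSpace Θ (fun _ => (0 : Fin 0 → ℝ)) ∧ ∃ ℓ : Fin 0 → ℝ,
        estFun μ f β x (est n x) + restrMatrix (fun _ => (0 : Fin 0 → ℝ)) (est n x) *ᵥ ℓ = 0) := by
    intro n x
    simp only [h1, add_zero, exists_const]
    exact and_congr_left fun _ => ⟨fun h => ⟨h, rfl⟩, fun h => h.1⟩
  refine ⟨fun h => ⟨h.measurable, h.consistent, ?_⟩, fun h => ⟨h.measurable, h.consistent, ?_⟩⟩
  · simpa only [h2] using h.root
  · simpa only [h2] using h.root

end Problems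

/-! ### Asymptotics of the pair of estimators and of the test -/

section Test

variable {p r : ℕ} {𝒳 Ω : Type*} [MeasurableSpace 𝒳] [MeasurableSpace Ω] {μ : Measure 𝒳}
  {Θ : Set (Param p)} {f : Param p → 𝒳 → ℝ} {h : Param p → Fin r → ℝ} {h₁ : Param p → Fin 0 → ℝ}
  {β γ lam : ℝ} {θs θ₀ : Param p} {P : Measure Ω} [IsProbabilityMeasure P] {X : ℕ → Ω → 𝒳}
  {est rest : (n : ℕ) → (Fin n → 𝒳) → Param p}

/-- The joint influence function of the unrestricted and the restricted estimator. -/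
noncomputable def pairInfluence (μ : Measure 𝒳) (f : Param p → 𝒳 → ℝ) (h₁ : Param p → Fin 0 → ℝ)
    (h : Param p → Fin r → ℝ) (β : ℝ) (θs θ₀ : Param p) (x : 𝒳) : Param p × Param p :=
  (influence μ f h₁ β (f θs) θs x, influence μ f h β (f θs) θ₀ x)

theorem integrable_pairInfluence (hp₁ : RestrictedProblem μ Θ f h₁ β θs θs)
    (hp : RestrictedProblem μ Θ f h β θs θ₀) :
    Integrable (pairInfluence μ f h₁ h β θs θ₀) (law μ (f θs)) :=
  hp₁.integrable_influence.prodMk hp.integrable_influence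

theorem memLp_pairInfluence (hp₁ : RestrictedProblem μ Θ f h₁ β θs θs)
    (hp : RestrictedProblem μ Θ f h β θs θ₀) (i : Fin p ⊕ Fin p) :
    MemLp (fun x => pairLp (pairInfluence μ f h₁ h β θs θ₀ x) i) 2 (law μ (f θs)) := by
  rcases i with i | i
  · exact hp₁.memLp_influence i
  · exact hp.memLp_influence i

theorem holdsWHP_pair_linearization (hp₁ : RestrictedProblem μ Θ f h₁ β θs θs)
    (hp : RestrictedProblem μ Θ f h β θs θ₀) (hX : IsIID P (law μ (f θs)) X)
    (hest : IsConsistentRestrictedRoot μ Θ h₁ f β P X θs est)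
    (hrest : IsConsistentRestrictedRoot μ Θ h f β P X θ₀ rest) {ε : ℝ} (hε : 0 < ε) :
    HoldsWHP P fun n ω => ‖√n • ((est n (sample X n ω), rest n (sample X n ω)) - (θs, θ₀))
      - √n • (sampleMean (pairInfluence μ f h₁ h β θs θ₀) (sample X n ω)
        - ∫ x, pairInfluence μ f h₁ h β θs θ₀ x ∂(law μ (f θs)))‖ < ε := by
  refine ((hp₁.holdsWHP_linearization hX hest hε).and
    (hp.holdsWHP_linearization hX hrest hε)).mono fun n ω hA => ?_
  have hU := integrable_pairInfluence hp₁ hp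
  have h1 : (sampleMean (pairInfluence μ f h₁ h β θs θ₀) (sample X n ω)).1
      = sampleMean (influence μ f h₁ β (f θs) θs) (sample X n ω) :=
    clm_sampleMean (ContinuousLinearMap.fst ℝ (Param p) (Param p)) _ _
  have h2 : (sampleMean (pairInfluence μ f h₁ h β θs θ₀) (sample X n ω)).2
      = sampleMean (influence μ f h β (f θs) θ₀) (sample X n ω) :=
    clm_sampleMean (ContinuousLinearMap.snd ℝ (Param p) (Param p)) _ _
  have h3 : (∫ x, pairInfluence μ f h₁ h β θs θ₀ x ∂(law μ (f θs))).1
      = ∫ x, influence μ f h₁ β (f θs) θs x ∂(law μ (f θs)) :=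
    ((ContinuousLinearMap.fst ℝ (Param p) (Param p)).integral_comp_comm hU).symm
  have h4 : (∫ x, pairInfluence μ f h₁ h β θs θ₀ x ∂(law μ (f θs))).2
      = ∫ x, influence μ f h β (f θs) θ₀ x ∂(law μ (f θs)) :=
    ((ContinuousLinearMap.snd ℝ (Param p) (Param p)).integral_comp_comm hU).symm
  rw [Prod.norm_def, max_lt_iff]
  simp only [Prod.fst_sub, Prod.snd_sub, Prod.smul_fst, Prod.smul_snd, h1, h2, h3, h4]
  exact hA

theorem IsIID.measurable_sample {P : Measure Ω} (hX : IsIID P (law μ (f θs)) X) (n : ℕ) :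
    Measurable (sample X n) :=
  measurable_pi_lambda _ fun i => hX.measurable i

theorem holdsWHP_pair_consistent {P : Measure Ω}
    (hest : IsConsistentRestrictedRoot μ Θ h₁ f β P X θs est)
    (hrest : IsConsistentRestrictedRoot μ Θ h f β P X θ₀ rest) (ε : ℝ) (hε : 0 < ε) :
    HoldsWHP P fun n ω => ‖(est n (sample X n ω), rest n (sample X n ω)) - (θs, θ₀)‖ < ε := by
  refine ((tendstoInMeasure_iff_holdsWHP.1 hest.consistent ε hε).and
    (tendstoInMeasure_iff_holdsWHP.1 hrest.consistent ε hε)).mono fun n ω hA => ?_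
  rw [Prod.norm_def, max_lt_iff]
  exact hA

/-- Central limit theorem for the pair of influence functions, transferred by Slutsky's theorem
through the joint linearization. -/
theorem tendstoInDistribution_pair (hp₁ : RestrictedProblem μ Θ f h₁ β θs θs)
    (hp : RestrictedProblem μ Θ f h β θs θ₀) (hJ : IsUnit (matJ μ f β (f θs) θs).det)
    (hX : IsIID P (law μ (f θs)) X)
    (hest : IsConsistentRestrictedRoot μ Θ h₁ f β P X θs est)
    (hrest : IsConsistentRestrictedRoot μ Θ h f β P X θ₀ rest) :
    TendstoInDistribution
      (fun (n : ℕ) ω => WithLp.toLp 2 (Sum.elim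
        (fun j => √n * (est n (sample X n ω) j - θs j))
        (fun j => √n * (rest n (sample X n ω) j - θ₀ j))))
      atTop (id : EuclideanSpace ℝ (Fin p ⊕ Fin p) → _) (fun _ => P)
      (multivariateGaussian 0 (covJoint μ f h β θs θ₀)) := by
  have hU := integrable_pairInfluence hp₁ hp
  have h1 := hX.tendstoInDistribution_sampleMean_euclidean
    (W := fun x => pairLp (pairInfluence μ f h₁ h β θs θ₀ x)) (memLp_pairInfluence hp₁ hp)
  have hcov : covMatrix (law μ (f θs)) (fun x => pairLp (pairInfluence μ f h₁ h β θs θ₀ x))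
      = covJoint μ f h β θs θ₀ := covMatrix_influence hp₁ hp hJ
  rw [hcov] at h1
  refine tendstoInDistribution_of_tendstoInMeasure_sub _ _ h1 ?_ fun n => ?_
  · refine tendstoInMeasure_iff_holdsWHP.2 fun ε hε => ?_
    have hτ : 0 < ε / (‖pairLp (p := p)‖ + 1) := by positivity
    refine (holdsWHP_pair_linearization hp₁ hp hX hest hrest hτ).mono fun n ω hA => ?_
    have h2 : WithLp.toLp 2 (Sum.elim
          (fun j => √n * (est n (sample X n ω) j - θs j))
          (fun j => √n * (rest n (sample X n ω) j - θ₀ j)))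
        - √n • (sampleMean (fun x => pairLp (pairInfluence μ f h₁ h β θs θ₀ x)) (sample X n ω)
          - ∫ x, pairLp (pairInfluence μ f h₁ h β θs θ₀ x) ∂(law μ (f θs)))
        = pairLp (√n • ((est n (sample X n ω), rest n (sample X n ω)) - (θs, θ₀))
          - √n • (sampleMean (pairInfluence μ f h₁ h β θs θ₀) (sample X n ω)
            - ∫ x, pairInfluence μ f h₁ h β θs θ₀ x ∂(law μ (f θs)))) := by
      rw [map_sub pairLp (√n • ((est n (sample X n ω), rest n (sample X n ω)) - (θs, θ₀))),
        map_smul pairLp _ (sampleMean _ _ - _), map_sub pairLp (sampleMean _ _), clm_sampleMean,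
        ← ContinuousLinearMap.integral_comp_comm _ hU]
      congr 1
    have h3 : ‖WithLp.toLp 2 (Sum.elim
          (fun j => √n * (est n (sample X n ω) j - θs j))
          (fun j => √n * (rest n (sample X n ω) j - θ₀ j)))
        - √n • (sampleMean (fun x => pairLp (pairInfluence μ f h₁ h β θs θ₀ x)) (sample X n ω)
          - ∫ x, pairLp (pairInfluence μ f h₁ h β θs θ₀ x) ∂(law μ (f θs)))‖ < ε := by
      rw [h2]
      refine (pairLp.le_opNorm _).trans_lt ?_
      calc ‖pairLp (p := p)‖ * _ ≤ ‖pairLp (p := p)‖ * (ε / (‖pairLp (p := p)‖ + 1)) := by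
            gcongr
        _ < ε := by
          rw [mul_div_assoc', div_lt_iff₀ (by positivity)]
          nlinarith [norm_nonneg (pairLp (p := p))]
    simpa using h3
  · have hs := hX.measurable_sample n
    have h2 : Measurable fun ω =>
        pairLp (√n • ((est n (sample X n ω), rest n (sample X n ω)) - (θs, θ₀))) :=
      pairLp.continuous.measurable.comp
        (((((hest.measurable n).comp hs).prodMk ((hrest.measurable n).comp hs)).sub_const
          (θs, θ₀)).const_smul (√n : ℝ))
    refine h2.aemeasurable.congr (Eventually.of_forall fun ω => ?_)
    ext i
    rcases i with i | i <;> rfl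

end Test

/-! ### Power and consistency of the test. -/

section Power

variable {p r : ℕ} {𝒳 Ω : Type*} [MeasurableSpace 𝒳] [MeasurableSpace Ω] {μ : Measure 𝒳}
  {Θ : Set (Param p)} {f : Param p → 𝒳 → ℝ} {h : Param p → Fin r → ℝ} {h₁ : Param p → Fin 0 → ℝ}
  {β γ lam : ℝ} {θs θ₀ : Param p} {P : Measure Ω} [IsProbabilityMeasure P] {X : ℕ → Ω → 𝒳}
  {est rest : (n : ℕ) → (Fin n → 𝒳) → Param p}

theorem fderiv_sDiv_single (hdiff : DifferentiableAt ℝ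
      (fun q : Param p × Param p => sDiv μ γ lam (f q.1) (f q.2)) (θs, θ₀)) :
    Sum.elim
      (fun j => fderiv ℝ (fun q : Param p × Param p => sDiv μ γ lam (f q.1) (f q.2)) (θs, θ₀)
        (EuclideanSpace.single j 1, 0))
      (fun j => fderiv ℝ (fun q : Param p × Param p => sDiv μ γ lam (f q.1) (f q.2)) (θs, θ₀)
        (0, EuclideanSpace.single j 1))
      = Sum.elim (gradM1 μ f γ lam θs θ₀) (gradM2 μ f γ lam θs θ₀) := by
  have h1 := hdiff.hasFDerivAt.comp (𝕜 := ℝ) θs (hasFDerivAt_prodMk_left θs θ₀)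
  have h2 := hdiff.hasFDerivAt.comp (𝕜 := ℝ) θ₀ (hasFDerivAt_prodMk_right θs θ₀)
  funext i
  rcases i with j | j
  · exact (congrArg (fun L : Param p →L[ℝ] ℝ => L (EuclideanSpace.single j 1)) h1.fderiv).symm
  · exact (congrArg (fun L : Param p →L[ℝ] ℝ => L (EuclideanSpace.single j 1)) h2.fderiv).symm

/-- The normal approximation to the power, uniformly over all critical values. -/
theorem eventually_forall_abs_power_sub_lt (hp₁ : RestrictedProblem μ Θ f h₁ β θs θs)
    (hp : RestrictedProblem μ Θ f h β θs θ₀) (hJ : IsUnit (matJ μ f β (f θs) θs).det)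
    (hX : IsIID P (law μ (f θs)) X)
    (hdiff : DifferentiableAt ℝ
      (fun q : Param p × Param p => sDiv μ γ lam (f q.1) (f q.2)) (θs, θ₀))
    (hest : IsConsistentRestrictedRoot μ Θ h₁ f β P X θs est)
    (hrest : IsConsistentRestrictedRoot μ Θ h f β P X θ₀ rest)
    (hσ : 0 < sigmaSq μ f h β γ lam θs θ₀) {ε : ℝ} (hε : 0 < ε) :
    ∀ᶠ n in atTop, ∀ c : ℝ, |power μ f γ lam est rest P X n c
      - powerApprox μ f h β γ lam θs θ₀ n c| < ε := by
  have := hp.model.isProbabilityMeasure_law hp.mem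
  have hU := integrable_pairInfluence hp₁ hp
  have hLp := memLp_pairInfluence hp₁ hp
  set U := pairInfluence μ f h₁ h β θs θ₀ with hUdef
  set S : Param p × Param p → ℝ := fun q => sDiv μ γ lam (f q.1) (f q.2) with hS
  set S' := fderiv ℝ S (θs, θ₀) with hS'
  set m := Sum.elim (gradM1 μ f γ lam θs θ₀) (gradM2 μ f γ lam θs θ₀) with hm
  -- The derivative of the divergence applied to the joint influence function is a scalar function
  -- of one observation, and its variance is the quadratic form `sigmaSq`.
  have hφ : (fun x => S' (U x)) = fun x => ∑ i, m i * pairLp (U x) i := by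
    funext x
    rw [clm_pair_eq_sum, fderiv_sDiv_single hdiff]
  have hφLp : MemLp (fun x => S' (U x)) 2 (law μ (f θs)) := by
    rw [hφ]
    exact memLp_finsetSum _ fun i _ => (hLp i).const_mul _
  have hvar : Var[fun x => S' (U x); law μ (f θs)] = sigmaSq μ f h β γ lam θs θ₀ := by
    rw [hφ, variance_inner_eq (W := fun x => pairLp (U x)) hLp, sigmaSq_eq,
      ← covMatrix_influence hp₁ hp hJ]
    rfl
  have hclt := hX.tendstoInDistribution_sampleMean hφLp
  rw [hvar] at hclt
  have hV := boundedInProb_pair hX hU hLp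
  have hdelta := fun δ (hδ : 0 < δ) => holdsWHP_delta (ε := δ) hdiff.hasFDerivAt
    (holdsWHP_pair_consistent hest hrest) hV
    (fun τ hτ => holdsWHP_pair_linearization hp₁ hp hX hest hrest hτ) hδ
  -- Away from the limiting pair nothing makes the divergence measurable in the parameters, so the
  -- version for nonmeasurable `Z` is used.
  have htail := eventually_forall_abs_tail_sub_lt
    (Z := fun n ω => √n * (S (est n (sample X n ω), rest n (sample X n ω)) - S (θs, θ₀)))
    (v := (sigmaSq μ f h β γ lam θs θ₀).toNNReal) (Real.toNNReal_pos.2 hσ).ne' hclt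
    (fun δ hδ => (hdelta δ hδ).mono fun n ω hA => by
      rwa [map_smul, map_sub, clm_sampleMean, ← ContinuousLinearMap.integral_comp_comm _ hU] at hA)
    hε
  filter_upwards [htail, eventually_gt_atTop 0] with n hn hn0 c
  have hn' : (0 : ℝ) < n := by exact_mod_cast hn0
  have hsq : 0 < √(n : ℝ) := Real.sqrt_pos.2 hn'
  -- The threshold depends on `n` as well as on `c`; uniformity in the threshold makes the
  -- substitution harmless.
  have h1 := hn (√n * (c / (2 * n) - S (θs, θ₀)))
  have h2 : {ω | √n * (c / (2 * n) - S (θs, θ₀))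
      < √n * (S (est n (sample X n ω), rest n (sample X n ω)) - S (θs, θ₀))}
      = {ω | c < testStat μ f γ lam est rest n (sample X n ω)} := by
    ext ω
    change √n * (c / (2 * n) - S (θs, θ₀))
      < √n * (S (est n (sample X n ω), rest n (sample X n ω)) - S (θs, θ₀)) ↔
        c < 2 * n * S (est n (sample X n ω), rest n (sample X n ω))
    rw [mul_lt_mul_iff_right₀ hsq, sub_lt_sub_iff_right, div_lt_iff₀' (by positivity)]
  rw [h2, Real.coe_toNNReal _ hσ.le, mul_div_right_comm] at h1
  exact h1

/-- The test is consistent, whatever the critical value. -/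
theorem tendsto_power_one (hS : 0 < sDiv μ γ lam (f θs) (f θ₀))
    (hdiff : DifferentiableAt ℝ
      (fun q : Param p × Param p => sDiv μ γ lam (f q.1) (f q.2)) (θs, θ₀))
    (hest : IsConsistentRestrictedRoot μ Θ h₁ f β P X θs est)
    (hrest : IsConsistentRestrictedRoot μ Θ h f β P X θ₀ rest) (c : ℝ) :
    Tendsto (fun n => power μ f γ lam est rest P X n c) atTop (𝓝 1) := by
  have hcont := hdiff.continuousAt.eventually (lt_mem_nhds (half_lt_self hS))
  obtain ⟨δ, hδ, hnear⟩ := Metric.eventually_nhds_iff.1 hcont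
  refine HoldsWHP.tendsto_measure_one
    ((holdsWHP_pair_consistent hest hrest δ hδ).mono_eventually ?_)
  -- Near the limits the divergence exceeds half its limiting value, so the statistic is at least
  -- `n` times that value, which passes `|c|` for large `n`.
  filter_upwards [(tendsto_natCast_atTop_atTop (R := ℝ)).eventually_gt_atTop
    (|c| / sDiv μ γ lam (f θs) (f θ₀))] with n hn ω hA
  rw [← dist_eq_norm] at hA
  have h1 : sDiv μ γ lam (f θs) (f θ₀) / 2
      < sDiv μ γ lam (f (est n (sample X n ω))) (f (rest n (sample X n ω))) := hnear hA
  rw [div_lt_iff₀ hS] at hn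
  have h2 : (0 : ℝ) ≤ n := Nat.cast_nonneg n
  change c < 2 * n * _
  nlinarith [le_abs_self c]

end Power

end SDivTest

theorem theorem4 {p r : ℕ} {𝒳 Ω : Type*} [MeasurableSpace 𝒳] [MeasurableSpace Ω]
    -- the model and the null hypothesis
    (μ : Measure 𝒳) [SigmaFinite μ] (Θ : Set (Param p)) (f : Param p → 𝒳 → ℝ)
    (hmodel : IsModel μ Θ f) (h : Param p → Fin r → ℝ)
    -- the tuning parameters
    (β γ lam : ℝ) (hβ : 0 ≤ β) (hγ : γ ∈ Set.Icc (0 : ℝ) 1)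
    -- the true parameter, with the regularity conditions in the full parameter space
    (θs : Param p) (hθs : θs ∈ Θ) (hθs_alt : θs ∉ nullSpace Θ h)
    (hreg : IsRegularAt μ Θ f β (f θs) θs) (hJ : (matJ μ f β (f θs) θs).PosDef)
    -- the restricted best fitting parameter, with the regularity conditions in the null space
    (θ₀ : Param p) (hθ₀ : θ₀ ∈ nullSpace Θ h)
    (hbest : IsLocalMinOn (dpdRisk μ f β (f θs)) (nullSpace Θ h) θ₀)
    (hh : ContDiffAt ℝ 2 h θ₀) (hH : (restrMatrix h θ₀).rank = r)
    (hreg₀ : IsRegularAt μ Θ f β (f θs) θ₀)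
    (hJ₀ : ∀ v : Fin p → ℝ, v ≠ 0 → (restrMatrix h θ₀)ᵀ *ᵥ v = 0 →
      0 < v ⬝ᵥ matJres μ f h β (f θs) θ₀ *ᵥ v)
    -- the divergence is finite near, and differentiable at, the pair of limiting parameters
    (hfin : ∀ᶠ q : Param p × Param p in 𝓝 (θs, θ₀), SDivFinite μ γ lam (f q.1) (f q.2))
    (hdiff : DifferentiableAt ℝ
      (fun q : Param p × Param p => sDiv μ γ lam (f q.1) (f q.2)) (θs, θ₀))
    -- the observations
    (P : Measure Ω) [IsProbabilityMeasure P] (X : ℕ → Ω → 𝒳) (hX : ∀ i, Measurable (X i))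
    (hindep : iIndepFun X P) (hlaw : ∀ i, P.map (X i) = law μ (f θs)) :
    (∃ est rest : (n : ℕ) → (Fin n → 𝒳) → Param p,
      IsConsistentRoot μ Θ f β P X θs est ∧
      IsConsistentRestrictedRoot μ Θ h f β P X θ₀ rest) ∧
    ∀ est rest : (n : ℕ) → (Fin n → 𝒳) → Param p,
      IsConsistentRoot μ Θ f β P X θs est →
      IsConsistentRestrictedRoot μ Θ h f β P X θ₀ rest →
      -- joint asymptotic normality of the estimators
      TendstoInDistribution
        (fun (n : ℕ) ω => WithLp.toLp 2 (Sum.elim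
          (fun j => √n * (est n (sample X n ω) j - θs j))
          (fun j => √n * (rest n (sample X n ω) j - θ₀ j))))
        atTop (id : EuclideanSpace ℝ (Fin p ⊕ Fin p) → _) (fun _ => P)
        (multivariateGaussian 0 (covJoint μ f h β θs θ₀)) ∧
      -- the approximation to the power, uniformly over all critical values and at each `t_α`
      (0 < sigmaSq μ f h β γ lam θs θ₀ →
        (∀ ε > 0, ∀ᶠ n in atTop, ∀ c : ℝ,
          |power μ f γ lam est rest P X n c - powerApprox μ f h β γ lam θs θ₀ n c| < ε) ∧
        ∀ α ∈ Set.Ioo (0 : ℝ) 1, Tendsto (fun n =>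
          power μ f γ lam est rest P X n (critValue μ f h β γ θ₀ α)
            - powerApprox μ f h β γ lam θs θ₀ n (critValue μ f h β γ θ₀ α)) atTop (𝓝 0)) ∧
      -- consistency of the test
      ∀ α ∈ Set.Ioo (0 : ℝ) 1, Tendsto (fun n =>
        power μ f γ lam est rest P X n (critValue μ f h β γ θ₀ α)) atTop (𝓝 1) := by
  have hiid : IsIID P (law μ (f θs)) X := ⟨hX, hindep, hlaw⟩
  have hp₁ := RestrictedProblem.unrestricted hmodel hβ hθs hreg hJ
  have hp : RestrictedProblem μ Θ f h β θs θ₀ :=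
    ⟨hmodel, hβ, hθs, hθ₀, hh, hH, hreg₀, hJ₀,
      hreg₀.exists_multiplier hmodel hθs hθ₀ hbest hh hH⟩
  have hdet : IsUnit (matJ μ f β (f θs) θs).det := hJ.det_pos.ne'.isUnit
  -- Equal laws would force `θs = θ₀` by identifiability and put the true parameter in the null
  -- space.
  have hpos : 0 < sDiv μ γ lam (f θs) (f θ₀) :=
    sDiv_pos hγ.1 (hmodel.nonneg θs hθs) (hmodel.nonneg θ₀ hθ₀.1)
      (hmodel.common_support θs hθs θ₀ hθ₀.1) hfin.self_of_nhds fun heq =>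
        hθs_alt (hmodel.identifiable θs hθs θ₀ hθ₀.1 heq ▸ hθ₀)
  constructor
  · obtain ⟨est, hest⟩ := hp₁.exists_isConsistentRestrictedRoot hiid
    obtain ⟨rest, hrest⟩ := hp.exists_isConsistentRestrictedRoot hiid
    exact ⟨est, rest, isConsistentRoot_iff.2 hest, hrest⟩
  intro est rest hest hrest
  rw [isConsistentRoot_iff] at hest
  refine ⟨tendstoInDistribution_pair hp₁ hp hdet hiid hest hrest, fun hσ => ?_, fun α _ =>
    tendsto_power_one hpos hdiff hest hrest _⟩
  have hunif := fun ε (hε : ε > 0) =>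
    eventually_forall_abs_power_sub_lt hp₁ hp hdet hiid hdiff hest hrest hσ hε
  refine ⟨hunif, fun α _ => Metric.tendsto_atTop'.2 fun ε hε => ?_⟩
  obtain ⟨N, hN⟩ := eventually_atTop.1 (hunif ε hε)
  refine ⟨N, fun n hn => ?_⟩
  rw [Real.dist_eq, sub_zero]
  exact hN n hn.le _
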